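/- Let $n\ge 2$ and let $\mathbf p=(p_1,\dots,p_n)$ be real exponents. Put $\overline p=\bigl(\frac1n\sum_{i=1}^n\frac1{p_i}\bigr)^{-1}$, $\mathcal P=\max\{p_1,\dots,p_n\}$, $P=\max\{2,\mathcal P\}$, and assume $$1<p_i<\overline p\Bigl(1+\frac2n\Bigr)\ \ (i=1,\dots,n),\qquad \overline p<n,\qquad \overline p>\frac{2n}{n+2}.$$ Setting. Let $\Omega\subset\mathbb R^n$ be a bounded domain, $0<T<\infty$, $\Omega_T=\Omega\times(0,T)$, $\delta_1,\dots,\delta_n\ge0$ and $\mathcal C>0$. For $\rho>0$, $x_0\in\mathbb R^n$, $t_0\in\mathbb R$ let $$K_\rho(x_0)=\prod_{i=1}^n\bigl(x_{0,i}-\rho^{1/p_i},\,x_{0,i}+\rho^{1/p_i}\bigr),\qquad Q_\rho(x_0,t_0)=K_\rho(x_0)\times(t_0-\rho,t_0).$$ An admissible cut-off function for $Q_\rho(x_0,t_0)$ is a function $\zeta\in C^\infty(\mathbb R^{n+1})$ of the form $\zeta(x,t)=\psi(t)\prod_{i=1}^n\zeta_i(x_i)^{p_i}$, where $\psi\in C^\infty(\mathbb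 R;[0,1])$ is non-decreasing, $\psi=0$ on $(-\infty,t_0-\rho+\epsilon/2]$ and $\psi=1$ on $[t_0-\rho+\epsilon,\infty)$ for some $\epsilon\in(0,\rho)$, and $\zeta_i\in C_0^\infty(\mathbb R;[0,1])$ with $\operatorname{supp}\zeta_i\subset(x_{0,i}-\rho^{1/p_i},x_{0,i}+\rho^{1/p_i})$. The class $\mathcal{DG}^{+}(\mathbf p,\{\delta_i\},\Omega_T,\mathcal C)$ consists of the measurable functions $u:\Omega_T\to\mathbb R$ such that $u\in L^P_{loc}(\Omega_T)$, $u\in L^1_{loc}(0,T;W^{1,1}_{loc}(\Omega))$, the weak spatial derivatives satisfy $\partial_{x_i}u\in L^{p_i}_{loc}(\Omega_T)$ for all $i$, and, for every $Q_\rho(x_0,t_0)\Subset\Omega_T$, every admissible cut-off function $\zeta$ for it and every $k\in\mathbb R$, $$\operatorname*{ess\,sup}_{t_0-\rho<\tau<t_0}\int_{K_\rho(x_0)}(u-k)_+^2\,\zeta(x,\tau)\,dx+\sum_{i=1}^n\iint_{Q_\rho(x_0,t_0)}(|\partial_{x_i}u|-\delta_i)_+^{p_i}\,\zeta\,\mathbf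 1_{\{u>k\}}\,dx\,dt$$ $$\le\mathcal C\iint_{Q_\rho(x_0,t_0)}(u-k)_+^2\,\partial_t\zeta\,dx\,dt+\mathcal C\sum_{i=1}^n\iint_{Q_\rho(x_0,t_0)}(u-k)_+^{p_i}\,\bigl|\partial_{x_i}\zeta^{1/p_i}\bigr|^{p_i}\,dx\,dt.$$ The class $\mathcal{DG}^{-}(\mathbf p,\{\delta_i\},\Omega_T,\mathcal C)$ is defined in the same way with $(u-k)_-$ in place of $(u-k)_+$ and $\mathbf 1_{\{u<k\}}$ in place of $\mathbf 1_{\{u>k\}}$; here $v_+=\max\{v,0\}$ and $v_-=\max\{-v,0\}$. Theorem. There is a constant $C>0$, depending only on $n$, $\mathbf p$, $\mathcal C$ and $\max\{\delta_1,\dots,\delta_n\}$, with the following properties. (i) Every $u\in\mathcal{DG}^{+}(\mathbf p,\{\delta_i\},\Omega_T,\mathcal C)$ is locally essentially bounded from above in $\Omega_T$ and, for every $Q_\rho(x_0,t_0)\Subset\Omega_T$ and every $\sigma\in(0,1)$, $$\operatorname*{ess\,sup}_{Q_{\sigma\rho}(x_0,t_0)}u\le\max\Bigl\{1,\ \rho^{1/P},\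 C\Bigl[(1-\sigma)^{-\frac{\mathcal P(n+\overline p)}{\overline p}}\,\frac1{|Q_\rho(x_0,t_0)|}\iint_{Q_\rho(x_0,t_0)}u_+^P\,dx\,dt\Bigr]^{\frac{\overline p}{\overline p(n+2)-nP}}\Bigr\}.$$ (ii) Every $u\in\mathcal{DG}^{-}(\mathbf p,\{\delta_i\},\Omega_T,\mathcal C)$ is locally essentially bounded from below in $\Omega_T$ and, for every $Q_\rho(x_0,t_0)\Subset\Omega_T$ and every $\sigma\in(0,1)$, $$\operatorname*{ess\,inf}_{Q_{\sigma\rho}(x_0,t_0)}u\ge-\max\Bigl\{1,\ \rho^{1/P},\ C\Bigl[(1-\sigma)^{-\frac{\mathcal P(n+\overline p)}{\overline p}}\,\frac1{|Q_\rho(x_0,t_0)|}\iint_{Q_\rho(x_0,t_0)}u_-^P\,dx\,dt\Bigr]^{\frac{\overline p}{\overline p(n+2)-nP}}\Bigr\}.$$ -/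

import Mathlib

open MeasureTheory Set
open scoped ENNReal ContDiff

namespace AnisoDG

noncomputable section

variable {n : ℕ}

/-- Points `(x, t)` of `ℝⁿ × ℝ`. Only the topology and the Lebesgue measure of `ℝⁿ` are used. -/
abbrev SpaceTime (n : ℕ) : Type := (Fin n → ℝ) × ℝ

/-- The harmonic average of the exponents. -/
def pbar (p : Fin n → ℝ) : ℝ := ((1 / (n : ℝ)) * ∑ i, 1 / p i)⁻¹

/-- The largest exponent `max {p₁, …, pₙ}`. -/
def pmax (p : Fin n → ℝ) : ℝ := ⨆ i, p i

/-- `max {2, p₁, …, pₙ}`. -/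
def bigP (p : Fin n → ℝ) : ℝ := max 2 (pmax p)

/-- The anisotropic open box `∏ᵢ (x₀ᵢ - ρ^(1/pᵢ), x₀ᵢ + ρ^(1/pᵢ))`. -/
def box (p : Fin n → ℝ) (x₀ : Fin n → ℝ) (ρ : ℝ) : Set (Fin n → ℝ) :=
  Set.univ.pi fun i => Ioo (x₀ i - ρ ^ (1 / p i)) (x₀ i + ρ ^ (1 / p i))

/-- The backward cylinder with vertex `(x₀, t₀)`. -/
def cyl (p : Fin n → ℝ) (x₀ : Fin n → ℝ) (t₀ ρ : ℝ) : Set (SpaceTime n) :=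
  box p x₀ ρ ×ˢ Ioo (t₀ - ρ) t₀

/-- The space-time domain `Ω × (0, T)`. -/
def parDomain (Ω : Set (Fin n → ℝ)) (T : ℝ) : Set (SpaceTime n) := Ω ×ˢ Ioo 0 T

/-- `f ∈ L^q_loc(S)`: `f` is in `L^q` of every compact subset of `S`. -/
def MemLpLoc {X : Type*} [TopologicalSpace X] [MeasureSpace X]
    (q : ℝ) (f : X → ℝ) (S : Set X) : Prop :=
  ∀ K : Set X, K ⊆ S → IsCompact K → MemLp f (ENNReal.ofReal q) (volume.restrict K)

/-- The classical partial derivative `∂φ/∂xᵢ`. -/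
def partialX (i : Fin n) (φ : (Fin n → ℝ) → ℝ) (x : Fin n → ℝ) : ℝ :=
  deriv (fun s => φ (Function.update x i s)) (x i)

/-- `v, w ∈ L¹_loc(Ω)` and `w` is the weak partial derivative `∂v/∂xᵢ` in `Ω`. -/
def HasWeakPartial (Ω : Set (Fin n → ℝ)) (i : Fin n) (v w : (Fin n → ℝ) → ℝ) : Prop :=
  MemLpLoc 1 v Ω ∧ MemLpLoc 1 w Ω ∧
    ∀ φ : (Fin n → ℝ) → ℝ, ContDiff ℝ ∞ φ → HasCompactSupport φ → tsupport φ ⊆ Ω →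
      ∫ x in Ω, v x * partialX i φ x = -∫ x in Ω, w x * φ x

/-- `u ∈ L^𝐩_loc(0,T; W^{1,𝐩}_loc(Ω))` with weak spatial gradient `g`: `u` and `g` are in
`L¹_loc(Ω_T)`, for a.e. `t` the slice `g(·,t)` is the weak gradient of `u(·,t)` in `Ω`
(that is, `u ∈ L¹_loc(0,T; W^{1,1}_loc(Ω))`), and `gᵢ ∈ L^{pᵢ}_loc(Ω_T)`. -/
structure MemParabolicSobolev (p : Fin n → ℝ) (Ω : Set (Fin n → ℝ)) (T : ℝ)
    (u : SpaceTime n → ℝ) (g : Fin n → SpaceTime n → ℝ) : Prop where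
  locInt : MemLpLoc 1 u (parDomain Ω T)
  grad_locInt : ∀ i, MemLpLoc 1 (g i) (parDomain Ω T)
  weakGrad : ∀ᵐ t ∂(volume.restrict (Ioo 0 T)),
    ∀ i, HasWeakPartial Ω i (fun x => u (x, t)) (fun x => g i (x, t))
  grad_memLp : ∀ i, MemLpLoc (p i) (g i) (parDomain Ω T)

/-- Admissible cut-off functions for the cylinder with vertex `(x₀, t₀)` and radius `ρ`:
smooth functions of the form `ψ(t) ∏ᵢ ζᵢ(xᵢ)^{pᵢ}`. -/
def IsCutoff (p : Fin n → ℝ) (x₀ : Fin n → ℝ) (t₀ ρ : ℝ) (ζ : SpaceTime n → ℝ) : Prop :=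
  ContDiff ℝ ∞ ζ ∧
  ∃ (ψ : ℝ → ℝ) (ε : ℝ) (η : Fin n → ℝ → ℝ),
    (ContDiff ℝ ∞ ψ ∧ Monotone ψ ∧ (∀ t, ψ t ∈ Icc (0 : ℝ) 1) ∧ ε ∈ Ioo 0 ρ ∧
      (∀ t ≤ t₀ - ρ + ε / 2, ψ t = 0) ∧ (∀ t, t₀ - ρ + ε ≤ t → ψ t = 1)) ∧
    (∀ i, ContDiff ℝ ∞ (η i) ∧ HasCompactSupport (η i) ∧ (∀ s, η i s ∈ Icc (0 : ℝ) 1) ∧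
      tsupport (η i) ⊆ Ioo (x₀ i - ρ ^ (1 / p i)) (x₀ i + ρ ^ (1 / p i))) ∧
    ∀ x t, ζ (x, t) = ψ t * ∏ i, (η i (x i)) ^ (p i)

/-- The energy inequality on one cylinder for a truncation `w ≥ 0` and its level set `A`:
`ess sup_τ ∫ w² ζ(·,τ) dx + ∑ᵢ ∬ (|gᵢ| - δᵢ)₊^{pᵢ} ζ 1_A
  ≤ c ∬ w² ∂ₜζ + c ∑ᵢ ∬ w^{pᵢ} |∂ᵢ ζ^{1/pᵢ}|^{pᵢ}`.
All integrands are non-negative, and the integrals are taken in `[0, ∞]`. -/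
def EnergyIneq (p δ : Fin n → ℝ) (c : ℝ) (x₀ : Fin n → ℝ) (t₀ ρ : ℝ)
    (ζ w : SpaceTime n → ℝ) (A : Set (SpaceTime n)) (g : Fin n → SpaceTime n → ℝ) : Prop :=
  essSup (fun τ => ∫⁻ x in box p x₀ ρ, ENNReal.ofReal (w (x, τ) ^ 2 * ζ (x, τ)))
      (volume.restrict (Ioo (t₀ - ρ) t₀))
    + ∑ i, ∫⁻ z in cyl p x₀ t₀ ρ,
        A.indicator (fun z => ENNReal.ofReal ((max (|g i z| - δ i) 0) ^ (p i) * ζ z)) z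
  ≤ ENNReal.ofReal c * (∫⁻ z in cyl p x₀ t₀ ρ,
        ENNReal.ofReal (w z ^ 2 * deriv (fun s => ζ (z.1, s)) z.2))
    + ENNReal.ofReal c * ∑ i, ∫⁻ z in cyl p x₀ t₀ ρ,
        ENNReal.ofReal (w z ^ (p i) *
          |partialX i (fun x => ζ (x, z.2) ^ (1 / p i)) z.1| ^ (p i))

/-- The class `DG⁺(𝐩, {δᵢ}, Ω_T, c)`. -/
def MemDGPlus (p δ : Fin n → ℝ) (Ω : Set (Fin n → ℝ)) (T c : ℝ) (u : SpaceTime n → ℝ) : Prop :=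
  AEMeasurable u (volume.restrict (parDomain Ω T)) ∧
  MemLpLoc (bigP p) u (parDomain Ω T) ∧
  ∃ g : Fin n → SpaceTime n → ℝ, MemParabolicSobolev p Ω T u g ∧
    ∀ (x₀ : Fin n → ℝ) (t₀ ρ : ℝ), 0 < ρ → closure (cyl p x₀ t₀ ρ) ⊆ parDomain Ω T →
      ∀ ζ : SpaceTime n → ℝ, IsCutoff p x₀ t₀ ρ ζ → ∀ k : ℝ,
        EnergyIneq p δ c x₀ t₀ ρ ζ (fun z => max (u z - k) 0) {z | k < u z} g

/-- The class `DG⁻(𝐩, {δᵢ}, Ω_T, c)`. -/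
def MemDGMinus (p δ : Fin n → ℝ) (Ω : Set (Fin n → ℝ)) (T c : ℝ) (u : SpaceTime n → ℝ) : Prop :=
  AEMeasurable u (volume.restrict (parDomain Ω T)) ∧
  MemLpLoc (bigP p) u (parDomain Ω T) ∧
  ∃ g : Fin n → SpaceTime n → ℝ, MemParabolicSobolev p Ω T u g ∧
    ∀ (x₀ : Fin n → ℝ) (t₀ ρ : ℝ), 0 < ρ → closure (cyl p x₀ t₀ ρ) ⊆ parDomain Ω T →
      ∀ ζ : SpaceTime n → ℝ, IsCutoff p x₀ t₀ ρ ζ → ∀ k : ℝ,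
        EnergyIneq p δ c x₀ t₀ ρ ζ (fun z => max (-(u z - k)) 0) {z | u z < k} g

/-- `u` is locally (essentially) bounded from above in `S`. -/
def LocBddAbove (u : SpaceTime n → ℝ) (S : Set (SpaceTime n)) : Prop :=
  ∀ K ⊆ S, IsCompact K → ∃ M : ℝ, ∀ᵐ z ∂(volume.restrict K), u z ≤ M

/-- `u` is locally (essentially) bounded from below in `S`. -/
def LocBddBelow (u : SpaceTime n → ℝ) (S : Set (SpaceTime n)) : Prop :=
  ∀ K ⊆ S, IsCompact K → ∃ M : ℝ, ∀ᵐ z ∂(volume.restrict K), M ≤ u z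

/-- The explicit bound, for the mean value `⨍_{Q_ρ} v^P` of a function `v ≥ 0`:
`max {1, ρ^{1/P}, C [(1-σ)^{-𝒫(n+p̄)/p̄} ⨍ v^P]^{p̄/(p̄(n+2)-nP)}}`. -/
def supBound (p : Fin n → ℝ) (C : ℝ) (x₀ : Fin n → ℝ) (t₀ ρ σ : ℝ)
    (v : SpaceTime n → ℝ) : ℝ :=
  max 1 (max (ρ ^ (1 / bigP p))
    (C * ((1 - σ) ^ (-(pmax p * ((n : ℝ) + pbar p) / pbar p)) *
        ⨍ z in cyl p x₀ t₀ ρ, v z ^ bigP p) ^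
      (pbar p / (pbar p * ((n : ℝ) + 2) - (n : ℝ) * bigP p))))

end

end AnisoDG

namespace AnisoDG

open Filter Topology Convolution

variable {n : ℕ}

/-! ### Cut-off functions -/

/-! The proof is a De Giorgi iteration. Between concentric cylinders of radii r < R the energy
inequality bounds the supremum in time of the spatial L² integral of (u - k)₊ and the truncated
gradient energies by one factor ((R - r)/R)^(-𝒫)/R times integrals of (u - k)₊² and (u - k)₊^{pᵢ}.
The scaling ρ^(1/pᵢ) of the boxes is what lets a single factor serve for time and for every
direction. Removing the δᵢ from the gradient costs a multiple of the measure of {u > k}.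

For almost every time the slice is weakly differentiable, and an anisotropic Sobolev inequality
(`sobolev_posPart`) applies. It comes from the grid-lines inequality, used with a different power of
the function in each direction and with weights chosen at the end (`rpow_lintegral_le_of_grid`).
Mollification, bounded truncations and Pratt's lemma carry it from C¹ functions to the slices.
Interpolation with L² and integration in time put (u - k)₊ in L^q, q = p̄(n + 2)/n, with a bound
that is superlinear, of power 1 + p̄/n (`exists_higher_integrability`).

The assumptions on the exponents say that P < q. Hölder's inequality on the superlevel set and
Chebyshev's inequality between two levels then give Y_{j+1} ≤ M B^j Y_j^{1+α}, α = P/(n + 2), for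
the integrals Y_j of (u - k_j)₊^P over shrinking cylinders and levels k_j increasing to k
(`levelEnergy_step`). If Y_0 is small relative to k, then Y_j → 0 (`fast_geometric_convergence`) and
u ≤ k on the inner cylinder. The conditions k ≥ 1 and k ≥ ρ^(1/P) absorb the lower powers and the
measure term; the third entry of the maximum is the smallness condition solved for k. The lower
bound is the upper bound for -u. -/

lemma expNegInvGlue_rpow {p : ℝ} (hp : 0 < p) (x : ℝ) :
    expNegInvGlue x ^ p = expNegInvGlue (x / p) := by
  rcases le_or_gt x 0 with hx | hx
  · rw [expNegInvGlue.zero_of_nonpos hx, Real.zero_rpow hp.ne',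
      expNegInvGlue.zero_of_nonpos (div_nonpos_of_nonpos_of_nonneg hx hp.le)]
  · have h1 : ¬ x ≤ 0 := not_le.2 hx
    have h2 : ¬ x / p ≤ 0 := not_le.2 (div_pos hx hp)
    simp only [expNegInvGlue, h1, h2, if_false]
    rw [← Real.exp_mul]
    congr 1
    field_simp

/-- A real power of a smooth non-negative function need not be smooth where the function vanishes.
Here it is, because powers of exp(-1/x) are dilates of it and the denominator never vanishes.
Admissible cut-offs need this, as they contain the powers ζᵢ^{pᵢ}. -/
lemma contDiff_smoothTransition_rpow {p : ℝ} (hp : 0 < p) :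
    ContDiff ℝ ∞ (fun x => Real.smoothTransition x ^ p) := by
  have h : (fun x => Real.smoothTransition x ^ p) = fun x =>
      expNegInvGlue (x / p) / (expNegInvGlue x + expNegInvGlue (1 - x)) ^ p := by
    funext x
    rw [Real.smoothTransition, Real.div_rpow (expNegInvGlue.nonneg _)
      (Real.smoothTransition.pos_denom x).le, expNegInvGlue_rpow hp]
  rw [h]
  have h1 : ContDiff ℝ ∞ (fun x : ℝ => expNegInvGlue (x / p)) :=
    expNegInvGlue.contDiff.comp (contDiff_id.div_const p)
  have h2 : ContDiff ℝ ∞ (fun x : ℝ => expNegInvGlue x + expNegInvGlue (1 - x)) :=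
    expNegInvGlue.contDiff.add (expNegInvGlue.contDiff.comp (contDiff_const.sub contDiff_id))
  refine h1.div (h2.rpow_const_of_ne fun x => (Real.smoothTransition.pos_denom x).ne') fun x => ?_
  exact (Real.rpow_pos_of_pos (Real.smoothTransition.pos_denom x) p).ne'

lemma exists_abs_deriv_smoothTransition_le :
    ∃ L : ℝ, 0 < L ∧ ∀ x, |deriv Real.smoothTransition x| ≤ L := by
  have hc : Continuous (deriv Real.smoothTransition) :=
    (Real.smoothTransition.contDiff (n := 1)).continuous_deriv le_rfl
  obtain ⟨L, hL⟩ := isCompact_Icc (a := (0 : ℝ)) (b := 1) |>.exists_bound_of_continuousOn hc.continuousOn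
  refine ⟨max L 1, by positivity, fun x => ?_⟩
  by_cases hx : x ∈ Icc (0 : ℝ) 1
  · exact (hL x hx).trans (le_max_left _ _)
  · have : deriv Real.smoothTransition x = 0 := by
      rcases lt_or_ge x 0 with h | h
      · have : Real.smoothTransition =ᶠ[nhds x] fun _ => 0 := by
          filter_upwards [Iio_mem_nhds h] with y hy
          exact Real.smoothTransition.zero_of_nonpos (le_of_lt hy)
        rw [this.deriv_eq]; simp
      · have h1 : 1 < x := by
          by_contra h'
          exact hx ⟨h, not_lt.1 h'⟩
        have : Real.smoothTransition =ᶠ[nhds x] fun _ => 1 := by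
          filter_upwards [Ioi_mem_nhds h1] with y hy
          exact Real.smoothTransition.one_of_one_le (le_of_lt hy)
        rw [this.deriv_eq]; simp
    rw [this]; simp

/-- A smooth one-dimensional cut-off all of whose positive powers are smooth. -/
lemma exists_lineCutoff : ∃ L : ℝ, 0 < L ∧ ∀ c r R : ℝ, 0 < r → r < R → ∃ η : ℝ → ℝ,
    ContDiff ℝ ∞ η ∧ (∀ p : ℝ, 0 < p → ContDiff ℝ ∞ fun s => η s ^ p) ∧ HasCompactSupport η ∧
    (∀ s, η s ∈ Icc (0 : ℝ) 1) ∧ tsupport η ⊆ Ioo (c - R) (c + R) ∧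
    (∀ s ∈ Ioo (c - r) (c + r), η s = 1) ∧ ∀ s, |deriv η s| ≤ L / (R - r) := by
  obtain ⟨L, hL0, hL⟩ := exists_abs_deriv_smoothTransition_le
  refine ⟨4 * L, by positivity, fun c r R hr hrR => ?_⟩
  -- The transition takes place at distances between r = a - h and a from the centre, so the support
  -- stays away from the endpoints c ± R.
  set a := (R + r) / 2 with ha
  set h := (R - r) / 2 with hh
  have hpos : 0 < h := by rw [hh]; linarith
  have c1 : ContDiff ℝ ∞ (fun s : ℝ => (a - (s - c)) / h) :=
    (contDiff_const.sub (contDiff_id.sub contDiff_const)).div_const h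
  have c2 : ContDiff ℝ ∞ (fun s : ℝ => (a + (s - c)) / h) :=
    (contDiff_const.add (contDiff_id.sub contDiff_const)).div_const h
  set η : ℝ → ℝ := fun s => Real.smoothTransition ((a - (s - c)) / h) *
    Real.smoothTransition ((a + (s - c)) / h) with hη
  have hsm : ContDiff ℝ ∞ η :=
    (Real.smoothTransition.contDiff.comp c1).mul (Real.smoothTransition.contDiff.comp c2)
  have hrange : ∀ s, η s ∈ Icc (0 : ℝ) 1 := fun s =>
    ⟨mul_nonneg (Real.smoothTransition.nonneg _) (Real.smoothTransition.nonneg _),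
      mul_le_one₀ (Real.smoothTransition.le_one _) (Real.smoothTransition.nonneg _)
        (Real.smoothTransition.le_one _)⟩
  have hsupp : Function.support η ⊆ Icc (c - a) (c + a) := by
    intro s hs
    by_contra hn
    apply hs
    rw [mem_Icc, not_and_or] at hn
    rcases hn with h1 | h1
    · have : (a + (s - c)) / h ≤ 0 := div_nonpos_of_nonpos_of_nonneg (by linarith) hpos.le
      simp [hη, Real.smoothTransition.zero_of_nonpos this]
    · have : (a - (s - c)) / h ≤ 0 := div_nonpos_of_nonpos_of_nonneg (by linarith) hpos.le
      simp [hη, Real.smoothTransition.zero_of_nonpos this]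
  have htsupp : tsupport η ⊆ Icc (c - a) (c + a) := closure_minimal hsupp isClosed_Icc
  refine ⟨η, hsm, fun p hp => ?_, ?_, hrange, ?_, ?_, ?_⟩
  · have : (fun s => η s ^ p) = fun s => Real.smoothTransition ((a - (s - c)) / h) ^ p *
        Real.smoothTransition ((a + (s - c)) / h) ^ p := by
      funext s
      exact Real.mul_rpow (Real.smoothTransition.nonneg _) (Real.smoothTransition.nonneg _)
    rw [this]
    exact ((contDiff_smoothTransition_rpow hp).comp c1).mul
      ((contDiff_smoothTransition_rpow hp).comp c2)
  · exact HasCompactSupport.intro isCompact_Icc fun s hs => by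
      by_contra hne
      exact hs (hsupp hne)
  · refine htsupp.trans fun s hs => ⟨?_, ?_⟩
    · linarith [hs.1]
    · linarith [hs.2]
  · intro s hs
    have h1 : 1 ≤ (a - (s - c)) / h := by rw [le_div_iff₀ hpos]; linarith [hs.2]
    have h2 : 1 ≤ (a + (s - c)) / h := by rw [le_div_iff₀ hpos]; linarith [hs.1]
    simp [hη, Real.smoothTransition.one_of_one_le h1, Real.smoothTransition.one_of_one_le h2]
  · intro s
    have hd : ∀ x, HasDerivAt Real.smoothTransition (deriv Real.smoothTransition x) x := fun x =>
      ((Real.smoothTransition.contDiff (n := 1)).differentiable one_ne_zero x).hasDerivAt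
    have d1 : HasDerivAt (fun s : ℝ => (a - (s - c)) / h) (-1 / h) s :=
      (((hasDerivAt_id s).sub_const c).const_sub a).div_const h
    have d2 : HasDerivAt (fun s : ℝ => (a + (s - c)) / h) (1 / h) s :=
      (((hasDerivAt_id s).sub_const c).const_add a).div_const h
    have hder := ((hd _).comp s d1).mul ((hd _).comp s d2)
    have e : deriv η s = _ := hder.deriv
    rw [e]
    simp only [Function.comp]
    set A := (a - (s - c)) / h
    set B := (a + (s - c)) / h
    have key : ∀ x y : ℝ, |deriv Real.smoothTransition x * Real.smoothTransition y / h| ≤ L / h := by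
      intro x y
      rw [abs_div, abs_of_pos hpos, abs_mul, abs_of_nonneg (Real.smoothTransition.nonneg y)]
      gcongr
      calc _ ≤ L * 1 := mul_le_mul (hL x) (Real.smoothTransition.le_one y)
            (Real.smoothTransition.nonneg y) hL0.le
        _ = L := mul_one L
    have e2 : deriv Real.smoothTransition A * (-1 / h) * Real.smoothTransition B +
        Real.smoothTransition A * (deriv Real.smoothTransition B * (1 / h)) =
        -(deriv Real.smoothTransition A * Real.smoothTransition B / h) +
        deriv Real.smoothTransition B * Real.smoothTransition A / h := by ring
    rw [e2]
    calc _ ≤ |-(deriv Real.smoothTransition A * Real.smoothTransition B / h)| +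
        |deriv Real.smoothTransition B * Real.smoothTransition A / h| := abs_add_le _ _
      _ ≤ L / h + L / h := by rw [abs_neg]; exact add_le_add (key _ _) (key _ _)
      _ = 4 * L / (R - r) := by rw [hh]; field_simp; norm_num

/-- The parameter ε of an admissible cut-off is R - r here: ψ rises from 0 to 1 on the second half
of [t₀ - R, t₀ - r]. A one-sided derivative bound is enough, since ∂ₜζ enters the energy inequality
only through an upper bound. -/
lemma exists_timeCutoff : ∃ L : ℝ, 0 < L ∧ ∀ t₀ r R : ℝ, 0 < r → r < R → ∃ ψ : ℝ → ℝ,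
    ContDiff ℝ ∞ ψ ∧ Monotone ψ ∧ (∀ t, ψ t ∈ Icc (0 : ℝ) 1) ∧
    (∀ t ≤ t₀ - R + (R - r) / 2, ψ t = 0) ∧ (∀ t, t₀ - R + (R - r) ≤ t → ψ t = 1) ∧
    ∀ s, deriv ψ s ≤ L / (R - r) := by
  obtain ⟨L, hL0, hL⟩ := exists_abs_deriv_smoothTransition_le
  refine ⟨2 * L, by positivity, fun t₀ r R hr hrR => ?_⟩
  set h := (R - r) / 2 with hh
  have hpos : 0 < h := by rw [hh]; linarith
  refine ⟨fun t => Real.smoothTransition ((t - (t₀ - R + h)) / h), ?_, ?_, fun t =>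
    ⟨Real.smoothTransition.nonneg _, Real.smoothTransition.le_one _⟩, fun t ht => ?_,
    fun t ht => ?_, fun t => ?_⟩
  · exact Real.smoothTransition.contDiff.comp ((contDiff_id.sub contDiff_const).div_const h)
  · intro a b hab
    apply Real.smoothTransition.monotone
    gcongr
  · exact Real.smoothTransition.zero_of_nonpos
      (div_nonpos_of_nonpos_of_nonneg (by linarith) hpos.le)
  · exact Real.smoothTransition.one_of_one_le (by rw [le_div_iff₀ hpos]; linarith)
  · have hd : ∀ x, HasDerivAt Real.smoothTransition (deriv Real.smoothTransition x) x := fun x =>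
      ((Real.smoothTransition.contDiff (n := 1)).differentiable one_ne_zero x).hasDerivAt
    have d1 : HasDerivAt (fun s : ℝ => (s - (t₀ - R + h)) / h) (1 / h) t :=
      ((hasDerivAt_id t).sub_const _).div_const h
    have hder := (hd _).comp t d1
    have e : deriv (fun t => Real.smoothTransition ((t - (t₀ - R + h)) / h)) t = _ := hder.deriv
    rw [e]
    calc _ ≤ L * (1 / h) := by
          gcongr
          exact (le_abs_self _).trans (hL _)
      _ = 2 * L / (R - r) := by rw [hh]; field_simp

lemma le_pmax (p : Fin n → ℝ) (i : Fin n) : p i ≤ pmax p :=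
  le_ciSup (Set.finite_range p).bddAbove i

/-- Concavity of s ↦ s^(1/p), in the form of Bernoulli's inequality for r = R(1 - (R - r)/R). -/
lemma rpow_sub_rpow_ge {p r R : ℝ} (hp : 1 ≤ p) (hr : 0 ≤ r) (hrR : r < R) :
    (R - r) / R * R ^ (1 / p) / p ≤ R ^ (1 / p) - r ^ (1 / p) := by
  have hR : 0 < R := hr.trans_lt hrR
  have hp0 : 0 < p := by linarith
  have h1 : r = R * (1 + -((R - r) / R)) := by field_simp; ring
  have hs : -1 ≤ -((R - r) / R) := by
    rw [neg_le_neg_iff, div_le_one hR]; linarith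
  have h2 := rpow_one_add_le_one_add_mul_self hs (p := 1 / p) (by positivity)
    (by rw [div_le_one hp0]; exact hp)
  have h3 : r ^ (1 / p) = R ^ (1 / p) * (1 + -((R - r) / R)) ^ (1 / p) := by
    conv_lhs => rw [h1]
    exact Real.mul_rpow hR.le (by linarith)
  have h4 : 0 < R ^ (1 / p) := Real.rpow_pos_of_pos hR _
  calc (R - r) / R * R ^ (1 / p) / p
      = R ^ (1 / p) - R ^ (1 / p) * (1 + 1 / p * -((R - r) / R)) := by ring
    _ ≤ R ^ (1 / p) - R ^ (1 / p) * (1 + -((R - r) / R)) ^ (1 / p) := by gcongr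
    _ = _ := by rw [h3]

/-- The gap between the boxes in a direction of exponent p is of order θR^(1/p), θ = (R - r)/R, so
its power -p is of order θ^(-p)/R. Since θ ≤ 1, passing to the larger exponent m makes the factor
independent of the direction. -/
lemma rpow_div_gap_le {p r R L m : ℝ} (hp : 1 ≤ p) (hpm : p ≤ m) (hr : 0 < r) (hrR : r < R)
    (hL : 0 ≤ L) : (L / (R ^ (1 / p) - r ^ (1 / p))) ^ p
      ≤ (L * p) ^ p * (((R - r) / R) ^ (-m) / R) := by
  have hR : 0 < R := hr.trans hrR
  have hp0 : 0 < p := by linarith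
  set θ := (R - r) / R with hθ
  have hθ0 : 0 < θ := div_pos (by linarith) hR
  have hθ1 : θ ≤ 1 := by rw [hθ, div_le_one hR]; linarith
  have hRp : 0 < R ^ (1 / p) := Real.rpow_pos_of_pos hR _
  have h0 : 0 < θ * R ^ (1 / p) / p := by positivity
  calc (L / (R ^ (1 / p) - r ^ (1 / p))) ^ p
      ≤ (L / (θ * R ^ (1 / p) / p)) ^ p := by
        have := rpow_sub_rpow_ge hp hr.le hrR
        have h1 : 0 < R ^ (1 / p) - r ^ (1 / p) := h0.trans_le this
        gcongr
    _ = (L * p * (θ⁻¹ * (R ^ (1 / p))⁻¹)) ^ p := by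
        congr 1; field_simp
    _ = (L * p) ^ p * (θ ^ (-p) / R) := by
        rw [Real.mul_rpow (x := L * p) (by positivity) (by positivity),
          Real.mul_rpow (x := θ⁻¹) (by positivity) (by positivity), Real.inv_rpow hRp.le,
          ← Real.rpow_mul hR.le, Real.inv_rpow hθ0.le, Real.rpow_neg hθ0.le,
          one_div_mul_cancel hp0.ne', Real.rpow_one]
        rfl
    _ ≤ (L * p) ^ p * (θ ^ (-m) / R) := by
        have := Real.rpow_le_rpow_of_exponent_ge hθ0 hθ1 (neg_le_neg hpm)
        gcongr

lemma prod_update_eq (F : Fin n → ℝ → ℝ) (x : Fin n → ℝ) (i : Fin n) (s : ℝ) :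
    ∏ j, F j (Function.update x i s j) = F i s * ∏ j ∈ Finset.univ.erase i, F j (x j) := by
  rw [← Finset.mul_prod_erase Finset.univ _ (Finset.mem_univ i), Function.update_self]
  congr 1
  refine Finset.prod_congr rfl fun j hj => ?_
  rw [Function.update_of_ne (Finset.ne_of_mem_erase hj)]

/-- Cut-off functions between two concentric cylinders, with quantitative derivative bounds. -/
lemma exists_cutoff (p : Fin n → ℝ) (hp : ∀ i, 1 < p i) (hn : 0 < n) :
    ∃ L : ℝ, 0 < L ∧ ∀ (x₀ : Fin n → ℝ) (t₀ r R : ℝ), 0 < r → r < R →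
    ∃ (χ : (Fin n → ℝ) → ℝ) (ψ : ℝ → ℝ),
      IsCutoff p x₀ t₀ R (fun z => ψ z.2 * χ z.1) ∧
      ContDiff ℝ ∞ χ ∧ HasCompactSupport χ ∧ tsupport χ ⊆ box p x₀ R ∧
      (∀ x, χ x ∈ Icc (0 : ℝ) 1) ∧ (∀ x ∈ box p x₀ r, χ x = 1) ∧
      (∀ t, t₀ - r ≤ t → ψ t = 1) ∧
      (∀ x t, deriv (fun s => ψ s * χ x) t ≤ L * (((R - r) / R) ^ (-pmax p) / R)) ∧
      (∀ i x t, |partialX i (fun x => (ψ t * χ x) ^ (1 / p i)) x| ^ (p i)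
        ≤ L * (((R - r) / R) ^ (-pmax p) / R)) ∧
      (∀ i x, |partialX i χ x| ^ (p i) ≤ L * (((R - r) / R) ^ (-pmax p) / R)) := by
  have hp0 : ∀ i, 0 < p i := fun i => by linarith [hp i]
  obtain ⟨L₁, hL₁, H₁⟩ := exists_lineCutoff
  obtain ⟨L₂, hL₂, H₂⟩ := exists_timeCutoff
  -- One factor `p i` comes from differentiating the power ηᵢ^{pᵢ}, the other from the concavity
  -- bound for the gap.
  set M : ℝ := L₂ + ∑ i, (L₁ * p i * p i) ^ (p i) with hM
  have hterm : ∀ i, 0 ≤ (L₁ * p i * p i) ^ (p i) := fun i => by have := hp0 i; positivity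
  have hsum : ∀ i, (L₁ * p i * p i) ^ (p i) ≤ M := fun i => by
    have := Finset.single_le_sum (f := fun i => (L₁ * p i * p i) ^ (p i))
      (fun i _ => hterm i) (Finset.mem_univ i)
    linarith
  have hL₂M : L₂ ≤ M := by
    have := Finset.sum_nonneg (s := Finset.univ) fun i _ => hterm i
    linarith
  refine ⟨M, by linarith, fun x₀ t₀ r R hr hrR => ?_⟩
  have hR : 0 < R := hr.trans hrR
  have hκ0 : 0 ≤ ((R - r) / R) ^ (-pmax p) / R := by
    have : 0 ≤ (R - r) / R := div_nonneg (by linarith) hR.le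
    positivity
  obtain ⟨ψ, ψs, ψm, ψr, ψ0, ψ1, ψd⟩ := H₂ t₀ r R hr hrR
  have hη := fun i => H₁ (x₀ i) (r ^ (1 / p i)) (R ^ (1 / p i)) (Real.rpow_pos_of_pos hr _)
    (Real.rpow_lt_rpow hr.le hrR (by have := hp0 i; positivity))
  choose η ηs ηp ηc ηr ηt η1 ηd using hη
  set χ : (Fin n → ℝ) → ℝ := fun x => ∏ i, η i (x i) ^ p i with hχ
  have hχs : ContDiff ℝ ∞ χ := contDiff_prod fun i _ =>
    (ηp i (p i) (hp0 i)).comp (contDiff_apply ℝ ℝ i)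
  have hpow : ∀ (i : Fin n) (s q : ℝ), 0 < q → η i s ^ q ∈ Icc (0 : ℝ) 1 := fun i s q hq =>
    ⟨Real.rpow_nonneg (ηr i s).1 _, Real.rpow_le_one (ηr i s).1 (ηr i s).2 hq.le⟩
  have hχr : ∀ x, χ x ∈ Icc (0 : ℝ) 1 := fun x =>
    ⟨Finset.prod_nonneg fun i _ => (hpow i _ _ (hp0 i)).1,
      Finset.prod_le_one (fun i _ => (hpow i _ _ (hp0 i)).1) fun i _ => (hpow i _ _ (hp0 i)).2⟩
  have hsupp : Function.support χ ⊆ Set.univ.pi fun i => tsupport (η i) := by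
    intro x hx i _
    by_contra hn
    apply hx
    refine Finset.prod_eq_zero (Finset.mem_univ i) ?_
    rw [image_eq_zero_of_notMem_tsupport hn, Real.zero_rpow (hp0 i).ne']
  have hcpt : IsCompact (Set.univ.pi fun i => tsupport (η i)) :=
    isCompact_univ_pi fun i => (ηc i)
  have htsupp : tsupport χ ⊆ Set.univ.pi fun i => tsupport (η i) :=
    closure_minimal hsupp hcpt.isClosed
  have herase : ∀ (i : Fin n) (x : Fin n → ℝ), ∏ j ∈ Finset.univ.erase i, η j (x j) ^ p j ∈ Icc (0 : ℝ) 1 := fun i x =>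
    ⟨Finset.prod_nonneg fun j _ => (hpow j _ _ (hp0 j)).1,
      Finset.prod_le_one (fun j _ => (hpow j _ _ (hp0 j)).1) fun j _ => (hpow j _ _ (hp0 j)).2⟩
  have hηdiff : ∀ i s, DifferentiableAt ℝ (η i) s := fun i s =>
    (ηs i).differentiable (by simp) s
  have hgap : ∀ i, (L₁ * p i / (R ^ (1 / p i) - r ^ (1 / p i))) ^ p i
      ≤ M * (((R - r) / R) ^ (-pmax p) / R) := fun i =>
    (rpow_div_gap_le (hp i).le (le_pmax p i) hr hrR
      (mul_nonneg hL₁.le (hp0 i).le)).trans (mul_le_mul_of_nonneg_right (hsum i) hκ0)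
  have hgap0 : ∀ i, 0 < R ^ (1 / p i) - r ^ (1 / p i) := fun i =>
    sub_pos.2 (Real.rpow_lt_rpow hr.le hrR (by have := hp0 i; positivity))
  refine ⟨χ, ψ, ⟨?_, ψ, R - r, η, ⟨ψs, ψm, ψr, ⟨by linarith, by linarith⟩, ψ0, ψ1⟩,
    fun i => ⟨ηs i, ηc i, ηr i, ηt i⟩, fun x t => rfl⟩, hχs, ?_, ?_, hχr, ?_, ?_, ?_, ?_, ?_⟩
  · exact (ψs.comp contDiff_snd).mul (hχs.comp contDiff_fst)
  · exact hcpt.of_isClosed_subset (isClosed_tsupport χ) htsupp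
  · intro x hx i hi
    exact ηt i (htsupp hx i hi)
  · intro x hx
    refine Finset.prod_eq_one fun i _ => ?_
    rw [η1 i (x i) (hx i (mem_univ i)), Real.one_rpow]
  · intro t ht
    exact ψ1 t (by linarith)
  · intro x t
    have hd : DifferentiableAt ℝ ψ t := ψs.differentiable (by simp) t
    rw [deriv_mul_const hd]
    have h1 : 0 ≤ deriv ψ t := ψm.deriv_nonneg
    -- The time derivative costs only θ⁻¹/R, which is at most θ^(-𝒫)/R because 𝒫 ≥ 1 and θ = (R -
    -- r)/R ≤ 1.
    have h2 : L₂ / (R - r) ≤ L₂ * (((R - r) / R) ^ (-pmax p) / R) := by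
      have hθ0 : 0 < (R - r) / R := div_pos (by linarith) hR
      have hθ1 : (R - r) / R ≤ 1 := by rw [div_le_one hR]; linarith
      have hpm : 1 ≤ pmax p := (hp ⟨0, hn⟩).le.trans (le_pmax p _)
      have := Real.rpow_le_rpow_of_exponent_ge hθ0 hθ1 (neg_le_neg hpm)
      rw [Real.rpow_neg_one] at this
      calc L₂ / (R - r) = L₂ * (((R - r) / R)⁻¹ / R) := by
            have : R - r ≠ 0 := by linarith
            field_simp
        _ ≤ _ := by gcongr
    calc deriv ψ t * χ x ≤ deriv ψ t * 1 := by gcongr; exact (hχr x).2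
      _ ≤ L₂ / (R - r) := by rw [mul_one]; exact ψd t
      _ ≤ _ := h2.trans (mul_le_mul_of_nonneg_right hL₂M hκ0)
  · intro i x t
    have hA : (ψ t * ∏ j ∈ Finset.univ.erase i, η j (x j) ^ p j) ∈ Icc (0 : ℝ) 1 :=
      ⟨mul_nonneg (ψr t).1 (herase i x).1, mul_le_one₀ (ψr t).2 (herase i x).1 (herase i x).2⟩
    set A := ψ t * ∏ j ∈ Finset.univ.erase i, η j (x j) ^ p j with hAdef
    -- Along the i-th line the root ζ^(1/pᵢ) is a constant in [0, 1] times ηᵢ. This is the purpose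
    -- of the exponents pᵢ in the cut-off.
    have e : (fun s => (ψ t * χ (Function.update x i s)) ^ (1 / p i)) =
        fun s => A ^ (1 / p i) * η i s := by
      funext s
      have : ψ t * χ (Function.update x i s) = A * η i s ^ p i := by
        rw [hχ, hAdef]
        simp only
        rw [prod_update_eq (fun j s => η j s ^ p j)]
        ring
      rw [this, Real.mul_rpow hA.1 (hpow i s _ (hp0 i)).1, ← Real.rpow_mul (ηr i s).1,
        mul_one_div_cancel (hp0 i).ne', Real.rpow_one]
    have hA1 : A ^ (1 / p i) ∈ Icc (0 : ℝ) 1 :=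
      ⟨Real.rpow_nonneg hA.1 _, Real.rpow_le_one hA.1 hA.2 (by have := hp0 i; positivity)⟩
    refine le_trans ?_ (hgap i)
    refine Real.rpow_le_rpow (abs_nonneg _) ?_ (hp0 i).le
    rw [partialX, e, deriv_const_mul _ (hηdiff i _), abs_mul, abs_of_nonneg hA1.1]
    calc _ ≤ 1 * (L₁ / (R ^ (1 / p i) - r ^ (1 / p i))) :=
          mul_le_mul hA1.2 (ηd i _) (abs_nonneg _) zero_le_one
      _ ≤ _ := by
          rw [one_mul]
          have := hgap0 i
          gcongr
          nlinarith [hp i]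
  · intro i x
    have e : (fun s => χ (Function.update x i s)) =
        fun s => η i s ^ p i * ∏ j ∈ Finset.univ.erase i, η j (x j) ^ p j := by
      funext s
      rw [hχ]
      exact prod_update_eq (fun j s => η j s ^ p j) x i s
    have hd : HasDerivAt (fun s => η i s ^ p i)
        (deriv (η i) (x i) * p i * η i (x i) ^ (p i - 1)) (x i) :=
      (hηdiff i _).hasDerivAt.rpow_const (Or.inr (hp i).le)
    refine le_trans ?_ (hgap i)
    refine Real.rpow_le_rpow (abs_nonneg _) ?_ (hp0 i).le
    rw [partialX, e, deriv_mul_const hd.differentiableAt, hd.deriv, abs_mul, abs_mul, abs_mul,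
      abs_of_nonneg (hp0 i).le, abs_of_nonneg (herase i x).1,
      abs_of_nonneg (hpow i _ (p i - 1) (by linarith [hp i])).1]
    have h1 := ηd i (x i)
    have h2 := hpow i (x i) (p i - 1) (by linarith [hp i])
    have h3 := herase i x
    calc _ ≤ L₁ / (R ^ (1 / p i) - r ^ (1 / p i)) * p i * 1 * 1 := by
          have := hp0 i
          have := hgap0 i
          gcongr
          · exact h3.1
          · exact h2.1
          · exact h2.2
          · exact h3.2
      _ = _ := by ring

/-! ### A multiplicative Gagliardo–Nirenberg–Sobolev inequality for `C¹` functions -/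

section SmoothSobolev

lemma partialX_eq_fderiv {w : (Fin n → ℝ) → ℝ} {x : Fin n → ℝ} (hw : DifferentiableAt ℝ w x)
    (i : Fin n) : partialX i w x = fderiv ℝ w x (Pi.single i 1) := by
  have h1 : HasDerivAt (Function.update x i) (Pi.single i 1) (x i) := hasDerivAt_update x i (x i)
  have h2 : HasFDerivAt w (fderiv ℝ w x) (Function.update x i (x i)) := by
    rw [Function.update_eq_self]; exact hw.hasFDerivAt
  exact (h2.comp_hasDerivAt (x i) h1).deriv

lemma continuous_partialX {w : (Fin n → ℝ) → ℝ} (hw : ContDiff ℝ 1 w) (i : Fin n) :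
    Continuous (partialX i w) := by
  have : partialX i w = fun x => fderiv ℝ w x (Pi.single i 1) := by
    funext x
    exact partialX_eq_fderiv (hw.differentiable one_ne_zero x) i
  rw [this]
  exact (hw.continuous_fderiv one_ne_zero).clm_apply continuous_const

/-- On the i-th line through x, the value λᵢw^{γᵢ} is at most the integral of the absolute value of
its derivative, and the grid-lines inequality multiplies these n bounds. The powers γᵢ and weights
λᵢ are left free so that the anisotropy can be built in afterwards. -/
lemma lintegral_prod_rpow_le (hn : 2 ≤ n) {w : (Fin n → ℝ) → ℝ} (hw : ContDiff ℝ 1 w)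
    (hc : HasCompactSupport w) (h0 : ∀ x, 0 ≤ w x) {γ lam : Fin n → ℝ} (hγ : ∀ i, 1 < γ i)
    (hlam : ∀ i, 0 ≤ lam i) :
    ∫⁻ x, ∏ i, ENNReal.ofReal (lam i * w x ^ γ i) ^ (1 / ((n : ℝ) - 1)) ≤
      (∫⁻ x, ∑ i, ENNReal.ofReal (lam i * γ i * w x ^ (γ i - 1) * |partialX i w x|)) ^
        ((n : ℝ) / (n - 1)) := by
  have hn1 : (1 : ℝ) < n := by exact_mod_cast hn
  have hconj : Real.HolderConjugate (Fintype.card (Fin n)) ((n : ℝ) / (n - 1)) := by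
    rw [Fintype.card_fin]
    exact Real.HolderConjugate.conjExponent hn1
  -- The grid-lines inequality takes one integrand for all directions, hence the sum. The later
  -- choice of the weights makes its terms comparable.
  set f : (Fin n → ℝ) → ℝ≥0∞ := fun x =>
    ∑ i, ENNReal.ofReal (lam i * γ i * w x ^ (γ i - 1) * |partialX i w x|) with hf
  have hmeas : Measurable f := by
    refine Finset.measurable_fun_sum _ fun i _ => ENNReal.measurable_ofReal.comp ?_
    have h1 : Continuous fun x => w x ^ (γ i - 1) :=
      hw.continuous.rpow_const fun x => Or.inr (by linarith [hγ i])
    exact ((continuous_const.mul h1).mul (continuous_partialX hw i).abs).measurable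
  have hgrid := lintegral_prod_lintegral_pow_le (fun _ : Fin n => (volume : Measure ℝ)) hconj hmeas
  rw [Fintype.card_fin] at hgrid
  refine le_trans (lintegral_mono fun x => ?_) hgrid
  refine Finset.prod_le_prod' fun i _ => ?_
  refine ENNReal.rpow_le_rpow ?_ (by have : 0 < (n : ℝ) - 1 := by linarith
                                     positivity)
  have hcomp : ContDiff ℝ 1 fun s => w (Function.update x i s) :=
    hw.comp (contDiff_update 1 x i)
  have hφ : ContDiff ℝ 1 fun s => lam i * w (Function.update x i s) ^ γ i :=
    contDiff_const.mul (hcomp.rpow_const_of_le (m := 1) (by simpa using (hγ i).le))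
  have hcs : HasCompactSupport fun s => lam i * w (Function.update x i s) ^ γ i := by
    have h1 : HasCompactSupport fun s => w (Function.update x i s) :=
      hc.comp_isClosedEmbedding (isClosedEmbedding_update x i)
    refine h1.comp_left (g := fun y => lam i * y ^ γ i) ?_
    simp [Real.zero_rpow (by linarith [hγ i] : γ i ≠ 0)]
  have hmain := hcs.enorm_le_lintegral_Ici_deriv hφ (x i)
  simp only [Function.update_eq_self] at hmain
  rw [Real.enorm_eq_ofReal (mul_nonneg (hlam i) (Real.rpow_nonneg (h0 x) _))] at hmain
  refine hmain.trans ((setLIntegral_le_lintegral _ _).trans (lintegral_mono fun y => ?_))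
  have hd : HasDerivAt (fun s => w (Function.update x i s))
      (partialX i w (Function.update x i y)) y := by
    have := (hcomp.differentiable one_ne_zero y).hasDerivAt
    rwa [show deriv (fun s => w (Function.update x i s)) y =
      partialX i w (Function.update x i y) by simp [partialX]] at this
  rw [((hd.rpow_const (p := γ i) (Or.inr (hγ i).le)).const_mul (lam i)).deriv]
  rw [Real.enorm_eq_ofReal_abs, abs_mul, abs_mul, abs_mul, abs_of_nonneg (hlam i),
    abs_of_nonneg (by linarith [hγ i] : 0 ≤ γ i), abs_of_nonneg (Real.rpow_nonneg (h0 _) _)]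
  rw [show lam i * (|partialX i w (Function.update x i y)| * γ i *
    w (Function.update x i y) ^ (γ i - 1)) = lam i * γ i * w (Function.update x i y) ^ (γ i - 1) *
      |partialX i w (Function.update x i y)| by ring]
  exact Finset.single_le_sum (f := fun i => ENNReal.ofReal (lam i * γ i *
    w (Function.update x _ y) ^ (γ i - 1) * |partialX i w (Function.update x _ y)|))
    (fun _ _ => zero_le) (Finset.mem_univ i)

end SmoothSobolev

/-! ### Convergence of integrals under varying dominating functions -/

section Pratt

variable {α : Type*} [MeasurableSpace α] {μ : Measure α}

/-- Since ∫ b_m ≤ ∫ B, the excess (b_m - B)₊ has no larger integral than the deficit (B - b_m)₊. The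
deficit is dominated by B, so its integral tends to 0. -/
lemma tendsto_lintegral_sub_of_lintegral_le {b : ℕ → α → ℝ≥0∞} {B : α → ℝ≥0∞}
    (hb : ∀ m, AEMeasurable (b m) μ) (hB : AEMeasurable B μ) (hBfin : ∫⁻ x, B x ∂μ ≠ ⊤)
    (hlim : ∀ᵐ x ∂μ, Tendsto (fun m => b m x) atTop (𝓝 (B x)))
    (hle : ∀ m, ∫⁻ x, b m x ∂μ ≤ ∫⁻ x, B x ∂μ) :
    Tendsto (fun m => ∫⁻ x, (b m x - B x) ∂μ) atTop (𝓝 0) := by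
  have hBae : ∀ᵐ x ∂μ, B x < ⊤ := ae_lt_top' hB hBfin
  have h1 : Tendsto (fun m => ∫⁻ x, (B x - b m x) ∂μ) atTop (𝓝 0) := by
    have := tendsto_lintegral_of_dominated_convergence' (μ := μ) (F := fun m x => B x - b m x)
      (f := fun _ => 0) B (fun m => hB.sub (hb m))
      (fun m => Eventually.of_forall fun x => tsub_le_self) hBfin (by
        filter_upwards [hlim, hBae] with x hx hxf
        have := ENNReal.Tendsto.sub (tendsto_const_nhds (x := B x)) hx (Or.inl hxf.ne)
        simpa using this)
    simpa using this
  refine tendsto_of_tendsto_of_tendsto_of_le_of_le tendsto_const_nhds h1 (fun _ => zero_le)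
    fun m => ?_
  have e : ∫⁻ x, b m x ∂μ + ∫⁻ x, (B x - b m x) ∂μ = ∫⁻ x, B x ∂μ + ∫⁻ x, (b m x - B x) ∂μ := by
    rw [← lintegral_add_left' (hb m), ← lintegral_add_left' hB]
    refine lintegral_congr fun x => ?_
    rw [add_tsub_eq_max, add_tsub_eq_max, max_comm]
  have : ∫⁻ x, B x ∂μ + ∫⁻ x, (b m x - B x) ∂μ ≤
      ∫⁻ x, B x ∂μ + ∫⁻ x, (B x - b m x) ∂μ := by
    rw [← e]; exact add_le_add_left (hle m) _
  exact (ENNReal.add_le_add_iff_left hBfin).1 this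

/-- Pratt's lemma. -/
lemma tendsto_lintegral_of_le_of_lintegral_le {a b : ℕ → α → ℝ≥0∞} {A B : α → ℝ≥0∞}
    (ha : ∀ m, AEMeasurable (a m) μ) (hb : ∀ m, AEMeasurable (b m) μ)
    (hB : AEMeasurable B μ) (hBfin : ∫⁻ x, B x ∂μ ≠ ⊤)
    (hab : ∀ m, ∀ᵐ x ∂μ, a m x ≤ b m x)
    (halim : ∀ᵐ x ∂μ, Tendsto (fun m => a m x) atTop (𝓝 (A x)))
    (hlim : ∀ᵐ x ∂μ, Tendsto (fun m => b m x) atTop (𝓝 (B x)))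
    (hle : ∀ m, ∫⁻ x, b m x ∂μ ≤ ∫⁻ x, B x ∂μ) :
    Tendsto (fun m => ∫⁻ x, a m x ∂μ) atTop (𝓝 (∫⁻ x, A x ∂μ)) := by
  have hAB : ∀ᵐ x ∂μ, A x ≤ B x := by
    filter_upwards [halim, hlim, ae_all_iff.2 hab] with x h1 h2 h3
    exact le_of_tendsto_of_tendsto' h1 h2 h3
  -- Split a_m ≤ min(a_m, B) + (b_m - B)₊: the first part is dominated by B, and the second vanishes
  -- in the limit.
  have h1 : Tendsto (fun m => ∫⁻ x, min (a m x) (B x) ∂μ) atTop (𝓝 (∫⁻ x, A x ∂μ)) := by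
    refine tendsto_lintegral_of_dominated_convergence' B (fun m => (ha m).min hB)
      (fun m => Eventually.of_forall fun x => min_le_right _ _) hBfin ?_
    filter_upwards [halim, hAB] with x hx hle
    have := hx.min (tendsto_const_nhds (x := B x))
    rwa [min_eq_left hle] at this
  have h2 := tendsto_lintegral_sub_of_lintegral_le hb hB hBfin hlim hle
  have h3 := h1.add h2
  rw [add_zero] at h3
  refine tendsto_of_tendsto_of_tendsto_of_le_of_le h1 h3
    (fun m => lintegral_mono fun x => min_le_left _ _) fun m => ?_
  simp only
  rw [← lintegral_add_left' ((ha m).min hB)]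
  refine lintegral_mono_ae ?_
  filter_upwards [hab m] with x hx
  rcases le_total (a m x) (B x) with h | h
  · rw [min_eq_left h]; exact le_self_add
  · rw [min_eq_right h]
    exact hx.trans le_add_tsub

end Pratt

/-! ### Mollification of weakly differentiable functions -/

/-- The derivative falls on the mollifier, and t ↦ φ(x - t) is a test function supported in a ball
inside K' ⊆ Ω, so the weak derivative may be inserted. Cutting off to K' changes nothing on that
ball. -/
lemma partialX_normed_convolution {Ω K' : Set (Fin n → ℝ)} (hK'Ω : K' ⊆ Ω)
    {i : Fin n} {v g : (Fin n → ℝ) → ℝ} (h : HasWeakPartial Ω i v g)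
    (hV : Integrable (K'.indicator v))
    (φ : ContDiffBump (0 : Fin n → ℝ)) {x : Fin n → ℝ} (hx : Metric.closedBall x φ.rOut ⊆ K') :
    partialX i (φ.normed volume ⋆[ContinuousLinearMap.lsmul ℝ ℝ, volume] K'.indicator v) x =
      (φ.normed volume ⋆[ContinuousLinearMap.lsmul ℝ ℝ, volume] K'.indicator g) x := by
  set F : (Fin n → ℝ) → ℝ := φ.normed volume with hF
  have hFs : ContDiff ℝ ∞ F := φ.contDiff_normed
  have hFc : HasCompactSupport F := φ.hasCompactSupport_normed
  have hder := hFc.hasFDerivAt_convolution_left (ContinuousLinearMap.lsmul ℝ ℝ)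
    (hFs.of_le (by exact_mod_cast le_top)) hV.locallyIntegrable x
  have hF1 : ContDiff ℝ 1 F := hFs.of_le (by exact_mod_cast le_top)
  rw [partialX_eq_fderiv hder.differentiableAt, hder.fderiv]
  have hint := ((hFc.fderiv ℝ).convolutionExists_left
    ((ContinuousLinearMap.lsmul ℝ ℝ).precompL (Fin n → ℝ)) (hF1.continuous_fderiv one_ne_zero)
    hV.locallyIntegrable x).integrable_swap
  rw [convolution_eq_swap, convolution_eq_swap]
  rw [ContinuousLinearMap.integral_apply hint]
  simp only [ContinuousLinearMap.precompL_apply, ContinuousLinearMap.lsmul_apply, smul_eq_mul]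
  set Φ : (Fin n → ℝ) → ℝ := fun t => F (x - t) with hΦ
  have hΦs : ContDiff ℝ ∞ Φ := hFs.comp (contDiff_const.sub contDiff_id)
  have hsuppF : ∀ t, t ∉ K' → x - t ∉ tsupport F := by
    intro t ht hmem
    rw [hF, φ.tsupport_normed_eq, mem_closedBall_zero_iff] at hmem
    exact ht (hx (by rwa [Metric.mem_closedBall, dist_comm, dist_eq_norm]))
  have hsupp : Function.support Φ ⊆ Metric.closedBall x φ.rOut := by
    intro t ht
    have : x - t ∈ tsupport F := subset_tsupport _ ht
    rw [hF, φ.tsupport_normed_eq, mem_closedBall_zero_iff] at this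
    rwa [Metric.mem_closedBall, dist_comm, dist_eq_norm]
  have htsupp : tsupport Φ ⊆ Metric.closedBall x φ.rOut :=
    closure_minimal hsupp Metric.isClosed_closedBall
  have hΦc : HasCompactSupport Φ :=
    (isCompact_closedBall x φ.rOut).of_isClosed_subset (isClosed_tsupport Φ) htsupp
  -- The sign from the reflection t ↦ x - t cancels the sign in the definition of the weak
  -- derivative.
  have hpart : ∀ t, partialX i Φ t = -fderiv ℝ F (x - t) (Pi.single i 1) := by
    intro t
    rw [partialX_eq_fderiv (hΦs.differentiable (by simp) t)]
    have h1 : HasFDerivAt Φ ((fderiv ℝ F (x - t)).comp (-ContinuousLinearMap.id ℝ (Fin n → ℝ))) t :=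
      (hF1.differentiable one_ne_zero (x - t)).hasFDerivAt.comp t
        ((hasFDerivAt_id t).const_sub x)
    rw [h1.fderiv]
    simp
  have hw := h.2.2 Φ hΦs hΦc (htsupp.trans (hx.trans hK'Ω))
  have e1 : ∫ t, fderiv ℝ F (x - t) (Pi.single i 1) * K'.indicator v t =
      -∫ t in Ω, v t * partialX i Φ t := by
    rw [setIntegral_eq_integral_of_forall_compl_eq_zero, ← integral_neg]
    · refine integral_congr_ae (Eventually.of_forall fun t => ?_)
      simp only
      by_cases ht : t ∈ K'
      · rw [indicator_of_mem ht, hpart]; ring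
      · have : fderiv ℝ F (x - t) = 0 := by
          by_contra hne
          exact hsuppF t ht (tsupport_fderiv_subset ℝ (subset_tsupport _ hne))
        rw [indicator_of_notMem ht, hpart, this]; simp
    · intro t ht
      have : fderiv ℝ F (x - t) = 0 := by
        by_contra hne
        exact hsuppF t (fun h => ht (hK'Ω h)) (tsupport_fderiv_subset ℝ (subset_tsupport _ hne))
      rw [hpart, this]; simp
  have e2 : ∫ t, F (x - t) * K'.indicator g t = ∫ t in Ω, g t * Φ t := by
    rw [setIntegral_eq_integral_of_forall_compl_eq_zero]
    · refine integral_congr_ae (Eventually.of_forall fun t => ?_)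
      simp only
      by_cases ht : t ∈ K'
      · rw [indicator_of_mem ht]; ring
      · have : Φ t = 0 := image_eq_zero_of_notMem_tsupport (f := F) (hsuppF t ht)
        rw [indicator_of_notMem ht, this]; simp
    · intro t ht
      have : Φ t = 0 := image_eq_zero_of_notMem_tsupport (f := F) (hsuppF t fun h => ht (hK'Ω h))
      rw [this, mul_zero]
  rw [e1, e2, hw, neg_neg]

/-- Smooth approximation of a function with weak partial derivatives near a compact set. The
approximations of the derivatives are dominated by sequences whose integrals do not exceed those of
their limits. -/
lemma exists_mollification {Ω K : Set (Fin n → ℝ)} (hΩ : IsOpen Ω) (hK : IsCompact K)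
    (hKΩ : K ⊆ Ω) {v : (Fin n → ℝ) → ℝ} {g : Fin n → (Fin n → ℝ) → ℝ}
    (h : ∀ i, HasWeakPartial Ω i v (g i)) (hn : 0 < n) :
    ∃ (V : (Fin n → ℝ) → ℝ) (G : Fin n → (Fin n → ℝ) → ℝ) (vm : ℕ → (Fin n → ℝ) → ℝ)
      (gm bm : ℕ → Fin n → (Fin n → ℝ) → ℝ),
      Integrable V ∧ (∀ i, Integrable (G i)) ∧ EqOn V v K ∧ (∀ i, EqOn (G i) (g i) K) ∧
      (∀ m, ContDiff ℝ 1 (vm m)) ∧ (∀ m i, ∀ x ∈ K, partialX i (vm m) x = gm m i x) ∧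
      (∀ m i, Continuous (bm m i)) ∧ (∀ m i x, |gm m i x| ≤ bm m i x) ∧
      (∀ᵐ x, Tendsto (fun m => vm m x) atTop (𝓝 (V x))) ∧
      (∀ i, ∀ᵐ x, Tendsto (fun m => gm m i x) atTop (𝓝 (G i x))) ∧
      (∀ i, ∀ᵐ x, Tendsto (fun m => bm m i x) atTop (𝓝 |G i x|)) ∧
      (∀ m i, ∫⁻ x, ENNReal.ofReal (bm m i x) ≤ ∫⁻ x, ENNReal.ofReal |G i x|) := by
  obtain ⟨ε, hε, hεΩ⟩ := hK.exists_cthickening_subset_open hΩ hKΩ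
  set K' := Metric.cthickening ε K with hK'def
  have hK' : IsCompact K' := hK.cthickening
  have hKK' : K ⊆ K' := Metric.self_subset_cthickening K
  have hint : ∀ {f : (Fin n → ℝ) → ℝ}, MemLpLoc 1 f Ω → Integrable (K'.indicator f) := by
    intro f hf
    rw [integrable_indicator_iff hK'.measurableSet]
    have := hf K' hεΩ hK'
    rw [ENNReal.ofReal_one, memLp_one_iff_integrable] at this
    exact this
  have hV : Integrable (K'.indicator v) := hint (h ⟨0, hn⟩).1
  have hG : ∀ i, Integrable (K'.indicator (g i)) := fun i => hint (h i).2.1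
  -- The bounded ratio of the radii gives almost everywhere convergence. Outer radii at most ε keep
  -- the mollification at points of K inside the thickening K'.
  let φ : ℕ → ContDiffBump (0 : Fin n → ℝ) := fun m =>
    ⟨ε / (m + 1) / 2, ε / (m + 1), by positivity, half_lt_self (by positivity)⟩
  have hφ0 : Tendsto (fun m => (φ m).rOut) atTop (𝓝 0) := by
    have := (tendsto_one_div_add_atTop_nhds_zero_nat (𝕜 := ℝ)).const_mul ε
    rw [mul_zero] at this
    refine this.congr fun m => ?_
    simp only [φ]; ring
  have hφK : ∀ᶠ m in atTop, (φ m).rOut ≤ 2 * (φ m).rIn := Eventually.of_forall fun m => by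
    simp only [φ]; linarith
  have hφε : ∀ m, (φ m).rOut ≤ ε := fun m => by
    simp only [φ]
    exact div_le_self hε.le (by have : (0 : ℝ) ≤ m := m.cast_nonneg
                                linarith)
  -- The dominating sequence is the mollification of |G|: it dominates the mollified gradient, and
  -- convolution with a function of integral 1 preserves its integral.
  refine ⟨K'.indicator v, fun i => K'.indicator (g i),
    fun m => (φ m).normed volume ⋆[ContinuousLinearMap.lsmul ℝ ℝ, volume] K'.indicator v,
    fun m i => (φ m).normed volume ⋆[ContinuousLinearMap.lsmul ℝ ℝ, volume] K'.indicator (g i),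
    fun m i => (φ m).normed volume ⋆[ContinuousLinearMap.lsmul ℝ ℝ, volume]
      fun x => |K'.indicator (g i) x|,
    hV, hG, fun x hx => indicator_of_mem (hKK' hx) _, fun i x hx => indicator_of_mem (hKK' hx) _,
    ?_, ?_, ?_, ?_, ?_, ?_, ?_, ?_⟩
  · intro m
    exact (φ m).hasCompactSupport_normed.contDiff_convolution_left _ (φ m).contDiff_normed
      hV.locallyIntegrable
  · intro m i x hx
    refine partialX_normed_convolution hεΩ (h i) hV (φ m) fun y hy => ?_
    exact Metric.mem_cthickening_of_dist_le y x ε K hx ((Metric.mem_closedBall.1 hy).trans (hφε m))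
  · intro m i
    exact (φ m).hasCompactSupport_normed.continuous_convolution_left _
      ((φ m).contDiff_normed (n := 0) (μ := volume)).continuous (hG i).abs.locallyIntegrable
  · intro m i x
    simp only [convolution_def, ContinuousLinearMap.lsmul_apply, smul_eq_mul]
    rw [← Real.norm_eq_abs]
    refine (norm_integral_le_integral_norm _).trans_eq (integral_congr_ae
      (Eventually.of_forall fun t => ?_))
    simp only [Real.norm_eq_abs, abs_mul, abs_of_nonneg ((φ m).nonneg_normed t)]
  · exact ContDiffBump.ae_convolution_tendsto_right_of_locallyIntegrable hφ0 hφK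
      hV.locallyIntegrable
  · exact fun i => ContDiffBump.ae_convolution_tendsto_right_of_locallyIntegrable hφ0 hφK
      (hG i).locallyIntegrable
  · exact fun i => ContDiffBump.ae_convolution_tendsto_right_of_locallyIntegrable hφ0 hφK
      (hG i).abs.locallyIntegrable
  · intro m i
    have hφi : Integrable ((φ m).normed volume) := (φ m).integrable_normed
    have hc := hφi.integrable_convolution (ContinuousLinearMap.lsmul ℝ ℝ) (hG i).abs
    have h0 : ∀ x, 0 ≤ ((φ m).normed volume ⋆[ContinuousLinearMap.lsmul ℝ ℝ, volume]
        fun x => |K'.indicator (g i) x|) x := fun x => by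
      simp only [convolution_def, ContinuousLinearMap.lsmul_apply, smul_eq_mul]
      exact integral_nonneg fun t => mul_nonneg ((φ m).nonneg_normed t) (abs_nonneg _)
    rw [← ofReal_integral_eq_lintegral_ofReal hc (Eventually.of_forall h0),
      ← ofReal_integral_eq_lintegral_ofReal (hG i).abs (Eventually.of_forall fun x => abs_nonneg _),
      integral_convolution _ hφi (hG i).abs]
    simp [(φ m).integral_normed]

/-! ### Bounded smooth truncations -/

/-- A bounded `C¹` regularisation of the positive part. -/
noncomputable def posTrunc (a s : ℝ) : ℝ := max s 0 ^ 2 / (a + max s 0 + a * max s 0 ^ 2)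

/-- The derivative of `posTrunc`. -/
noncomputable def posTruncDeriv (a s : ℝ) : ℝ :=
  (2 * a * max s 0 + max s 0 ^ 2) / (a + max s 0 + a * max s 0 ^ 2) ^ 2

lemma posTrunc_denom_pos {a : ℝ} (ha : 0 < a) (s : ℝ) :
    0 < a + max s 0 + a * max s 0 ^ 2 := by
  have : 0 ≤ max s 0 := le_max_right _ _
  positivity

lemma posTrunc_nonneg {a : ℝ} (ha : 0 < a) (s : ℝ) : 0 ≤ posTrunc a s :=
  div_nonneg (sq_nonneg _) (posTrunc_denom_pos ha s).le

lemma posTrunc_le {a : ℝ} (ha : 0 < a) (s : ℝ) : posTrunc a s ≤ max s 0 := by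
  have h : 0 ≤ max s 0 := le_max_right _ _
  rw [posTrunc, div_le_iff₀ (posTrunc_denom_pos ha s)]
  have := mul_nonneg (mul_nonneg ha.le h) (sq_nonneg (max s 0))
  nlinarith [mul_nonneg ha.le h]

lemma posTrunc_le_inv {a : ℝ} (ha : 0 < a) (s : ℝ) : posTrunc a s ≤ a⁻¹ := by
  have h : 0 ≤ max s 0 := le_max_right _ _
  rw [posTrunc, div_le_iff₀ (posTrunc_denom_pos ha s)]
  have : a⁻¹ * (a + max s 0 + a * max s 0 ^ 2) = 1 + a⁻¹ * max s 0 + max s 0 ^ 2 := by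
    field_simp
  rw [this]
  have : 0 ≤ a⁻¹ * max s 0 := by positivity
  linarith

lemma posTruncDeriv_nonneg {a : ℝ} (ha : 0 < a) (s : ℝ) : 0 ≤ posTruncDeriv a s := by
  have h : 0 ≤ max s 0 := le_max_right _ _
  unfold posTruncDeriv
  positivity

/-- This is what keeps the gradient of the truncation below that of the original function. -/
lemma posTruncDeriv_le_one {a : ℝ} (ha : 0 < a) (s : ℝ) : posTruncDeriv a s ≤ 1 := by
  have h : 0 ≤ max s 0 := le_max_right _ _
  rw [posTruncDeriv, div_le_one (pow_pos (posTrunc_denom_pos ha s) 2)]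
  set q := max s 0
  have : (a + q + a * q ^ 2) ^ 2 = 2 * a * q + q ^ 2 + (a ^ 2 + 2 * (a + q) * (a * q ^ 2) +
    (a * q ^ 2) ^ 2) := by ring
  rw [this]
  have : 0 ≤ a ^ 2 + 2 * (a + q) * (a * q ^ 2) + (a * q ^ 2) ^ 2 := by positivity
  linarith

lemma posTruncDeriv_of_nonpos {a s : ℝ} (hs : s ≤ 0) : posTruncDeriv a s = 0 := by
  simp [posTruncDeriv, max_eq_right hs]

lemma continuous_posTruncDeriv {a : ℝ} (ha : 0 < a) : Continuous (posTruncDeriv a) := by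
  have h : Continuous fun s : ℝ => max s 0 := continuous_id.max continuous_const
  unfold posTruncDeriv
  exact ((continuous_const.mul h).add (h.pow 2)).div
    (((continuous_const.add h).add (continuous_const.mul (h.pow 2))).pow 2)
    fun s => (pow_pos (posTrunc_denom_pos ha s) 2).ne'

/-- The quadratic numerator makes the branches meet at 0 with slope 0, where `posTrunc a` is at most
y²/a. The term with the square in the denominator is the one that makes the truncation bounded. -/
lemma hasDerivAt_posTrunc {a : ℝ} (ha : 0 < a) (s : ℝ) :
    HasDerivAt (posTrunc a) (posTruncDeriv a s) s := by
  rcases lt_trichotomy s 0 with hs | hs | hs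
  · rw [posTruncDeriv_of_nonpos hs.le]
    refine (hasDerivAt_const s (0 : ℝ)).congr_of_eventuallyEq ?_
    filter_upwards [Iio_mem_nhds hs] with y hy
    simp [posTrunc, max_eq_right (le_of_lt (mem_Iio.1 hy))]
  · subst hs
    rw [posTruncDeriv_of_nonpos le_rfl]
    rw [hasDerivAt_iff_isLittleO_nhds_zero]
    have h0 : posTrunc a 0 = 0 := by simp [posTrunc]
    have hb : ∀ y, ‖posTrunc a (0 + y) - posTrunc a 0 - y • (0 : ℝ)‖ ≤ a⁻¹ * ‖y ^ 2‖ := by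
      intro y
      rw [h0, zero_add, smul_zero, sub_zero, sub_zero, Real.norm_of_nonneg (posTrunc_nonneg ha y),
        Real.norm_of_nonneg (sq_nonneg y), posTrunc, div_le_iff₀ (posTrunc_denom_pos ha y)]
      have hq : 0 ≤ max y 0 := le_max_right _ _
      have h1 : max y 0 ^ 2 ≤ y ^ 2 := by
        rcases le_total y 0 with h | h
        · rw [max_eq_right h]; nlinarith [sq_nonneg y]
        · rw [max_eq_left h]
      have : a⁻¹ * y ^ 2 * (a + max y 0 + a * max y 0 ^ 2) =
          y ^ 2 + a⁻¹ * y ^ 2 * (max y 0 + a * max y 0 ^ 2) := by field_simp; ring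
      rw [this]
      have : 0 ≤ a⁻¹ * y ^ 2 * (max y 0 + a * max y 0 ^ 2) := by positivity
      linarith
    refine (Asymptotics.IsBigO.of_bound a⁻¹ (Eventually.of_forall hb)).trans_isLittleO ?_
    exact Asymptotics.isLittleO_pow_id one_lt_two
  · have hD := posTrunc_denom_pos ha s
    rw [max_eq_left hs.le] at hD
    have h1 : HasDerivAt (fun y : ℝ => y ^ 2 / (a + y + a * y ^ 2)) _ s :=
      ((hasDerivAt_id s).pow 2).div (((hasDerivAt_id s).const_add a).add
        (((hasDerivAt_id s).pow 2).const_mul a)) hD.ne'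
    have h2 : HasDerivAt (fun y : ℝ => y ^ 2 / (a + y + a * y ^ 2)) (posTruncDeriv a s) s := by
      convert h1 using 1
      simp only [posTruncDeriv, max_eq_left hs.le, id, Pi.pow_apply]
      congr 1
      push_cast
      ring
    refine h2.congr_of_eventuallyEq ?_
    filter_upwards [Ioi_mem_nhds hs] with y hy
    simp [posTrunc, max_eq_left (le_of_lt (mem_Ioi.1 hy))]

lemma contDiff_posTrunc {a : ℝ} (ha : 0 < a) : ContDiff ℝ 1 (posTrunc a) := by
  rw [contDiff_one_iff_deriv]
  refine ⟨fun s => (hasDerivAt_posTrunc ha s).differentiableAt, ?_⟩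
  rw [show deriv (posTrunc a) = posTruncDeriv a from funext fun s => (hasDerivAt_posTrunc ha s).deriv]
  exact continuous_posTruncDeriv ha

lemma tendsto_posTrunc {a : ℕ → ℝ} (ha : Tendsto a atTop (𝓝 0)) (s : ℝ) :
    Tendsto (fun m => posTrunc (a m) s) atTop (𝓝 (max s 0)) := by
  rcases le_or_gt s 0 with hs | hs
  · simp [posTrunc, max_eq_right hs]
  · have : Tendsto (fun m => a m + max s 0 + a m * max s 0 ^ 2) atTop
        (𝓝 (0 + max s 0 + 0 * max s 0 ^ 2)) := (ha.add_const _).add (ha.mul_const _)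
    have h1 := (tendsto_const_nhds (x := max s 0 ^ 2)).div this (by
      rw [max_eq_left hs.le]; simpa using hs.ne')
    have e : max s 0 = max s 0 ^ 2 / (0 + max s 0 + 0 * max s 0 ^ 2) := by
      rw [max_eq_left hs.le]
      field_simp
      ring
    rw [← e] at h1
    exact h1

/-! ### The Sobolev inequality for truncations of weakly differentiable functions -/

/-- The C¹ inequality holds for Θ(v_m)χ with mollified v_m. Fatou's lemma handles the left side and
Pratt's lemma the right side. As Θ is bounded, the right side grows linearly in the gradient, so an
L¹ gradient suffices. -/
lemma lintegral_prod_rpow_le_of_hasWeakPartial (hn : 2 ≤ n) {Ω : Set (Fin n → ℝ)} (hΩ : IsOpen Ω)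
    {v : (Fin n → ℝ) → ℝ} {g : Fin n → (Fin n → ℝ) → ℝ} (h : ∀ i, HasWeakPartial Ω i v (g i))
    {χ : (Fin n → ℝ) → ℝ} (hχ : ContDiff ℝ 1 χ) (hχc : HasCompactSupport χ)
    (hχΩ : tsupport χ ⊆ Ω) (hχr : ∀ x, χ x ∈ Icc (0 : ℝ) 1)
    {Θ Θ' : ℝ → ℝ} (hΘ : ∀ s, HasDerivAt Θ (Θ' s) s) (hΘ'c : Continuous Θ') {M : ℝ}
    (hΘ0 : ∀ s, 0 ≤ Θ s) (hΘM : ∀ s, Θ s ≤ M) (hΘ'1 : ∀ s, |Θ' s| ≤ 1)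
    {γ lam : Fin n → ℝ} (hγ : ∀ i, 1 < γ i) (hlam : ∀ i, 0 ≤ lam i) :
    ∫⁻ x, ∏ i, ENNReal.ofReal (lam i * (Θ (v x) * χ x) ^ γ i) ^ (1 / ((n : ℝ) - 1)) ≤
      (∫⁻ x, ∑ i, ENNReal.ofReal (lam i * γ i * (Θ (v x) * χ x) ^ (γ i - 1) *
        |Θ' (v x) * g i x * χ x + Θ (v x) * partialX i χ x|)) ^ ((n : ℝ) / (n - 1)) := by
  have hn1 : (1 : ℝ) < n := by exact_mod_cast hn
  have hn0 : (0 : ℝ) < (n : ℝ) - 1 := by linarith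
  have hM : 0 ≤ M := (hΘ0 0).trans (hΘM 0)
  obtain ⟨V, G, vm, gm, bm, hV, hG, hVv, hGg, hvm, hpd, hbm, hgb, hvlim, hglim, hblim, hbint⟩ :=
    exists_mollification hΩ hχc hχΩ h (by omega)
  have hΘc : ContDiff ℝ 1 Θ := by
    rw [contDiff_one_iff_deriv]
    refine ⟨fun s => (hΘ s).differentiableAt, ?_⟩
    rwa [show deriv Θ = Θ' from funext fun s => (hΘ s).deriv]
  have hχ0 : ∀ x, x ∉ tsupport χ → χ x = 0 := fun x hx => image_eq_zero_of_notMem_tsupport hx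
  have hχd0 : ∀ i x, x ∉ tsupport χ → partialX i χ x = 0 := fun i x hx => by
    have : fderiv ℝ χ x = 0 := by
      by_contra hne
      exact hx (tsupport_fderiv_subset ℝ (subset_tsupport _ hne))
    rw [partialX_eq_fderiv (hχ.differentiable one_ne_zero x), this]; simp
  -- replace `v`, `g` by their integrable extensions
  have eW : ∀ x, Θ (v x) * χ x = Θ (V x) * χ x := fun x => by
    by_cases hx : x ∈ tsupport χ
    · rw [hVv hx]
    · rw [hχ0 x hx, mul_zero, mul_zero]
  have eD : ∀ i x, Θ' (v x) * g i x * χ x + Θ (v x) * partialX i χ x =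
      Θ' (V x) * G i x * χ x + Θ (V x) * partialX i χ x := fun i x => by
    by_cases hx : x ∈ tsupport χ
    · rw [hVv hx, hGg i hx]
    · rw [hχ0 x hx, hχd0 i x hx]; simp
  simp_rw [eW, eD]
  set Wm : ℕ → (Fin n → ℝ) → ℝ := fun m x => Θ (vm m x) * χ x with hWm
  have hWms : ∀ m, ContDiff ℝ 1 (Wm m) := fun m => (hΘc.comp (hvm m)).mul hχ
  have hWmc : ∀ m, HasCompactSupport (Wm m) := fun m => hχc.mul_left
  have hWm0 : ∀ m x, 0 ≤ Wm m x := fun m x => mul_nonneg (hΘ0 _) (hχr x).1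
  have hWmM : ∀ m x, Wm m x ≤ M := fun m x =>
    (mul_le_mul (hΘM _) (hχr x).2 (hχr x).1 hM).trans_eq (mul_one M)
  have hWmd : ∀ m i x, partialX i (Wm m) x =
      Θ' (vm m x) * gm m i x * χ x + Θ (vm m x) * partialX i χ x := by
    intro m i x
    have h1 : HasDerivAt (fun s => vm m (Function.update x i s)) (partialX i (vm m) x) (x i) :=
      ((((hvm m).comp (contDiff_update 1 x i)).differentiable one_ne_zero) (x i)).hasDerivAt
    have h2 : HasDerivAt (fun s => χ (Function.update x i s)) (partialX i χ x) (x i) :=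
      (((hχ.comp (contDiff_update 1 x i)).differentiable one_ne_zero) (x i)).hasDerivAt
    have h3 := ((hΘ _).comp (x i) h1).mul h2
    have h4 : partialX i (Wm m) x = _ := h3.deriv
    rw [h4]
    simp only [Function.comp, Function.update_eq_self]
    by_cases hx : x ∈ tsupport χ
    · rw [hpd m i x hx]
    · rw [hχ0 x hx]; ring
  have hsm := fun m => lintegral_prod_rpow_le hn (hWms m) (hWmc m) (hWm0 m) hγ hlam
  have hWlim : ∀ᵐ x, Tendsto (fun m => Wm m x) atTop (𝓝 (Θ (V x) * χ x)) := by
    filter_upwards [hvlim] with x hx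
    exact ((hΘc.continuous.tendsto _).comp hx).mul_const _
  have hpcont : ∀ i, Continuous (partialX i χ) := continuous_partialX hχ
  have hpint : ∀ i, Integrable (partialX i χ) := fun i =>
    (hpcont i).integrable_of_hasCompactSupport
      (HasCompactSupport.intro hχc fun x hx => hχd0 i x hx)
  -- The power of the function is replaced by the corresponding power of its bound M, leaving a
  -- majorant that is linear in the mollified |G|.
  set c : Fin n → ℝ := fun i => lam i * γ i * M ^ (γ i - 1) with hc
  have hc0 : ∀ i, 0 ≤ c i := fun i =>
    mul_nonneg (mul_nonneg (hlam i) (by linarith [hγ i])) (Real.rpow_nonneg hM _)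
  have hBi : ∀ i, Integrable fun x => c i * (|G i x| + M * |partialX i χ x|) := fun i =>
    ((hG i).abs.add ((hpint i).abs.const_mul M)).const_mul (c i)
  have hbi : ∀ m i, Continuous fun x => c i * (bm m i x + M * |partialX i χ x|) := fun m i =>
    continuous_const.mul ((hbm m i).add (continuous_const.mul (hpcont i).abs))
  have hMp : ∀ i, AEMeasurable fun x => ENNReal.ofReal (M * |partialX i χ x|) := fun i =>
    (continuous_const.mul (hpcont i).abs).measurable.ennreal_ofReal.aemeasurable
  have hPratt := tendsto_lintegral_of_le_of_lintegral_le (μ := (volume : Measure (Fin n → ℝ)))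
    (a := fun m x => ∑ i, ENNReal.ofReal (lam i * γ i * Wm m x ^ (γ i - 1) * |partialX i (Wm m) x|))
    (b := fun m x => ∑ i, ENNReal.ofReal (c i * (bm m i x + M * |partialX i χ x|)))
    (A := fun x => ∑ i, ENNReal.ofReal (lam i * γ i * (Θ (V x) * χ x) ^ (γ i - 1) *
        |Θ' (V x) * G i x * χ x + Θ (V x) * partialX i χ x|))
    (B := fun x => ∑ i, ENNReal.ofReal (c i * (|G i x| + M * |partialX i χ x|)))
    (fun m => by
      refine Finset.aemeasurable_fun_sum _ fun i _ => ENNReal.measurable_ofReal.comp_aemeasurable ?_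
      have h1 : Continuous fun x => Wm m x ^ (γ i - 1) :=
        (hWms m).continuous.rpow_const fun x => Or.inr (by linarith [hγ i])
      exact ((continuous_const.mul h1).mul
        (continuous_partialX (hWms m) i).abs).measurable.aemeasurable)
    (fun m => Finset.aemeasurable_fun_sum _ fun i _ => (hbi m i).measurable.ennreal_ofReal.aemeasurable)
    (Finset.aemeasurable_fun_sum _ fun i _ =>
        (hBi i).1.aemeasurable.ennreal_ofReal)
    (by
      rw [lintegral_finsetSum' _ fun i _ =>
        (hBi i).1.aemeasurable.ennreal_ofReal]
      exact (ENNReal.sum_lt_top.2 fun i _ => (hBi i).lintegral_lt_top).ne)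
    (fun m => Eventually.of_forall fun x => Finset.sum_le_sum fun i _ => by
      refine ENNReal.ofReal_le_ofReal ?_
      have h1 : Wm m x ^ (γ i - 1) ≤ M ^ (γ i - 1) :=
        Real.rpow_le_rpow (hWm0 m x) (hWmM m x) (by linarith [hγ i])
      have h2 : |partialX i (Wm m) x| ≤ bm m i x + M * |partialX i χ x| := by
        rw [hWmd]
        refine (abs_add_le _ _).trans (add_le_add ?_ ?_)
        · rw [abs_mul, abs_mul, abs_of_nonneg (hχr x).1]
          calc _ ≤ 1 * |gm m i x| * 1 := by
                gcongr
                · exact (hχr x).1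
                · exact hΘ'1 _
                · exact (hχr x).2
            _ ≤ _ := by rw [one_mul, mul_one]; exact hgb m i x
        · rw [abs_mul, abs_of_nonneg (hΘ0 _)]
          gcongr
          exact hΘM _
      have h3 : 0 ≤ lam i * γ i := mul_nonneg (hlam i) (by linarith [hγ i])
      exact mul_le_mul (mul_le_mul_of_nonneg_left h1 h3) h2 (abs_nonneg _) (hc0 i))
    (by
      filter_upwards [hvlim, ae_all_iff.2 hglim, hWlim] with x h1 h2 h3
      refine tendsto_finsetSum _ fun i _ => ENNReal.tendsto_ofReal ?_
      simp_rw [hWmd]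
      have h4 : Tendsto (fun m => Wm m x ^ (γ i - 1)) atTop (𝓝 ((Θ (V x) * χ x) ^ (γ i - 1))) :=
        h3.rpow_const (Or.inr (by linarith [hγ i]))
      refine (h4.const_mul _).mul (Tendsto.abs ?_)
      exact ((((hΘ'c.tendsto _).comp h1).mul (h2 i)).mul_const _).add
        (((hΘc.continuous.tendsto _).comp h1).mul_const _))
    (by
      filter_upwards [ae_all_iff.2 hblim] with x hx
      exact tendsto_finsetSum _ fun i _ => ENNReal.tendsto_ofReal
        (((hx i).add_const _).const_mul _))
    (fun m => by
      rw [lintegral_finsetSum' _ fun i _ => (hbi m i).measurable.ennreal_ofReal.aemeasurable,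
        lintegral_finsetSum' _ fun i _ =>
        (hBi i).1.aemeasurable.ennreal_ofReal]
      refine Finset.sum_le_sum fun i _ => ?_
      have hb0 : ∀ x, 0 ≤ bm m i x := fun x => (abs_nonneg _).trans (hgb m i x)
      have hp0 : ∀ x, 0 ≤ M * |partialX i χ x| := fun x => mul_nonneg hM (abs_nonneg _)
      simp_rw [ENNReal.ofReal_mul (hc0 i), ENNReal.ofReal_add (hb0 _) (hp0 _),
        ENNReal.ofReal_add (abs_nonneg _) (hp0 _)]
      rw [lintegral_const_mul' _ _ ENNReal.ofReal_ne_top,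
        lintegral_const_mul' _ _ ENNReal.ofReal_ne_top,
        lintegral_add_right' _ (hMp i),
        lintegral_add_right' _ (hMp i)]
      gcongr _ * (?_ + _)
      exact hbint m i)
  have hpos : (0 : ℝ) ≤ (n : ℝ) / (n - 1) := by positivity
  have hR := (ENNReal.continuous_rpow_const (y := (n : ℝ) / (n - 1))).tendsto _ |>.comp hPratt
  have hq : (0 : ℝ) ≤ 1 / ((n : ℝ) - 1) := by positivity
  have hFatou := lintegral_liminf_le' (u := atTop) (μ := (volume : Measure (Fin n → ℝ)))
    (f := fun m x => ∏ i, ENNReal.ofReal (lam i * Wm m x ^ γ i) ^ (1 / ((n : ℝ) - 1)))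
    (fun m => Finset.aemeasurable_fun_prod _ fun i _ => by
      have h1 : Continuous fun x => Wm m x ^ γ i :=
        (hWms m).continuous.rpow_const fun x => Or.inr (by linarith [hγ i])
      exact ((continuous_const.mul h1).measurable.ennreal_ofReal.pow_const _).aemeasurable)
  have hL : ∫⁻ x, ∏ i, ENNReal.ofReal (lam i * (Θ (V x) * χ x) ^ γ i) ^ (1 / ((n : ℝ) - 1)) =
      ∫⁻ x, liminf (fun m => ∏ i, ENNReal.ofReal (lam i * Wm m x ^ γ i) ^ (1 / ((n : ℝ) - 1)))
        atTop := by
    refine lintegral_congr_ae ?_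
    filter_upwards [hWlim] with x hx
    refine (Tendsto.liminf_eq ?_).symm
    refine ENNReal.tendsto_finsetProd_of_ne_top _ (fun i _ => ?_) fun i _ =>
      ENNReal.rpow_ne_top_of_nonneg hq ENNReal.ofReal_ne_top
    refine ((ENNReal.continuous_rpow_const (y := 1 / ((n : ℝ) - 1))).tendsto _).comp
      (ENNReal.tendsto_ofReal ((hx.rpow_const (Or.inr (by linarith [hγ i]))).const_mul _))
  rw [hL]
  refine hFatou.trans ?_
  rw [← hR.liminf_eq]
  exact liminf_le_liminf (Eventually.of_forall fun m => hsm m)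

/-! ### The anisotropic Sobolev inequality -/

lemma sum_inv_eq (p : Fin n → ℝ) (hn : 0 < n) :
    ∑ i, 1 / p i = n / pbar p := by
  have : (n : ℝ) ≠ 0 := by exact_mod_cast hn.ne'
  rw [pbar, div_inv_eq_mul]
  field_simp

lemma pbar_pos {p : Fin n → ℝ} (hp : ∀ i, 1 < p i) (hn : 0 < n) : 0 < pbar p := by
  have : 0 < ∑ i, 1 / p i := by
    have : Nonempty (Fin n) := ⟨⟨0, hn⟩⟩
    exact Finset.sum_pos (fun i _ => by have := hp i; positivity) Finset.univ_nonempty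
  have hn' : (0 : ℝ) < n := by exact_mod_cast hn
  unfold pbar
  positivity

/-- The Sobolev exponent `n p̄ / (n - p̄)`. -/
noncomputable def sobExp (p : Fin n → ℝ) : ℝ := n * pbar p / (n - pbar p)

/-- The powers to which a function is raised in the proof of the anisotropic Sobolev inequality. -/
noncomputable def sobPow (p : Fin n → ℝ) (i : Fin n) : ℝ := 1 + sobExp p * (1 - 1 / p i)

lemma sobExp_pos {p : Fin n → ℝ} (hn : 2 ≤ n) (hp : ∀ i, 1 < p i)
    (hpn : pbar p < n) : 0 < sobExp p := by
  have h1 := pbar_pos hp (by omega)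
  have hn' : (0 : ℝ) < n := by exact_mod_cast (by omega : 0 < n)
  exact div_pos (mul_pos hn' h1) (by linarith)

lemma one_lt_sobPow {p : Fin n → ℝ} (hn : 2 ≤ n) (hp : ∀ i, 1 < p i)
    (hpn : pbar p < n) (i : Fin n) : 1 < sobPow p i := by
  have h1 := sobExp_pos hn hp hpn
  have h2 : 1 / p i < 1 := by
    rw [div_lt_one (by linarith [hp i])]; exact hp i
  have : 0 < sobExp p * (1 - 1 / p i) := mul_pos h1 (by linarith)
  unfold sobPow
  linarith

/-- With s = `sobExp p`, this total makes the product of the powers W^{γᵢ/(n-1)} equal to W^s. At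
the same time γᵢ - 1 = s(1 - 1/pᵢ), so Hölder's inequality in each direction produces the same
integral of W^s. -/
lemma sum_sobPow {p : Fin n → ℝ} (hn : 2 ≤ n) (hp : ∀ i, 1 < p i)
    (hpn : pbar p < n) :
    ∑ i, sobPow p i = sobExp p * (n - 1) := by
  have h1 := pbar_pos hp (by omega)
  unfold sobPow
  rw [Finset.sum_add_distrib, ← Finset.mul_sum, Finset.sum_sub_distrib, sum_inv_eq p (by omega)]
  simp only [Finset.sum_const, Finset.card_univ, Fintype.card_fin, nsmul_eq_mul, mul_one]
  unfold sobExp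
  have : (n : ℝ) - pbar p ≠ 0 := by linarith
  field_simp
  ring

section Optimise

variable {α : Type*} [MeasurableSpace α] {μ : Measure α}

/-- The product of the weights is a monomial in I and H whose exponents involve only n and p̄, so
after taking logarithms the claim is linear. -/
lemma optimise_real (hn : 2 ≤ n) {p : Fin n → ℝ} (hp : ∀ i, 1 < p i)
    {I H S : ℝ} (hI : 0 < I) (hH : 0 < H) (hS : 0 < S)
    (h : (∏ i, (I ^ (1 - 1 / p i) * H ^ (1 / p i))⁻¹) ^ (1 / ((n : ℝ) - 1)) * I ≤
      S ^ ((n : ℝ) / (n - 1))) :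
    I ^ ((n - pbar p) / n) ≤ S ^ pbar p * H := by
  have hP := pbar_pos hp (by omega)
  have hn1 : (1 : ℝ) < n := by exact_mod_cast hn
  have hn0 : (0 : ℝ) < (n : ℝ) - 1 := by linarith
  have e1 : ∏ i, (I ^ (1 - 1 / p i) * H ^ (1 / p i))⁻¹ =
      (I ^ ((n : ℝ) - n / pbar p) * H ^ ((n : ℝ) / pbar p))⁻¹ := by
    rw [Finset.prod_inv_distrib, Finset.prod_mul_distrib, ← Real.rpow_sum_of_pos hI,
      ← Real.rpow_sum_of_pos hH, Finset.sum_sub_distrib, sum_inv_eq p (by omega)]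
    simp
  rw [e1] at h
  have hIp : ∀ y : ℝ, 0 < I ^ y := Real.rpow_pos_of_pos hI
  have hHp : ∀ y : ℝ, 0 < H ^ y := Real.rpow_pos_of_pos hH
  have hSp : ∀ y : ℝ, 0 < S ^ y := Real.rpow_pos_of_pos hS
  have h2 := Real.log_le_log (mul_pos (Real.rpow_pos_of_pos
    (inv_pos.2 (mul_pos (hIp _) (hHp _))) _) hI) h
  rw [Real.log_mul (Real.rpow_pos_of_pos (inv_pos.2 (mul_pos (hIp _) (hHp _))) _).ne' hI.ne',
    Real.log_rpow (inv_pos.2 (mul_pos (hIp _) (hHp _))), Real.log_inv,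
    Real.log_mul (hIp _).ne' (hHp _).ne', Real.log_rpow hI, Real.log_rpow hH,
    Real.log_rpow hS] at h2
  rw [← Real.log_le_log_iff (hIp _) (mul_pos (hSp _) hH), Real.log_mul (hSp _).ne' hH.ne',
    Real.log_rpow hI, Real.log_rpow hS]
  -- This multiplier turns the coefficient of log H into -1.
  have h3 := mul_le_mul_of_nonneg_left h2 (by positivity : 0 ≤ ((n : ℝ) - 1) * (pbar p / n))
  have e2 : ((n : ℝ) - 1) * (pbar p / n) * (1 / ((n : ℝ) - 1) *
      -(((n : ℝ) - n / pbar p) * Real.log I + n / pbar p * Real.log H) + Real.log I) =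
      (n - pbar p) / n * Real.log I - Real.log H := by
    field_simp
    ring
  have e3 : ((n : ℝ) - 1) * (pbar p / n) * ((n : ℝ) / (n - 1) * Real.log S) =
      pbar p * Real.log S := by
    field_simp
  rw [e2, e3] at h3
  linarith

/-- With I = ∫ W^s and H a common bound for the ∫ Dᵢ^{pᵢ}, Hölder's inequality bounds the i-th
derivative integral by aᵢ = I^(1-1/pᵢ) H^(1/pᵢ). The weights 1/aᵢ normalise every term of the sum,
and the remaining inequality is solved for I. Finiteness of I is needed for this absorption. -/
lemma rpow_lintegral_le_of_grid (hn : 2 ≤ n) {p : Fin n → ℝ} (hp : ∀ i, 1 < p i)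
    (hpn : pbar p < n) {W : α → ℝ} {D : Fin n → α → ℝ} (hW0 : ∀ x, 0 ≤ W x)
    (hD0 : ∀ i x, 0 ≤ D i x) (hWm : AEMeasurable W μ) (hDm : ∀ i, AEMeasurable (D i) μ)
    (hfin : ∫⁻ x, ENNReal.ofReal (W x ^ sobExp p) ∂μ ≠ ⊤)
    (hgrid : ∀ lam : Fin n → ℝ, (∀ i, 0 ≤ lam i) →
      ∫⁻ x, ∏ i, ENNReal.ofReal (lam i * W x ^ sobPow p i) ^ (1 / ((n : ℝ) - 1)) ∂μ ≤
        (∫⁻ x, ∑ i, ENNReal.ofReal (lam i * sobPow p i * W x ^ (sobPow p i - 1) * D i x) ∂μ) ^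
          ((n : ℝ) / (n - 1))) :
    (∫⁻ x, ENNReal.ofReal (W x ^ sobExp p) ∂μ) ^ ((n - pbar p) / n) ≤
      ENNReal.ofReal ((∑ i, sobPow p i) ^ pbar p) *
        ∑ i, ∫⁻ x, ENNReal.ofReal (D i x ^ p i) ∂μ := by
  have hP := pbar_pos hp (by omega)
  have hn1 : (1 : ℝ) < n := by exact_mod_cast hn
  have hn0 : (0 : ℝ) < (n : ℝ) - 1 := by linarith
  have hs := sobExp_pos hn hp hpn
  have hp0 : ∀ i, 0 < p i := fun i => by linarith [hp i]
  have hγ := one_lt_sobPow hn hp hpn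
  have hγ0 : ∀ i, 0 < sobPow p i := fun i => by linarith [hγ i]
  have he : 0 < (n - pbar p) / n := div_pos (by linarith) (by linarith)
  have hS : 0 < ∑ i, sobPow p i := by
    rw [sum_sobPow hn hp hpn]; exact mul_pos hs hn0
  set S := ∑ i, sobPow p i with hSdef
  have hSP : 0 < S ^ pbar p := Real.rpow_pos_of_pos hS _
  set I := ∫⁻ x, ENNReal.ofReal (W x ^ sobExp p) ∂μ with hIdef
  rcases eq_or_ne I 0 with hI0 | hI0
  · rw [hI0, ENNReal.zero_rpow_of_pos he]; exact zero_le
  have hIr : 0 < I.toReal := ENNReal.toReal_pos hI0 hfin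
  have hIof : ENNReal.ofReal I.toReal = I := ENNReal.ofReal_toReal hfin
  -- the bound in terms of a common upper bound for the derivatives
  have key : ∀ H : ℝ, 0 < H → (∀ i, ∫⁻ x, ENNReal.ofReal (D i x ^ p i) ∂μ ≤ ENNReal.ofReal H) →
      I.toReal ^ ((n - pbar p) / n) ≤ S ^ pbar p * H := by
    intro H hH hDH
    refine optimise_real hn hp hIr hH hS ?_
    set a : Fin n → ℝ := fun i => I.toReal ^ (1 - 1 / p i) * H ^ (1 / p i) with ha
    have ha0 : ∀ i, 0 < a i := fun i =>
      mul_pos (Real.rpow_pos_of_pos hIr _) (Real.rpow_pos_of_pos hH _)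
    have hJ : ∀ i, ∫⁻ x, ENNReal.ofReal (W x ^ (sobPow p i - 1) * D i x) ∂μ ≤
        ENNReal.ofReal (a i) := by
      intro i
      have h1p : 0 ≤ 1 - 1 / p i := by
        rw [sub_nonneg, div_le_one (hp0 i)]; exact (hp i).le
      have h1p' : 0 ≤ 1 / p i := by have := hp0 i; positivity
      have hHol := ENNReal.lintegral_mul_norm_pow_le (μ := μ)
        (f := fun x => ENNReal.ofReal (W x ^ sobExp p))
        (g := fun x => ENNReal.ofReal (D i x ^ p i))
        (hWm.pow_const _).ennreal_ofReal ((hDm i).pow_const _).ennreal_ofReal h1p h1p' (by ring)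
      have e : ∀ x, ENNReal.ofReal (W x ^ sobExp p) ^ (1 - 1 / p i) *
          ENNReal.ofReal (D i x ^ p i) ^ (1 / p i) =
          ENNReal.ofReal (W x ^ (sobPow p i - 1) * D i x) := by
        intro x
        rw [ENNReal.ofReal_rpow_of_nonneg (Real.rpow_nonneg (hW0 x) _) h1p,
          ENNReal.ofReal_rpow_of_nonneg (Real.rpow_nonneg (hD0 i x) _) h1p',
          ← Real.rpow_mul (hW0 x), ← Real.rpow_mul (hD0 i x), mul_one_div_cancel (hp0 i).ne',
          Real.rpow_one, ← ENNReal.ofReal_mul (Real.rpow_nonneg (hW0 x) _)]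
        congr 3
        simp [sobPow]
      simp_rw [e] at hHol
      refine hHol.trans ?_
      rw [ha, ENNReal.ofReal_mul (Real.rpow_nonneg hIr.le _),
        ← ENNReal.ofReal_rpow_of_nonneg hIr.le h1p, hIof,
        ← ENNReal.ofReal_rpow_of_nonneg hH.le h1p']
      gcongr
      exact hDH i
    have hg := hgrid (fun i => (a i)⁻¹) fun i => (inv_pos.2 (ha0 i)).le
    have hR : ∫⁻ x, ∑ i, ENNReal.ofReal ((a i)⁻¹ * sobPow p i * W x ^ (sobPow p i - 1) * D i x) ∂μ ≤
        ENNReal.ofReal S := by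
      have hm : ∀ i, AEMeasurable (fun x =>
          (a i)⁻¹ * sobPow p i * W x ^ (sobPow p i - 1) * D i x) μ := fun i =>
        ((hWm.pow_const _).const_mul _).mul (hDm i)
      rw [lintegral_finsetSum' _ fun i _ => (hm i).ennreal_ofReal]
      rw [hSdef, ENNReal.ofReal_sum_of_nonneg fun i _ => (hγ0 i).le]
      refine Finset.sum_le_sum fun i _ => ?_
      have h0 : 0 ≤ (a i)⁻¹ * sobPow p i := mul_nonneg (inv_pos.2 (ha0 i)).le (hγ0 i).le
      simp_rw [mul_assoc ((a i)⁻¹ * sobPow p i), ENNReal.ofReal_mul h0]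
      rw [lintegral_const_mul' _ _ ENNReal.ofReal_ne_top]
      refine (mul_le_mul_right (hJ i) _).trans ?_
      rw [← ENNReal.ofReal_mul h0]
      refine ENNReal.ofReal_le_ofReal (le_of_eq ?_)
      have := (ha0 i).ne'
      field_simp
    have hq : 0 ≤ 1 / ((n : ℝ) - 1) := by positivity
    have hL : ∀ x, ∏ i, ENNReal.ofReal ((a i)⁻¹ * W x ^ sobPow p i) ^ (1 / ((n : ℝ) - 1)) =
        ENNReal.ofReal ((∏ i, (a i)⁻¹) ^ (1 / ((n : ℝ) - 1))) *
          ENNReal.ofReal (W x ^ sobExp p) := by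
      intro x
      have hpa : 0 ≤ ∏ i, (a i)⁻¹ := Finset.prod_nonneg fun i _ => (inv_pos.2 (ha0 i)).le
      rw [ENNReal.prod_rpow_of_nonneg hq, ← ENNReal.ofReal_prod_of_nonneg fun i _ =>
        mul_nonneg (inv_pos.2 (ha0 i)).le (Real.rpow_nonneg (hW0 x) _),
        Finset.prod_mul_distrib, ENNReal.ofReal_rpow_of_nonneg (mul_nonneg hpa
          (Finset.prod_nonneg fun i _ => Real.rpow_nonneg (hW0 x) _)) hq,
        Real.mul_rpow hpa (Finset.prod_nonneg fun i _ => Real.rpow_nonneg (hW0 x) _),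
        ENNReal.ofReal_mul (Real.rpow_nonneg hpa _),
        ← Real.rpow_sum_of_nonneg (hW0 x) fun i _ => (hγ0 i).le, ← Real.rpow_mul (hW0 x),
        sum_sobPow hn hp hpn, mul_assoc, mul_one_div_cancel hn0.ne', mul_one]
    simp_rw [hL] at hg
    rw [lintegral_const_mul' _ _ ENNReal.ofReal_ne_top, ← hIdef, ← hIof] at hg
    have h0 : 0 ≤ (∏ i, (a i)⁻¹) ^ (1 / ((n : ℝ) - 1)) :=
      Real.rpow_nonneg (Finset.prod_nonneg fun i _ => (inv_pos.2 (ha0 i)).le) _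
    rw [← ENNReal.ofReal_mul h0] at hg
    have hnn : 0 ≤ (n : ℝ) / (n - 1) := by positivity
    have h1 := hg.trans (ENNReal.rpow_le_rpow hR hnn)
    rw [ENNReal.ofReal_rpow_of_nonneg hS.le hnn] at h1
    exact (ENNReal.ofReal_le_ofReal_iff (Real.rpow_nonneg hS.le _)).1 h1
  set X := ∑ i, ∫⁻ x, ENNReal.ofReal (D i x ^ p i) ∂μ with hX
  rcases eq_or_ne X ⊤ with hXt | hXt
  · rw [hXt, ENNReal.mul_top]
    · exact le_top
    · simpa using hSP
  have hXi : ∀ i, ∫⁻ x, ENNReal.ofReal (D i x ^ p i) ∂μ ≤ X := fun i =>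
    Finset.single_le_sum (f := fun i => ∫⁻ x, ENNReal.ofReal (D i x ^ p i) ∂μ)
      (fun _ _ => zero_le) (Finset.mem_univ i)
  -- `key` needs a positive H, whereas X may vanish, so a small positive amount is added and then
  -- removed.
  have hfinal : I.toReal ^ ((n - pbar p) / n) ≤ S ^ pbar p * X.toReal := by
    refine le_of_forall_pos_le_add fun ε hε => ?_
    have := key (X.toReal + ε / S ^ pbar p) (by positivity) fun i => by
      refine (hXi i).trans ?_
      rw [← ENNReal.ofReal_toReal hXt]
      exact ENNReal.ofReal_le_ofReal (by rw [ENNReal.ofReal_toReal hXt]; linarith [div_pos hε hSP])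
    rwa [mul_add, mul_div_cancel₀ _ hSP.ne'] at this
  rw [← hIof, ← ENNReal.ofReal_toReal hXt, ENNReal.ofReal_rpow_of_nonneg hIr.le he.le,
    ← ENNReal.ofReal_mul hSP.le]
  exact ENNReal.ofReal_le_ofReal hfinal

end Optimise

lemma aemeasurable_indicator_tsupport {Ω : Set (Fin n → ℝ)} {χ f : (Fin n → ℝ) → ℝ}
    (hχc : HasCompactSupport χ) (hχΩ : tsupport χ ⊆ Ω) {q : ℝ} (hf : MemLpLoc q f Ω) :
    AEMeasurable ((tsupport χ).indicator f) :=
  (aemeasurable_indicator_iff (isClosed_tsupport χ).measurableSet).2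
    (hf _ hχΩ hχc).1.aemeasurable

/-- Anisotropic Sobolev inequality for bounded smooth truncations. -/
lemma sobolev_of_bounded (hn : 2 ≤ n) {p : Fin n → ℝ} (hp : ∀ i, 1 < p i)
    (hpn : pbar p < n) {Ω : Set (Fin n → ℝ)} (hΩ : IsOpen Ω)
    {v : (Fin n → ℝ) → ℝ} {g : Fin n → (Fin n → ℝ) → ℝ} (h : ∀ i, HasWeakPartial Ω i v (g i))
    {χ : (Fin n → ℝ) → ℝ} (hχ : ContDiff ℝ 1 χ) (hχc : HasCompactSupport χ)
    (hχΩ : tsupport χ ⊆ Ω) (hχr : ∀ x, χ x ∈ Icc (0 : ℝ) 1)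
    {Θ Θ' : ℝ → ℝ} (hΘ : ∀ s, HasDerivAt Θ (Θ' s) s) (hΘ'c : Continuous Θ') {M : ℝ}
    (hΘ0 : ∀ s, 0 ≤ Θ s) (hΘM : ∀ s, Θ s ≤ M) (hΘ'1 : ∀ s, |Θ' s| ≤ 1) :
    (∫⁻ x, ENNReal.ofReal ((Θ (v x) * χ x) ^ sobExp p)) ^ ((n - pbar p) / n) ≤
      ENNReal.ofReal ((∑ i, sobPow p i) ^ pbar p) *
        ∑ i, ∫⁻ x, ENNReal.ofReal
          (|Θ' (v x) * g i x * χ x + Θ (v x) * partialX i χ x| ^ p i) := by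
  have hs := sobExp_pos hn hp hpn
  have hΘc : Continuous Θ := continuous_iff_continuousAt.2 fun s => (hΘ s).continuousAt
  have hM : 0 ≤ M := (hΘ0 0).trans (hΘM 0)
  have hχ0 : ∀ x, x ∉ tsupport χ → χ x = 0 := fun x hx => image_eq_zero_of_notMem_tsupport hx
  have hχd0 : ∀ i x, x ∉ tsupport χ → partialX i χ x = 0 := fun i x hx => by
    have : fderiv ℝ χ x = 0 := by
      by_contra hne
      exact hx (tsupport_fderiv_subset ℝ (subset_tsupport _ hne))
    rw [partialX_eq_fderiv (hχ.differentiable one_ne_zero x), this]; simp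
  set K := tsupport χ with hK
  have hvm : AEMeasurable (K.indicator v) :=
    aemeasurable_indicator_tsupport hχc hχΩ (h ⟨0, by omega⟩).1
  have hgm : ∀ i, AEMeasurable (K.indicator (g i)) := fun i =>
    aemeasurable_indicator_tsupport hχc hχΩ (h i).2.1
  have eW : (fun x => Θ (v x) * χ x) = fun x => Θ (K.indicator v x) * χ x := by
    funext x
    by_cases hx : x ∈ K
    · rw [indicator_of_mem hx]
    · rw [hχ0 x hx, mul_zero, mul_zero]
  have eD : ∀ i, (fun x => |Θ' (v x) * g i x * χ x + Θ (v x) * partialX i χ x|) = fun x =>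
      |Θ' (K.indicator v x) * K.indicator (g i) x * χ x +
        Θ (K.indicator v x) * partialX i χ x| := by
    intro i
    funext x
    by_cases hx : x ∈ K
    · rw [indicator_of_mem hx, indicator_of_mem hx]
    · rw [hχ0 x hx, hχd0 i x hx]; simp
  have hWm : AEMeasurable fun x => Θ (v x) * χ x := by
    rw [eW]
    exact (hΘc.measurable.comp_aemeasurable hvm).mul hχ.continuous.aemeasurable
  have hDm : ∀ i, AEMeasurable fun x => |Θ' (v x) * g i x * χ x + Θ (v x) * partialX i χ x| := by
    intro i
    rw [eD]
    exact measurable_norm.comp_aemeasurable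
      ((((hΘ'c.measurable.comp_aemeasurable hvm).mul (hgm i)).mul
      hχ.continuous.aemeasurable).add ((hΘc.measurable.comp_aemeasurable hvm).mul
        (continuous_partialX hχ i).aemeasurable))
  refine rpow_lintegral_le_of_grid hn hp hpn (W := fun x => Θ (v x) * χ x)
    (D := fun i x => |Θ' (v x) * g i x * χ x + Θ (v x) * partialX i χ x|)
    (fun x => mul_nonneg (hΘ0 _) (hχr x).1) (fun i x => abs_nonneg _) hWm hDm ?_ ?_
  -- The finiteness required for the absorption: the truncated function is bounded and compactly
  -- supported.
  · refine (lt_of_le_of_lt (b := ∫⁻ x, K.indicator (fun _ => ENNReal.ofReal (M ^ sobExp p)) x)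
      (lintegral_mono fun x => ?_) ?_).ne
    · by_cases hx : x ∈ K
      · rw [indicator_of_mem hx]
        refine ENNReal.ofReal_le_ofReal (Real.rpow_le_rpow (mul_nonneg (hΘ0 _) (hχr x).1) ?_ hs.le)
        exact (mul_le_mul (hΘM _) (hχr x).2 (hχr x).1 hM).trans_eq (mul_one M)
      · simp only [hχ0 x hx, mul_zero, Real.zero_rpow hs.ne', ENNReal.ofReal_zero]
        exact zero_le
    · rw [lintegral_indicator (isClosed_tsupport χ).measurableSet, setLIntegral_const]
      exact ENNReal.mul_lt_top ENNReal.ofReal_lt_top (IsCompact.measure_lt_top hχc)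
  · intro lam hlam
    exact lintegral_prod_rpow_le_of_hasWeakPartial hn hΩ h hχ hχc hχΩ hχr hΘ hΘ'c hΘ0 hΘM hΘ'1
      (one_lt_sobPow hn hp hpn) hlam

/-- Anisotropic Sobolev inequality for `(v - k)₊ χ`. -/
lemma sobolev_posPart (hn : 2 ≤ n) {p : Fin n → ℝ} (hp : ∀ i, 1 < p i)
    (hpn : pbar p < n) {Ω : Set (Fin n → ℝ)} (hΩ : IsOpen Ω)
    {v : (Fin n → ℝ) → ℝ} {g : Fin n → (Fin n → ℝ) → ℝ} (h : ∀ i, HasWeakPartial Ω i v (g i))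
    {χ : (Fin n → ℝ) → ℝ} (hχ : ContDiff ℝ 1 χ) (hχc : HasCompactSupport χ)
    (hχΩ : tsupport χ ⊆ Ω) (hχr : ∀ x, χ x ∈ Icc (0 : ℝ) 1) (k : ℝ) :
    (∫⁻ x, ENNReal.ofReal ((max (v x - k) 0 * χ x) ^ sobExp p)) ^ ((n - pbar p) / n) ≤
      ENNReal.ofReal ((∑ i, sobPow p i) ^ pbar p) *
        ∑ i, ∫⁻ x, ENNReal.ofReal
          (({y | k < v y}.indicator (fun y => |g i y|) x * χ x +
            max (v x - k) 0 * |partialX i χ x|) ^ p i) := by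
  have hs := sobExp_pos hn hp hpn
  have hn0 : (0 : ℝ) < n := by exact_mod_cast (by omega : 0 < n)
  have he : 0 < (n - pbar p) / n := div_pos (by linarith) hn0
  set B := ENNReal.ofReal ((∑ i, sobPow p i) ^ pbar p) *
        ∑ i, ∫⁻ x, ENNReal.ofReal
          (({y | k < v y}.indicator (fun y => |g i y|) x * χ x +
            max (v x - k) 0 * |partialX i χ x|) ^ p i) with hB
  have hχ0 : ∀ x, x ∉ tsupport χ → χ x = 0 := fun x hx => image_eq_zero_of_notMem_tsupport hx
  set a : ℕ → ℝ := fun m => 1 / ((m : ℝ) + 1) with ha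
  have ha0 : ∀ m, 0 < a m := fun m => by simp only [ha]; positivity
  have halim : Tendsto a atTop (𝓝 0) := tendsto_one_div_add_atTop_nhds_zero_nat
  -- The bound does not depend on m, because the truncations have slope in [0, 1] and slope 0 off {v
  -- > k}. Fatou's lemma then removes the truncation.
  have hm : ∀ m, ∫⁻ x, ENNReal.ofReal ((posTrunc (a m) (v x - k) * χ x) ^ sobExp p) ≤
      B ^ (((n - pbar p) / n)⁻¹) := by
    intro m
    rw [ENNReal.le_rpow_inv_iff he]
    refine (sobolev_of_bounded hn hp hpn hΩ h hχ hχc hχΩ hχr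
      (Θ := fun s => posTrunc (a m) (s - k)) (Θ' := fun s => posTruncDeriv (a m) (s - k))
      (M := (a m)⁻¹) (fun s => ?_) ?_ (fun s => posTrunc_nonneg (ha0 m) _)
      (fun s => posTrunc_le_inv (ha0 m) _) (fun s => ?_)).trans ?_
    · exact (hasDerivAt_posTrunc (ha0 m) (s - k)).comp_sub_const s k
    · exact (continuous_posTruncDeriv (ha0 m)).comp (continuous_id.sub continuous_const)
    · rw [abs_of_nonneg (posTruncDeriv_nonneg (ha0 m) _)]
      exact posTruncDeriv_le_one (ha0 m) _
    · rw [hB]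
      gcongr with i _ x
      · linarith [hp i]
      · refine (abs_add_le _ _).trans (add_le_add ?_ ?_)
        · rw [abs_mul, abs_mul, abs_of_nonneg (hχr x).1,
            abs_of_nonneg (posTruncDeriv_nonneg (ha0 m) _)]
          refine mul_le_mul_of_nonneg_right ?_ (hχr x).1
          by_cases hx : k < v x
          · rw [indicator_of_mem (by exact hx)]
            exact mul_le_of_le_one_left (abs_nonneg _) (posTruncDeriv_le_one (ha0 m) _)
          · rw [indicator_of_notMem (by exact hx), posTruncDeriv_of_nonpos (by linarith), zero_mul]
        · rw [abs_mul, abs_of_nonneg (posTrunc_nonneg (ha0 m) _)]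
          exact mul_le_mul_of_nonneg_right (posTrunc_le (ha0 m) _) (abs_nonneg _)
  rw [← ENNReal.le_rpow_inv_iff he]
  have hvm : AEMeasurable ((tsupport χ).indicator v) :=
    aemeasurable_indicator_tsupport hχc hχΩ (h ⟨0, by omega⟩).1
  have hWm : ∀ m, AEMeasurable fun x => posTrunc (a m) (v x - k) * χ x := by
    intro m
    have : (fun x => posTrunc (a m) (v x - k) * χ x) = fun x =>
        posTrunc (a m) ((tsupport χ).indicator v x - k) * χ x := by
      funext x
      by_cases hx : x ∈ tsupport χ
      · rw [indicator_of_mem hx]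
      · rw [hχ0 x hx, mul_zero, mul_zero]
    rw [this]
    exact ((contDiff_posTrunc (ha0 m)).continuous.measurable.comp_aemeasurable
      (hvm.sub_const k)).mul hχ.continuous.aemeasurable
  have hF := lintegral_liminf_le' (u := atTop) (μ := (volume : Measure (Fin n → ℝ)))
    (f := fun m x => ENNReal.ofReal ((posTrunc (a m) (v x - k) * χ x) ^ sobExp p))
    (fun m => ((hWm m).pow_const _).ennreal_ofReal)
  have hlim : ∀ x, liminf (fun m => ENNReal.ofReal ((posTrunc (a m) (v x - k) * χ x) ^ sobExp p))
      atTop = ENNReal.ofReal ((max (v x - k) 0 * χ x) ^ sobExp p) := fun x =>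
    (ENNReal.tendsto_ofReal (((tendsto_posTrunc halim (v x - k)).mul_const _).rpow_const
      (Or.inr hs.le))).liminf_eq
  simp_rw [hlim] at hF
  exact hF.trans (liminf_le_of_frequently_le' (Frequently.of_forall hm))

/-- The critical parabolic exponent `p̄ (n + 2) / n`. -/
noncomputable def parExp (p : Fin n → ℝ) : ℝ := pbar p * (n + 2) / n

/-- Interpolation between `L²` and the anisotropic Sobolev inequality. -/
lemma lintegral_parExp_le (hn : 2 ≤ n) {p : Fin n → ℝ} (hp : ∀ i, 1 < p i)
    (hpn : pbar p < n) {Ω : Set (Fin n → ℝ)} (hΩ : IsOpen Ω)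
    {v : (Fin n → ℝ) → ℝ} {g : Fin n → (Fin n → ℝ) → ℝ} (h : ∀ i, HasWeakPartial Ω i v (g i))
    {χ : (Fin n → ℝ) → ℝ} (hχ : ContDiff ℝ 1 χ) (hχc : HasCompactSupport χ)
    (hχΩ : tsupport χ ⊆ Ω) (hχr : ∀ x, χ x ∈ Icc (0 : ℝ) 1) (k : ℝ) :
    ∫⁻ x, ENNReal.ofReal ((max (v x - k) 0 * χ x) ^ parExp p) ≤
      (∫⁻ x, ENNReal.ofReal ((max (v x - k) 0 * χ x) ^ 2)) ^ (pbar p / n) *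
      (ENNReal.ofReal ((∑ i, sobPow p i) ^ pbar p) *
        ∑ i, ∫⁻ x, ENNReal.ofReal
          (({y | k < v y}.indicator (fun y => |g i y|) x * χ x +
            max (v x - k) 0 * |partialX i χ x|) ^ p i)) := by
  have hP := pbar_pos hp (by omega)
  have hs := sobExp_pos hn hp hpn
  have hn0 : (0 : ℝ) < n := by exact_mod_cast (by omega : 0 < n)
  have he : 0 < (n - pbar p) / n := div_pos (by linarith) hn0
  have he2 : 0 ≤ pbar p / n := by positivity
  have hχ0 : ∀ x, x ∉ tsupport χ → χ x = 0 := fun x hx => image_eq_zero_of_notMem_tsupport hx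
  have hvm : AEMeasurable ((tsupport χ).indicator v) :=
    aemeasurable_indicator_tsupport hχc hχΩ (h ⟨0, by omega⟩).1
  have hWm : AEMeasurable fun x => max (v x - k) 0 * χ x := by
    have : (fun x => max (v x - k) 0 * χ x) = fun x =>
        max ((tsupport χ).indicator v x - k) 0 * χ x := by
      funext x
      by_cases hx : x ∈ tsupport χ
      · rw [indicator_of_mem hx]
      · rw [hχ0 x hx, mul_zero, mul_zero]
    rw [this]
    exact ((hvm.sub_const k).max aemeasurable_const).mul hχ.continuous.aemeasurable
  -- The weights p̄/n and (n - p̄)/n give the exponent 2p̄/n + p̄ = p̄(n + 2)/n, and they leave the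
  -- Sobolev factor with exactly the power that `sobolev_posPart` bounds.
  have hH := ENNReal.lintegral_mul_norm_pow_le (μ := (volume : Measure (Fin n → ℝ)))
    (f := fun x => ENNReal.ofReal ((max (v x - k) 0 * χ x) ^ 2))
    (g := fun x => ENNReal.ofReal ((max (v x - k) 0 * χ x) ^ sobExp p))
    (hWm.pow_const _).ennreal_ofReal (hWm.pow_const _).ennreal_ofReal he2 he.le
    (by field_simp; ring)
  have e : ∀ x, ENNReal.ofReal ((max (v x - k) 0 * χ x) ^ 2) ^ (pbar p / n) *
      ENNReal.ofReal ((max (v x - k) 0 * χ x) ^ sobExp p) ^ ((n - pbar p) / n) =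
      ENNReal.ofReal ((max (v x - k) 0 * χ x) ^ parExp p) := by
    intro x
    have h0 : 0 ≤ max (v x - k) 0 * χ x := mul_nonneg (le_max_right _ _) (hχr x).1
    set y := max (v x - k) 0 * χ x
    rw [ENNReal.ofReal_rpow_of_nonneg (sq_nonneg y) he2,
      ENNReal.ofReal_rpow_of_nonneg (Real.rpow_nonneg h0 _) he.le, ← Real.rpow_natCast,
      ← Real.rpow_mul h0, ← Real.rpow_mul h0, ← ENNReal.ofReal_mul (Real.rpow_nonneg h0 _),
      ← Real.rpow_add_of_nonneg h0 (by positivity) (by positivity)]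
    congr 2
    have : (n : ℝ) - pbar p ≠ 0 := by linarith
    unfold sobExp parExp
    push_cast
    field_simp
    ring
  simp_rw [e] at hH
  exact hH.trans (mul_le_mul_right (sobolev_posPart hn hp hpn hΩ h hχ hχc hχΩ hχr k) _)

/-! ### From the energy inequality to a higher integrability estimate -/

lemma add_rpow_le_two_rpow {a b q : ℝ} (ha : 0 ≤ a) (hb : 0 ≤ b) (hq : 0 ≤ q) :
    (a + b) ^ q ≤ 2 ^ q * (a ^ q + b ^ q) := by
  have h1 : a + b ≤ 2 * max a b := by
    have := le_max_left a b; have := le_max_right a b; linarith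
  have h2 : (max a b) ^ q ≤ a ^ q + b ^ q := by
    rcases le_total a b with h | h
    · rw [max_eq_right h]; linarith [Real.rpow_nonneg ha q]
    · rw [max_eq_left h]; linarith [Real.rpow_nonneg hb q]
  calc (a + b) ^ q ≤ (2 * max a b) ^ q := Real.rpow_le_rpow (by positivity) h1 hq
    _ = 2 ^ q * (max a b) ^ q := Real.mul_rpow (by norm_num) (ha.trans (le_max_left _ _))
    _ ≤ _ := by gcongr

/-- Turns the gradient of (u - k)₊χ into energy quantities: a ≤ (a - δ)₊ + δ, while χ^q ≤ χ restores
the weight occurring in the energy inequality. The constants use 2^m to be the same in all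
directions. -/
lemma cutoff_gradient_rpow_le {a δ χ w b q m K : ℝ} (ha : 0 ≤ a) (hδ : 0 ≤ δ)
    (hχ : χ ∈ Icc (0 : ℝ) 1) (hw : 0 ≤ w) (hb : 0 ≤ b) (hq : 1 ≤ q) (hqm : q ≤ m)
    (hbK : b ^ q ≤ K) :
    (a * χ + w * b) ^ q ≤ 2 ^ m * 2 ^ m * (max (a - δ) 0 ^ q * χ) + 2 ^ m * 2 ^ m * δ ^ q +
      2 ^ m * K * w ^ q := by
  have hq0 : 0 ≤ q := by linarith
  have h2 : (2 : ℝ) ^ q ≤ 2 ^ m := Real.rpow_le_rpow_of_exponent_le (by norm_num) hqm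
  have h2m : (1 : ℝ) ≤ 2 ^ m := Real.one_le_rpow (by norm_num) (by linarith)
  have hd : 0 ≤ max (a - δ) 0 := le_max_right _ _
  have hδq : 0 ≤ δ ^ q := Real.rpow_nonneg hδ q
  have hdq : 0 ≤ max (a - δ) 0 ^ q := Real.rpow_nonneg hd q
  have h3 : a ^ q ≤ 2 ^ m * (max (a - δ) 0 ^ q + δ ^ q) := by
    calc a ^ q ≤ (max (a - δ) 0 + δ) ^ q := by
          refine Real.rpow_le_rpow ha ?_ hq0
          linarith [le_max_left (a - δ) 0]
      _ ≤ 2 ^ q * (max (a - δ) 0 ^ q + δ ^ q) := add_rpow_le_two_rpow hd hδ hq0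
      _ ≤ _ := by gcongr
  have h4 : χ ^ q ≤ χ := by
    rcases hχ.1.eq_or_lt with h | h
    · rw [← h, Real.zero_rpow (by linarith)]
    · calc χ ^ q ≤ χ ^ (1 : ℝ) := Real.rpow_le_rpow_of_exponent_ge h hχ.2 hq
        _ = χ := Real.rpow_one χ
  have h5 : a ^ q * χ ^ q ≤ 2 ^ m * (max (a - δ) 0 ^ q * χ + δ ^ q) := by
    calc a ^ q * χ ^ q ≤ 2 ^ m * (max (a - δ) 0 ^ q + δ ^ q) * χ :=
          mul_le_mul h3 h4 (Real.rpow_nonneg hχ.1 q) (by positivity)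
      _ = 2 ^ m * (max (a - δ) 0 ^ q * χ + δ ^ q * χ) := by ring
      _ ≤ _ := by
          gcongr
          exact mul_le_of_le_one_right hδq hχ.2
  have h6 : w ^ q * b ^ q ≤ K * w ^ q := by
    rw [mul_comm]; exact mul_le_mul_of_nonneg_right hbK (Real.rpow_nonneg hw q)
  calc (a * χ + w * b) ^ q ≤ 2 ^ q * ((a * χ) ^ q + (w * b) ^ q) :=
        add_rpow_le_two_rpow (mul_nonneg ha hχ.1) (mul_nonneg hw hb) hq0
    _ = 2 ^ q * (a ^ q * χ ^ q + w ^ q * b ^ q) := by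
        rw [Real.mul_rpow ha hχ.1, Real.mul_rpow hw hb]
    _ ≤ 2 ^ m * (a ^ q * χ ^ q + w ^ q * b ^ q) := by
        have := Real.rpow_nonneg ha q
        have := Real.rpow_nonneg hχ.1 q
        have := Real.rpow_nonneg hw q
        have := Real.rpow_nonneg hb q
        gcongr
    _ ≤ 2 ^ m * (2 ^ m * (max (a - δ) 0 ^ q * χ + δ ^ q) + K * w ^ q) := by gcongr
    _ = _ := by ring

/-! ### Boxes and cylinders -/

lemma box_mono (p : Fin n → ℝ) (hp : ∀ i, 0 < p i) (x₀ : Fin n → ℝ) {r R : ℝ} (hr : 0 ≤ r)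
    (hrR : r ≤ R) : box p x₀ r ⊆ box p x₀ R := by
  refine Set.pi_mono fun i _ => ?_
  have : r ^ (1 / p i) ≤ R ^ (1 / p i) :=
    Real.rpow_le_rpow hr hrR (by have := hp i; positivity)
  exact Ioo_subset_Ioo (by linarith) (by linarith)

lemma cyl_mono (p : Fin n → ℝ) (hp : ∀ i, 0 < p i) (x₀ : Fin n → ℝ) (t₀ : ℝ) {r R : ℝ}
    (hr : 0 ≤ r) (hrR : r ≤ R) : cyl p x₀ t₀ r ⊆ cyl p x₀ t₀ R :=
  Set.prod_mono (box_mono p hp x₀ hr hrR) (Ioo_subset_Ioo (by linarith) le_rfl)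

lemma isOpen_box (p x₀ : Fin n → ℝ) (r : ℝ) : IsOpen (box p x₀ r) :=
  isOpen_set_pi finite_univ fun _ _ => isOpen_Ioo

lemma isOpen_cyl (p x₀ : Fin n → ℝ) (t₀ r : ℝ) : IsOpen (cyl p x₀ t₀ r) :=
  (isOpen_box p x₀ r).prod isOpen_Ioo

lemma mem_box_self (p x₀ : Fin n → ℝ) {r : ℝ} (hr : 0 < r) : x₀ ∈ box p x₀ r := fun i _ => by
  have := Real.rpow_pos_of_pos hr (1 / p i)
  constructor <;> linarith

lemma isCompact_closure_cyl (p x₀ : Fin n → ℝ) (t₀ r : ℝ) :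
    IsCompact (closure (cyl p x₀ t₀ r)) := by
  have h : IsCompact ((Set.univ.pi fun i => Icc (x₀ i - r ^ (1 / p i)) (x₀ i + r ^ (1 / p i))) ×ˢ
      Icc (t₀ - r) t₀) := (isCompact_univ_pi fun i => isCompact_Icc).prod isCompact_Icc
  refine h.closure_of_subset ?_
  exact Set.prod_mono (Set.pi_mono fun i _ => Ioo_subset_Icc_self) Ioo_subset_Icc_self

lemma restrict_cyl_eq_prod (p x₀ : Fin n → ℝ) (t₀ r : ℝ) :
    (volume : Measure (SpaceTime n)).restrict (cyl p x₀ t₀ r) =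
      ((volume : Measure (Fin n → ℝ)).restrict (box p x₀ r)).prod
        ((volume : Measure ℝ).restrict (Ioo (t₀ - r) t₀)) := by
  rw [Measure.prod_restrict]; rfl

lemma aemeasurable_of_memLpLoc {p x₀ : Fin n → ℝ} {t₀ R q : ℝ} {f : SpaceTime n → ℝ}
    {S : Set (SpaceTime n)} (hf : MemLpLoc q f S) (hS : closure (cyl p x₀ t₀ R) ⊆ S) :
    AEMeasurable f (volume.restrict (cyl p x₀ t₀ R)) :=
  (hf _ hS (isCompact_closure_cyl p x₀ t₀ R)).1.aemeasurable.mono_measure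
    (Measure.restrict_mono subset_closure le_rfl)

lemma Ioo_subset_of_cyl_subset {p x₀ : Fin n → ℝ} {t₀ R T : ℝ} {Ω : Set (Fin n → ℝ)} (hR : 0 < R)
    (h : closure (cyl p x₀ t₀ R) ⊆ parDomain Ω T) : Ioo (t₀ - R) t₀ ⊆ Ioo 0 T := fun t ht =>
  (h (subset_closure (show (x₀, t) ∈ cyl p x₀ t₀ R from ⟨mem_box_self p x₀ hR, ht⟩))).2

lemma box_subset_of_cyl_subset {p x₀ : Fin n → ℝ} {t₀ R T : ℝ} {Ω : Set (Fin n → ℝ)} (hR : 0 < R)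
    (h : closure (cyl p x₀ t₀ R) ⊆ parDomain Ω T) : box p x₀ R ⊆ Ω := fun x hx =>
  (h (subset_closure (show (x, t₀ - R / 2) ∈ cyl p x₀ t₀ R from
    ⟨hx, by constructor <;> linarith⟩))).1

/-- The sum of the two lower order terms which control the energy on a cylinder. -/
noncomputable def lowerOrder (p x₀ : Fin n → ℝ) (t₀ R : ℝ) (w : SpaceTime n → ℝ) : ℝ≥0∞ :=
  (∫⁻ z in cyl p x₀ t₀ R, ENNReal.ofReal (w z ^ 2)) +
    ∑ i, ∫⁻ z in cyl p x₀ t₀ R, ENNReal.ofReal (w z ^ p i)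

/-- The truncated gradient part of the energy. -/
noncomputable def gradEnergy (p δ x₀ : Fin n → ℝ) (t₀ R : ℝ) (ζ : SpaceTime n → ℝ)
    (A : Set (SpaceTime n)) (g : Fin n → SpaceTime n → ℝ) (i : Fin n) : ℝ≥0∞ :=
  ∫⁻ z in cyl p x₀ t₀ R,
    A.indicator (fun z => ENNReal.ofReal ((max (|g i z| - δ i) 0) ^ (p i) * ζ z)) z

lemma energyIneq_le {p δ x₀ : Fin n → ℝ} {c t₀ R K : ℝ} {ζ w : SpaceTime n → ℝ}
    {A : Set (SpaceTime n)} {g : Fin n → SpaceTime n → ℝ}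
    (h : EnergyIneq p δ c x₀ t₀ R ζ w A g) (hw : ∀ z, 0 ≤ w z)
    (h1 : ∀ z : SpaceTime n, deriv (fun s => ζ (z.1, s)) z.2 ≤ K)
    (h2 : ∀ i (z : SpaceTime n),
      |partialX i (fun x => ζ (x, z.2) ^ (1 / p i)) z.1| ^ p i ≤ K) :
    essSup (fun τ => ∫⁻ x in box p x₀ R, ENNReal.ofReal (w (x, τ) ^ 2 * ζ (x, τ)))
      (volume.restrict (Ioo (t₀ - R) t₀)) + ∑ i, gradEnergy p δ x₀ t₀ R ζ A g i ≤
      ENNReal.ofReal c * ENNReal.ofReal K * lowerOrder p x₀ t₀ R w := by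
  refine h.trans ?_
  rw [lowerOrder, mul_add, mul_assoc, mul_assoc]
  refine add_le_add (mul_le_mul_right ?_ _) (mul_le_mul_right ?_ _)
  · rw [← lintegral_const_mul' _ _ ENNReal.ofReal_ne_top]
    refine lintegral_mono fun z => ?_
    rw [ENNReal.ofReal_mul (sq_nonneg _), mul_comm (ENNReal.ofReal K)]
    exact mul_le_mul_right (ENNReal.ofReal_le_ofReal (h1 z)) _
  · rw [Finset.mul_sum]
    refine Finset.sum_le_sum fun i _ => ?_
    rw [← lintegral_const_mul' _ _ ENNReal.ofReal_ne_top]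
    refine lintegral_mono fun z => ?_
    rw [ENNReal.ofReal_mul (Real.rpow_nonneg (hw z) _), mul_comm (ENNReal.ofReal K)]
    exact mul_le_mul_right (ENNReal.ofReal_le_ofReal (h2 i z)) _

/-- The spatial integrals over time slices are controlled, for almost every time, by the energy. -/
lemma slice_estimate (hn : 2 ≤ n) {p : Fin n → ℝ} (hp : ∀ i, 1 < p i) (hpn : pbar p < n)
    {δ x₀ : Fin n → ℝ} (hδ : ∀ i, 0 ≤ δ i) {t₀ r R T K : ℝ} {Ω : Set (Fin n → ℝ)}
    (hΩ : IsOpen Ω) {u : SpaceTime n → ℝ} {g : Fin n → SpaceTime n → ℝ}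
    (hug : MemParabolicSobolev p Ω T u g) (hr : 0 < r) (hrR : r < R)
    (hcyl : closure (cyl p x₀ t₀ R) ⊆ parDomain Ω T) (k : ℝ)
    {χ : (Fin n → ℝ) → ℝ} {ψ : ℝ → ℝ} (hχ : ContDiff ℝ ∞ χ) (hχc : HasCompactSupport χ)
    (hχb : tsupport χ ⊆ box p x₀ R) (hχr : ∀ x, χ x ∈ Icc (0 : ℝ) 1)
    (hψ : ∀ t, t₀ - r ≤ t → ψ t = 1) (hχK : ∀ i x, |partialX i χ x| ^ p i ≤ K) {X : ℝ≥0∞}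
    (hX : essSup (fun τ => ∫⁻ x in box p x₀ R,
      ENNReal.ofReal (max (u (x, τ) - k) 0 ^ 2 * (ψ τ * χ x)))
      (volume.restrict (Ioo (t₀ - R) t₀)) ≤ X) :
    ∀ᵐ t ∂(volume.restrict (Ioo (t₀ - r) t₀)),
      ∫⁻ x, ENNReal.ofReal ((max (u (x, t) - k) 0 * χ x) ^ parExp p) ≤
        X ^ (pbar p / n) * ENNReal.ofReal ((∑ i, sobPow p i) ^ pbar p) *
          ∑ i, ∫⁻ x in box p x₀ R,
            (ENNReal.ofReal (2 ^ pmax p * 2 ^ pmax p) * {z | k < u z}.indicator (fun z =>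
              ENNReal.ofReal ((max (|g i z| - δ i) 0) ^ (p i) * (ψ z.2 * χ z.1))) (x, t) +
            ENNReal.ofReal (2 ^ pmax p * 2 ^ pmax p * δ i ^ p i) *
              {z | k < u z}.indicator 1 (x, t) +
            ENNReal.ofReal (2 ^ pmax p * K) * ENNReal.ofReal (max (u (x, t) - k) 0 ^ p i)) := by
  have hR : 0 < R := hr.trans hrR
  have hIoo : Ioo (t₀ - r) t₀ ⊆ Ioo (t₀ - R) t₀ := Ioo_subset_Ioo (by linarith) le_rfl
  have hP := pbar_pos hp (by omega)
  have hwg : ∀ᵐ t ∂(volume.restrict (Ioo (t₀ - r) t₀)),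
      ∀ i, HasWeakPartial Ω i (fun x => u (x, t)) (fun x => g i (x, t)) :=
    ae_restrict_of_ae_restrict_of_subset (hIoo.trans (Ioo_subset_of_cyl_subset hR hcyl)) hug.weakGrad
  have hsup : ∀ᵐ t ∂(volume.restrict (Ioo (t₀ - r) t₀)), ∫⁻ x in box p x₀ R,
      ENNReal.ofReal (max (u (x, t) - k) 0 ^ 2 * (ψ t * χ x)) ≤ X := by
    refine ae_restrict_of_ae_restrict_of_subset hIoo ?_
    filter_upwards [ENNReal.ae_le_essSup (μ := volume.restrict (Ioo (t₀ - R) t₀))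
      fun τ => ∫⁻ x in box p x₀ R, ENNReal.ofReal (max (u (x, τ) - k) 0 ^ 2 * (ψ τ * χ x))]
      with t ht
    exact ht.trans hX
  have hχ1 : ContDiff ℝ 1 χ := hχ.of_le (by exact_mod_cast le_top)
  have hχ0 : ∀ x, x ∉ box p x₀ R → χ x = 0 := fun x hx =>
    image_eq_zero_of_notMem_tsupport fun h => hx (hχb h)
  have hχd0 : ∀ i x, x ∉ box p x₀ R → partialX i χ x = 0 := fun i x hx => by
    have : fderiv ℝ χ x = 0 := by
      by_contra hne
      exact hx (hχb (tsupport_fderiv_subset ℝ (subset_tsupport _ hne)))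
    rw [partialX_eq_fderiv (hχ1.differentiable one_ne_zero x), this]; simp
  have hbm : MeasurableSet (box p x₀ R) := (isOpen_box p x₀ R).measurableSet
  filter_upwards [hwg, hsup, ae_restrict_mem measurableSet_Ioo] with t hwt hst htm
  have hψt : ψ t = 1 := hψ t htm.1.le
  have hmain := lintegral_parExp_le hn hp hpn hΩ hwt hχ1 hχc
    (hχb.trans (box_subset_of_cyl_subset hR hcyl)) hχr k
  refine hmain.trans ?_
  rw [mul_assoc]
  refine mul_le_mul' (ENNReal.rpow_le_rpow ?_ (by positivity)) (mul_le_mul_right ?_ _)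
  -- For these times ψ = 1, and χ² ≤ χ, so the slice is controlled by the essential supremum in the
  -- energy.
  · refine le_trans ?_ hst
    rw [← lintegral_indicator hbm]
    refine lintegral_mono fun x => ?_
    by_cases hx : x ∈ box p x₀ R
    · rw [indicator_of_mem hx, hψt, one_mul, mul_pow]
      refine ENNReal.ofReal_le_ofReal (mul_le_mul_of_nonneg_left ?_ (sq_nonneg _))
      nlinarith [(hχr x).1, (hχr x).2]
    · rw [indicator_of_notMem hx, hχ0 x hx]; simp
  · refine Finset.sum_le_sum fun i _ => ?_
    rw [← lintegral_indicator hbm]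
    refine lintegral_mono fun x => ?_
    have hpi : 0 < p i := by linarith [hp i]
    by_cases hx : x ∈ box p x₀ R
    · rw [indicator_of_mem hx]
      -- Off the superlevel set the left side vanishes, which is why the δ term carries the
      -- indicator and will produce only the measure of {u > k}.
      by_cases hk : k < u (x, t)
      · have m1 : x ∈ {y | k < u (y, t)} := hk
        have m2 : (x, t) ∈ {z | k < u z} := hk
        rw [indicator_of_mem m1, indicator_of_mem m2, indicator_of_mem m2, hψt, one_mul,
          Pi.one_apply, mul_one]
        have h2m : (0 : ℝ) ≤ 2 ^ pmax p := by positivity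
        have hK0 : 0 ≤ K := (Real.rpow_nonneg (abs_nonneg _) _).trans (hχK i x)
        have hd : 0 ≤ max (|g i (x, t)| - δ i) 0 ^ p i * χ x :=
          mul_nonneg (Real.rpow_nonneg (le_max_right _ _) _) (hχr x).1
        have hw : 0 ≤ max (u (x, t) - k) 0 ^ p i := Real.rpow_nonneg (le_max_right _ _) _
        have hdd := Real.rpow_nonneg (hδ i) (p i)
        rw [← ENNReal.ofReal_mul (by positivity), ← ENNReal.ofReal_mul (by positivity),
          ← ENNReal.ofReal_add (by positivity) (by positivity),
          ← ENNReal.ofReal_add (by positivity) (by positivity)]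
        exact ENNReal.ofReal_le_ofReal (cutoff_gradient_rpow_le (abs_nonneg _) (hδ i) (hχr x)
          (le_max_right _ _) (abs_nonneg _) (hp i).le (le_pmax p i) (hχK i x))
      · have m1 : x ∉ {y | k < u (y, t)} := hk
        rw [indicator_of_notMem m1, max_eq_right (by linarith), zero_mul, zero_mul, zero_add,
          Real.zero_rpow hpi.ne', ENNReal.ofReal_zero]
        exact zero_le
    · rw [indicator_of_notMem hx, hχ0 x hx, hχd0 i x hx, mul_zero, abs_zero, mul_zero, zero_add,
        Real.zero_rpow hpi.ne', ENNReal.ofReal_zero]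

/-- Reverse Hölder type estimate: integrability of order `p̄ (n + 2) / n` of a truncation. -/
lemma exists_higher_integrability (hn : 2 ≤ n) {p : Fin n → ℝ} (hp : ∀ i, 1 < p i)
    (hpn : pbar p < n) {c : ℝ} (hc : 0 < c) (δmax : ℝ) :
    ∃ C : ℝ, 0 < C ∧ ∀ (δ : Fin n → ℝ), (∀ i, 0 ≤ δ i) → (∀ i, δ i ≤ δmax) →
      ∀ (Ω : Set (Fin n → ℝ)), IsOpen Ω → ∀ (T : ℝ) (u : SpaceTime n → ℝ)
        (g : Fin n → SpaceTime n → ℝ), AEMeasurable u (volume.restrict (parDomain Ω T)) →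
        MemParabolicSobolev p Ω T u g →
      ∀ (x₀ : Fin n → ℝ) (t₀ r R : ℝ), 0 < r → r < R →
        closure (cyl p x₀ t₀ R) ⊆ parDomain Ω T → ∀ k : ℝ,
        (∀ ζ, IsCutoff p x₀ t₀ R ζ →
          EnergyIneq p δ c x₀ t₀ R ζ (fun z => max (u z - k) 0) {z | k < u z} g) →
        ∫⁻ z in cyl p x₀ t₀ r, ENNReal.ofReal (max (u z - k) 0 ^ parExp p) ≤
          (ENNReal.ofReal C * (ENNReal.ofReal (((R - r) / R) ^ (-pmax p) / R) *
            lowerOrder p x₀ t₀ R (fun z => max (u z - k) 0) +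
              volume.restrict (cyl p x₀ t₀ R) {z | k < u z})) ^ (1 + pbar p / n) := by
  have hP := pbar_pos hp (by omega)
  have hn0 : (0 : ℝ) < n := by exact_mod_cast (by omega : 0 < n)
  have hp0 : ∀ i, 0 < p i := fun i => by linarith [hp i]
  obtain ⟨L, hL, hcut⟩ := exists_cutoff p hp (by omega)
  have hθ : 0 ≤ pbar p / n := by positivity
  set CS : ℝ := (∑ i, sobPow p i) ^ pbar p with hCS
  have hCS0 : 0 ≤ CS := Real.rpow_nonneg (Finset.sum_nonneg fun i _ => by
    linarith [one_lt_sobPow hn hp hpn i]) _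
  set A : ℝ := 2 ^ pmax p * 2 ^ pmax p with hA
  have hA0 : 0 < A := by positivity
  set Dm : ℝ := ∑ i, |δmax| ^ p i with hDm
  have hDm0 : 0 ≤ Dm := Finset.sum_nonneg fun i _ => by positivity
  set E : ℝ := A * (c * L) + A * Dm + 2 ^ pmax p * L with hE
  have hE0 : 0 < E := by positivity
  -- The estimate has the form (cL·Z)^(p̄/n) · (CS·E·Z). A constant dominating both factors merges
  -- them into one power 1 + p̄/n.
  refine ⟨c * L + CS * E, by positivity, ?_⟩
  intro δ hδ hδm Ω hΩ T u g hu hug x₀ t₀ r R hr hrR hcyl k hen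
  have hR : 0 < R := hr.trans hrR
  obtain ⟨χ, ψ, hζ, hχ, hχc, hχb, hχr, hχ1, hψ, hd1, hd2, hd3⟩ := hcut x₀ t₀ r R hr hrR
  set κ : ℝ := ((R - r) / R) ^ (-pmax p) / R with hκ
  have hκ0 : 0 ≤ κ := by
    have : 0 ≤ (R - r) / R := div_nonneg (by linarith) hR.le
    positivity
  set w : SpaceTime n → ℝ := fun z => max (u z - k) 0 with hw
  set S : Set (SpaceTime n) := {z | k < u z} with hS
  set N := lowerOrder p x₀ t₀ R w with hN
  set V := volume.restrict (cyl p x₀ t₀ R) S with hV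
  set ζ : SpaceTime n → ℝ := fun z => ψ z.2 * χ z.1 with hζdef
  have hE1 := energyIneq_le (hen ζ hζ) (fun z => le_max_right _ _) (K := L * κ)
    (fun z => hd1 z.1 z.2) (fun i z => hd2 i z.1 z.2)
  set X : ℝ≥0∞ := ENNReal.ofReal c * ENNReal.ofReal (L * κ) * N with hX
  have hess : essSup (fun τ => ∫⁻ x in box p x₀ R, ENNReal.ofReal
      (max (u (x, τ) - k) 0 ^ 2 * (ψ τ * χ x))) (volume.restrict (Ioo (t₀ - R) t₀)) ≤ X :=
    le_self_add.trans hE1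
  have hgrad : ∑ i, gradEnergy p δ x₀ t₀ R ζ S g i ≤ X := le_add_self.trans hE1
  have hslice := slice_estimate hn hp hpn hδ hΩ hug hr hrR hcyl k hχ hχc hχb hχr hψ hd3 hess
  -- measurability
  have hcylsub : cyl p x₀ t₀ R ⊆ parDomain Ω T := subset_closure.trans hcyl
  have hum : AEMeasurable u (volume.restrict (cyl p x₀ t₀ R)) := hu.mono_set hcylsub
  have hgm : ∀ i, AEMeasurable (g i) (volume.restrict (cyl p x₀ t₀ R)) := fun i =>
    aemeasurable_of_memLpLoc (hug.grad_locInt i) hcyl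
  have hwm : AEMeasurable w (volume.restrict (cyl p x₀ t₀ R)) :=
    (hum.sub_const k).max aemeasurable_const
  have hSm : NullMeasurableSet S (volume.restrict (cyl p x₀ t₀ R)) :=
    nullMeasurableSet_lt aemeasurable_const hum
  have hζm : AEMeasurable ζ (volume.restrict (cyl p x₀ t₀ R)) :=
    hζ.1.continuous.measurable.aemeasurable
  set F1 : Fin n → SpaceTime n → ℝ≥0∞ := fun i => S.indicator fun z =>
    ENNReal.ofReal ((max (|g i z| - δ i) 0) ^ (p i) * ζ z) with hF1
  have hF1m : ∀ i, AEMeasurable (F1 i) (volume.restrict (cyl p x₀ t₀ R)) := fun i =>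
    AEMeasurable.indicator₀ ((((((measurable_norm.comp_aemeasurable (hgm i)).sub_const _).max
      aemeasurable_const).pow_const _).mul hζm).ennreal_ofReal) hSm
  have hF2m : AEMeasurable (S.indicator (1 : SpaceTime n → ℝ≥0∞))
      (volume.restrict (cyl p x₀ t₀ R)) := aemeasurable_one.indicator₀ hSm
  set F : Fin n → SpaceTime n → ℝ≥0∞ := fun i z =>
    ENNReal.ofReal A * F1 i z + ENNReal.ofReal (A * δ i ^ p i) * S.indicator 1 z +
      ENNReal.ofReal (2 ^ pmax p * (L * κ)) * ENNReal.ofReal (w z ^ p i) with hF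
  have hFm : ∀ i, AEMeasurable (F i) (volume.restrict (cyl p x₀ t₀ R)) := fun i =>
    (((hF1m i).const_mul _).add (hF2m.const_mul _)).add
      ((hwm.pow_const _).ennreal_ofReal.const_mul _)
  have hprodR := restrict_cyl_eq_prod p x₀ t₀ R
  have hprodr := restrict_cyl_eq_prod p x₀ t₀ r
  -- integration in time
  have hIoo : Ioo (t₀ - r) t₀ ⊆ Ioo (t₀ - R) t₀ := Ioo_subset_Ioo (by linarith) le_rfl
  -- Since χ = 1 on the inner box, it can be inserted and the spatial integral extended to the whole
  -- space, as the slice estimate requires.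
  have hstep1 : ∫⁻ z in cyl p x₀ t₀ r, ENNReal.ofReal (w z ^ parExp p) ≤
      ∫⁻ t in Ioo (t₀ - r) t₀, ∫⁻ x, ENNReal.ofReal ((w (x, t) * χ x) ^ parExp p) := by
    have hm : AEMeasurable (fun z => ENNReal.ofReal (w z ^ parExp p))
        (volume.restrict (cyl p x₀ t₀ r)) :=
      ((hwm.mono_set (cyl_mono p hp0 x₀ t₀ hr.le hrR.le)).pow_const _).ennreal_ofReal
    rw [hprodr] at hm ⊢
    rw [lintegral_prod_symm _ hm]
    refine lintegral_mono fun t => ?_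
    refine le_trans ?_ (setLIntegral_le_lintegral (box p x₀ r) _)
    refine setLIntegral_mono' (isOpen_box p x₀ r).measurableSet fun x hx => ?_
    rw [hχ1 x hx, mul_one]
  have hstep2 : ∫⁻ t in Ioo (t₀ - r) t₀, ∫⁻ x, ENNReal.ofReal ((w (x, t) * χ x) ^ parExp p) ≤
      X ^ (pbar p / n) * ENNReal.ofReal CS * ∑ i, ∫⁻ z in cyl p x₀ t₀ R, F i z := by
    have hm : ∀ i, AEMeasurable (fun t => ∫⁻ x in box p x₀ R, F i (x, t))
        (volume.restrict (Ioo (t₀ - R) t₀)) := fun i => by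
      have := hFm i
      rw [hprodR] at this
      exact this.lintegral_prod_left'
    calc _ ≤ ∫⁻ t in Ioo (t₀ - r) t₀, X ^ (pbar p / n) * ENNReal.ofReal CS *
          ∑ i, ∫⁻ x in box p x₀ R, F i (x, t) := lintegral_mono_ae hslice
      _ ≤ ∫⁻ t in Ioo (t₀ - R) t₀, X ^ (pbar p / n) * ENNReal.ofReal CS *
          ∑ i, ∫⁻ x in box p x₀ R, F i (x, t) := lintegral_mono_set hIoo
      _ = X ^ (pbar p / n) * ENNReal.ofReal CS *
          ∑ i, ∫⁻ t in Ioo (t₀ - R) t₀, ∫⁻ x in box p x₀ R, F i (x, t) := by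
        rw [lintegral_const_mul'' _ (Finset.aemeasurable_fun_sum _ fun i _ => hm i),
          lintegral_finsetSum' _ fun i _ => hm i]
      _ = _ := by
        congr 1
        refine Finset.sum_congr rfl fun i _ => ?_
        have := hFm i
        rw [hprodR] at this ⊢
        rw [lintegral_prod_symm _ this]
  set Z : ℝ≥0∞ := ENNReal.ofReal κ * N + V with hZ
  have hXZ : X ≤ ENNReal.ofReal (c * L) * Z := by
    rw [hX, ENNReal.ofReal_mul hL.le, ENNReal.ofReal_mul hc.le, hZ]
    calc _ = ENNReal.ofReal c * ENNReal.ofReal L * (ENNReal.ofReal κ * N) := by ring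
      _ ≤ _ := mul_le_mul_right le_self_add _
  have hFi : ∀ i, ∫⁻ z in cyl p x₀ t₀ R, F i z =
      ENNReal.ofReal A * gradEnergy p δ x₀ t₀ R ζ S g i + ENNReal.ofReal (A * δ i ^ p i) * V +
        ENNReal.ofReal (2 ^ pmax p * (L * κ)) *
          ∫⁻ z in cyl p x₀ t₀ R, ENNReal.ofReal (w z ^ p i) := by
    intro i
    rw [hF]
    simp only
    rw [lintegral_add_right' _ ((hwm.pow_const _).ennreal_ofReal.const_mul _),
      lintegral_add_right' _ (hF2m.const_mul _), lintegral_const_mul' _ _ ENNReal.ofReal_ne_top,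
      lintegral_const_mul' _ _ ENNReal.ofReal_ne_top,
      lintegral_const_mul' _ _ ENNReal.ofReal_ne_top, lintegral_indicator_one₀ hSm]
    rfl
  have hsumF : ∑ i, ∫⁻ z in cyl p x₀ t₀ R, F i z ≤ ENNReal.ofReal E * Z := by
    simp_rw [hFi]
    rw [Finset.sum_add_distrib, Finset.sum_add_distrib, ← Finset.mul_sum, ← Finset.mul_sum,
      ← Finset.sum_mul]
    have t1 : ENNReal.ofReal A * ∑ i, gradEnergy p δ x₀ t₀ R ζ S g i ≤
        ENNReal.ofReal (A * (c * L)) * Z := by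
      rw [ENNReal.ofReal_mul hA0.le, mul_assoc]
      exact mul_le_mul_right (hgrad.trans hXZ) _
    have t2 : (∑ i, ENNReal.ofReal (A * δ i ^ p i)) * V ≤ ENNReal.ofReal (A * Dm) * Z := by
      refine mul_le_mul' ?_ le_add_self
      rw [← ENNReal.ofReal_sum_of_nonneg fun i _ =>
        mul_nonneg hA0.le (Real.rpow_nonneg (hδ i) _), hDm, Finset.mul_sum]
      refine ENNReal.ofReal_le_ofReal (Finset.sum_le_sum fun i _ => ?_)
      exact mul_le_mul_of_nonneg_left (Real.rpow_le_rpow (hδ i)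
        ((hδm i).trans (le_abs_self _)) (hp0 i).le) hA0.le
    have t3 : ENNReal.ofReal (2 ^ pmax p * (L * κ)) *
        ∑ i, ∫⁻ z in cyl p x₀ t₀ R, ENNReal.ofReal (w z ^ p i) ≤
        ENNReal.ofReal (2 ^ pmax p * L) * Z := by
      rw [← mul_assoc, ENNReal.ofReal_mul (by positivity : 0 ≤ 2 ^ pmax p * L), mul_assoc]
      refine mul_le_mul_right ?_ _
      exact (mul_le_mul_right (le_add_self : _ ≤ N) _).trans le_self_add
    have h2L : 0 ≤ 2 ^ pmax p * L := by positivity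
    have hAcL : 0 ≤ A * (c * L) := by positivity
    have hADm : 0 ≤ A * Dm := by positivity
    rw [hE, ENNReal.ofReal_add (by positivity) h2L, ENNReal.ofReal_add hAcL hADm, add_mul, add_mul]
    exact add_le_add (add_le_add t1 t2) t3
  calc _ ≤ X ^ (pbar p / n) * ENNReal.ofReal CS * ∑ i, ∫⁻ z in cyl p x₀ t₀ R, F i z :=
        hstep1.trans hstep2
    _ ≤ (ENNReal.ofReal (c * L) * Z) ^ (pbar p / n) * ENNReal.ofReal CS *
        (ENNReal.ofReal E * Z) := by gcongr
    _ = (ENNReal.ofReal (c * L) * Z) ^ (pbar p / n) * (ENNReal.ofReal (CS * E) * Z) := by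
        rw [ENNReal.ofReal_mul hCS0]; ring
    _ ≤ (ENNReal.ofReal (c * L + CS * E) * Z) ^ (pbar p / n) *
        (ENNReal.ofReal (c * L + CS * E) * Z) ^ (1 : ℝ) := by
        rw [ENNReal.rpow_one]
        have : 0 ≤ c * L := by positivity
        have : 0 ≤ CS * E := by positivity
        gcongr <;> linarith
    _ = _ := by
        rw [← ENNReal.rpow_add_of_nonneg _ _ hθ zero_le_one, add_comm (pbar p / n) 1]

/-! ### The iteration -/

lemma two_le_bigP (p : Fin n → ℝ) : 2 ≤ bigP p := le_max_left _ _

lemma le_bigP (p : Fin n → ℝ) (i : Fin n) : p i ≤ bigP p := (le_pmax p i).trans (le_max_right _ _)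

/-- The lower bound on p̄ is 2 < q and the upper bound on the exponents is pᵢ < q, with q = `parExp
p`. The strict gap leaves a positive power of the measure in Hölder's inequality. -/
lemma bigP_lt_parExp (hn : 0 < n) {p : Fin n → ℝ} (hp : ∀ i, p i < pbar p * (1 + 2 / (n : ℝ)))
    (hsuper : 2 * (n : ℝ) / ((n : ℝ) + 2) < pbar p) : bigP p < parExp p := by
  have hn0 : (0 : ℝ) < n := by exact_mod_cast hn
  have : Nonempty (Fin n) := ⟨⟨0, hn⟩⟩
  have e : parExp p = pbar p * (1 + 2 / (n : ℝ)) := by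
    unfold parExp; field_simp
  refine max_lt ?_ ?_
  · rw [parExp, lt_div_iff₀ hn0]
    rwa [div_lt_iff₀ (by linarith)] at hsuper
  · obtain ⟨i, hi⟩ := exists_eq_ciSup_of_finite (f := p)
    rw [e, pmax, ← hi]
    exact hp i

/-- The integral of `(u - k)₊^P` over a cylinder. -/
noncomputable def levelEnergy (p x₀ : Fin n → ℝ) (t₀ : ℝ) (u : SpaceTime n → ℝ) (R k : ℝ) : ℝ≥0∞ :=
  ∫⁻ z in cyl p x₀ t₀ R, ENNReal.ofReal (max (u z - k) 0 ^ bigP p)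

/-- Above the higher level Δ(s - k₁) ≥ 1, so its exponent may be raised from q to P. This brings the
exponents 2 and pᵢ to the single exponent P. -/
lemma posPart_rpow_le {s k₁ k₂ q P Δ : ℝ} (hk : k₁ < k₂) (hq : 0 < q) (hqP : q ≤ P)
    (hΔ : 1 ≤ Δ) (hd : (k₂ - k₁)⁻¹ ≤ Δ) :
    max (s - k₂) 0 ^ q ≤ Δ ^ P * max (s - k₁) 0 ^ P := by
  rcases le_or_gt s k₂ with hs | hs
  · rw [max_eq_right (by linarith), Real.zero_rpow hq.ne']
    have : 0 ≤ max (s - k₁) 0 := le_max_right _ _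
    positivity
  · rw [max_eq_left (by linarith), max_eq_left (by linarith)]
    have hd0 : 0 < k₂ - k₁ := by linarith
    have h1 : 1 ≤ Δ * (s - k₁) := by
      have : 1 ≤ Δ * (k₂ - k₁) := by
        rw [inv_eq_one_div, div_le_iff₀ hd0] at hd; exact hd
      nlinarith
    calc (s - k₂) ^ q ≤ (Δ * (s - k₁)) ^ q :=
          Real.rpow_le_rpow (by linarith) (by nlinarith) hq.le
      _ ≤ (Δ * (s - k₁)) ^ P := Real.rpow_le_rpow_of_exponent_le h1 hqP
      _ = _ := Real.mul_rpow (by linarith) (by linarith)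

lemma lowerOrder_le_levelEnergy {p : Fin n → ℝ} (hp : ∀ i, 1 < p i) {x₀ : Fin n → ℝ} {t₀ R : ℝ}
    {u : SpaceTime n → ℝ} {k₁ k₂ Δ : ℝ} (hk : k₁ < k₂) (hΔ : 1 ≤ Δ) (hd : (k₂ - k₁)⁻¹ ≤ Δ) :
    lowerOrder p x₀ t₀ R (fun z => max (u z - k₂) 0) ≤
      ENNReal.ofReal ((n + 1) * Δ ^ bigP p) * levelEnergy p x₀ t₀ u R k₁ := by
  have hΔP : 0 ≤ Δ ^ bigP p := by positivity
  have h : ∀ q : ℝ, 0 < q → q ≤ bigP p →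
      ∫⁻ z in cyl p x₀ t₀ R, ENNReal.ofReal (max (u z - k₂) 0 ^ q) ≤
        ENNReal.ofReal (Δ ^ bigP p) * levelEnergy p x₀ t₀ u R k₁ := by
    intro q hq hqP
    rw [levelEnergy, ← lintegral_const_mul' _ _ ENNReal.ofReal_ne_top]
    refine lintegral_mono fun z => ?_
    rw [← ENNReal.ofReal_mul hΔP]
    exact ENNReal.ofReal_le_ofReal (posPart_rpow_le hk hq hqP hΔ hd)
  have h2 := h 2 two_pos (two_le_bigP p)
  simp_rw [Real.rpow_two] at h2
  have h3 := Finset.sum_le_sum fun i (_ : i ∈ Finset.univ) =>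
    h (p i) (by linarith [hp i]) (le_bigP p i)
  rw [Finset.sum_const, Finset.card_univ, Fintype.card_fin, nsmul_eq_mul] at h3
  refine (add_le_add h2 h3).trans_eq ?_
  rw [ENNReal.ofReal_mul (by positivity), ENNReal.ofReal_add (by positivity) zero_le_one,
    ENNReal.ofReal_natCast, ENNReal.ofReal_one]
  ring

/-- Chebyshev's inequality. It is the source of the negative power of k in the iteration. -/
lemma measure_superlevel_le {p x₀ : Fin n → ℝ} {t₀ R : ℝ} {u : SpaceTime n → ℝ}
    (hu : AEMeasurable u (volume.restrict (cyl p x₀ t₀ R))) {k₁ k₂ : ℝ} (hk : k₁ < k₂) :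
    volume.restrict (cyl p x₀ t₀ R) {z | k₂ < u z} ≤
      ENNReal.ofReal ((k₂ - k₁) ^ (-bigP p)) * levelEnergy p x₀ t₀ u R k₁ := by
  have hS : NullMeasurableSet {z | k₂ < u z} (volume.restrict (cyl p x₀ t₀ R)) :=
    nullMeasurableSet_lt aemeasurable_const hu
  have hd : 0 < k₂ - k₁ := by linarith
  have hP : 0 < bigP p := by linarith [two_le_bigP p]
  rw [← lintegral_indicator_one₀ hS, levelEnergy,
    ← lintegral_const_mul' _ _ ENNReal.ofReal_ne_top]
  refine lintegral_mono fun z => ?_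
  by_cases hz : k₂ < u z
  · rw [indicator_of_mem (by exact hz), Pi.one_apply, ← ENNReal.ofReal_mul (by positivity),
      ENNReal.one_le_ofReal, max_eq_left (by linarith), Real.rpow_neg hd.le, ← Real.inv_rpow hd.le,
      ← Real.mul_rpow (by positivity) (by linarith)]
    refine Real.one_le_rpow ?_ hP.le
    rw [inv_mul_eq_div, le_div_iff₀ hd]
    linarith
  · rw [indicator_of_notMem (by exact hz)]
    exact zero_le

/-- Hölder's inequality against the indicator of the superlevel set. -/
lemma levelEnergy_le_holder {p x₀ : Fin n → ℝ} {t₀ r : ℝ} {u : SpaceTime n → ℝ}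
    (hu : AEMeasurable u (volume.restrict (cyl p x₀ t₀ r))) (hPq : bigP p < parExp p) (k : ℝ) :
    levelEnergy p x₀ t₀ u r k ≤
      (∫⁻ z in cyl p x₀ t₀ r, ENNReal.ofReal (max (u z - k) 0 ^ parExp p)) ^
        (bigP p / parExp p) *
      (volume.restrict (cyl p x₀ t₀ r) {z | k < u z}) ^ (1 - bigP p / parExp p) := by
  have hS : NullMeasurableSet {z | k < u z} (volume.restrict (cyl p x₀ t₀ r)) :=
    nullMeasurableSet_lt aemeasurable_const hu
  have hP : 0 < bigP p := by linarith [two_le_bigP p]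
  have hq : 0 < parExp p := hP.trans hPq
  have hθ : 0 < bigP p / parExp p := div_pos hP hq
  have hθ1 : 0 < 1 - bigP p / parExp p := by
    rw [sub_pos, div_lt_one hq]; exact hPq
  have hH := ENNReal.lintegral_mul_norm_pow_le (μ := volume.restrict (cyl p x₀ t₀ r))
    (f := fun z => ENNReal.ofReal (max (u z - k) 0 ^ parExp p))
    (g := {z | k < u z}.indicator 1)
    (((hu.sub_const k).max aemeasurable_const).pow_const _).ennreal_ofReal
    (aemeasurable_one.indicator₀ hS) hθ.le hθ1.le (by ring)
  rw [lintegral_indicator_one₀ hS] at hH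
  refine le_trans (lintegral_mono fun z => ?_) hH
  simp only
  by_cases hz : k < u z
  · rw [indicator_of_mem (by exact hz), Pi.one_apply, ENNReal.one_rpow, mul_one,
      ENNReal.ofReal_rpow_of_nonneg (Real.rpow_nonneg (le_max_right _ _) _) hθ.le,
      ← Real.rpow_mul (le_max_right _ _), mul_div_cancel₀ _ hq.ne']
  · rw [max_eq_right (by linarith), Real.zero_rpow hP.ne', ENNReal.ofReal_zero]
    exact zero_le

/-- By induction y_j ≤ y_0 b^j with b = B^(-1/α). Since b^α = 1/B, the superlinear factor y_j^α
cancels the growth B^j, and the initial condition supplies one more factor b. -/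
lemma fast_geometric_convergence {y : ℕ → ℝ} {M B α : ℝ} (hy : ∀ j, 0 ≤ y j) (hM : 0 ≤ M)
    (hB : 1 < B) (hα : 0 < α) (hrec : ∀ j, y (j + 1) ≤ M * B ^ j * y j ^ (1 + α))
    (hinit : M * y 0 ^ α * B ^ (1 / α) ≤ 1) : Tendsto y atTop (𝓝 0) := by
  have hB0 : 0 < B := by linarith
  set b : ℝ := B ^ (-(1 / α)) with hb
  have hb0 : 0 < b := Real.rpow_pos_of_pos hB0 _
  have hb1 : b < 1 := Real.rpow_lt_one_of_one_lt_of_neg hB (by simpa using hα)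
  have hbα : b ^ α = B⁻¹ := by
    rw [hb, ← Real.rpow_mul hB0.le, neg_mul, one_div_mul_cancel hα.ne', Real.rpow_neg_one]
  have hinit' : M * y 0 ^ α ≤ b := by
    rw [hb, Real.rpow_neg hB0.le, ← one_div, le_div_iff₀ (Real.rpow_pos_of_pos hB0 _)]
    exact hinit
  have hbound : ∀ j, y j ≤ y 0 * b ^ j := by
    intro j
    induction j with
    | zero => simp
    | succ j ih =>
      have h1 : y j ^ α ≤ y 0 ^ α * (B⁻¹) ^ j := by
        calc y j ^ α ≤ (y 0 * b ^ j) ^ α := Real.rpow_le_rpow (hy j) ih hα.le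
          _ = _ := by
            rw [Real.mul_rpow (hy 0) (by positivity), ← hbα, ← Real.rpow_natCast,
              ← Real.rpow_natCast, ← Real.rpow_mul hb0.le, ← Real.rpow_mul hb0.le, mul_comm α]
      calc y (j + 1) ≤ M * B ^ j * y j ^ (1 + α) := hrec j
        _ = M * B ^ j * y j ^ α * y j := by
          rw [Real.rpow_add_of_nonneg (hy j) zero_le_one hα.le, Real.rpow_one]; ring
        _ ≤ M * B ^ j * (y 0 ^ α * (B⁻¹) ^ j) * y j := by
          have := hy j
          gcongr
        _ = M * y 0 ^ α * y j := by
          rw [inv_pow]; field_simp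
        _ ≤ b * (y 0 * b ^ j) := mul_le_mul hinit' ih (hy j) hb0.le
        _ = y 0 * b ^ (j + 1) := by ring
  have hlim : Tendsto (fun j => y 0 * b ^ j) atTop (𝓝 0) := by
    simpa using (tendsto_pow_atTop_nhds_zero_of_lt_one hb0.le hb1).const_mul (y 0)
  exact squeeze_zero hy hbound hlim

/-- The sides contribute ρ to the power ∑ 1/pᵢ = n/p̄ and the time interval one further ρ. -/
lemma measureReal_cyl {p : Fin n → ℝ} (hn : 0 < n) (hp : ∀ i, 1 < p i) (x₀ : Fin n → ℝ) (t₀ : ℝ)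
    {ρ : ℝ} (hρ : 0 < ρ) :
    volume.real (cyl p x₀ t₀ ρ) = 2 ^ n * ρ ^ ((n + pbar p) / pbar p) := by
  have hP := pbar_pos hp hn
  have h1 : volume (cyl p x₀ t₀ ρ) = volume (box p x₀ ρ) * volume (Ioo (t₀ - ρ) t₀) :=
    Measure.prod_prod _ _
  rw [Measure.real, h1, ENNReal.toReal_mul, box, Real.volume_pi_Ioo, Real.volume_Ioo,
    ENNReal.toReal_prod]
  have h2 : ∀ i, (ENNReal.ofReal (x₀ i + ρ ^ (1 / p i) - (x₀ i - ρ ^ (1 / p i)))).toReal =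
      2 * ρ ^ (1 / p i) := fun i => by
    have := Real.rpow_nonneg hρ.le (1 / p i)
    rw [ENNReal.toReal_ofReal (by linarith)]
    ring
  simp_rw [h2]
  rw [Finset.prod_mul_distrib, Finset.prod_const, Finset.card_univ, Fintype.card_fin,
    ← Real.rpow_sum_of_pos hρ, sum_inv_eq p hn, ENNReal.toReal_ofReal (by linarith)]
  rw [mul_assoc]
  congr 1
  have : t₀ - (t₀ - ρ) = ρ ^ (1 : ℝ) := by rw [Real.rpow_one]; ring
  rw [this, ← Real.rpow_add hρ]
  congr 1
  field_simp

/-! ### Arithmetic of the exponents -/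

section Exponents

variable {p : Fin n → ℝ}

/-- The total power of the energy in one iteration step exceeds 1 by α = P/(n + 2): the iteration is
superlinear. -/
lemma step_exponent_sum (hn : 0 < n) (hP : 0 < pbar p) :
    (1 + pbar p / n) * (bigP p / parExp p) + (1 - bigP p / parExp p) =
      1 + bigP p / ((n : ℝ) + 2) := by
  have hn0 : (0 : ℝ) < n := by exact_mod_cast hn
  unfold parExp
  field_simp
  ring

/-- The factor (1 - σ)^(-𝒫)/ρ thus enters with power α(n + p̄)/p̄: its ρ part combines with the
energy into a mean value over the cylinder, and its σ part yields the stated power of 1 - σ. -/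
lemma step_exponent_eq (hn : 0 < n) (hP : 0 < pbar p) :
    (1 + pbar p / n) * (bigP p / parExp p) =
      (n + pbar p) / pbar p * (bigP p / ((n : ℝ) + 2)) := by
  have hn0 : (0 : ℝ) < n := by exact_mod_cast hn
  unfold parExp
  field_simp

/-- The smallness condition compares k^(P(1-P/q)), q = `parExp p`, with the α-th power of the mean
value. Solving for k gives the exponent in the final bound. -/
lemma level_exponent_eq (hn : 0 < n) (hP : 0 < pbar p) (hPq : bigP p < parExp p) :
    pbar p / (pbar p * ((n : ℝ) + 2) - n * bigP p) * (bigP p * (1 - bigP p / parExp p)) =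
      bigP p / ((n : ℝ) + 2) := by
  have hn0 : (0 : ℝ) < n := by exact_mod_cast hn
  have h : 0 < pbar p * ((n : ℝ) + 2) - n * bigP p := by
    rw [parExp, lt_div_iff₀ hn0] at hPq
    linarith
  unfold parExp
  field_simp

end Exponents

lemma step_product {b c₁ c₂ y β τ : ℝ} (hb : 0 < b) (hc₁ : 0 ≤ c₁) (hc₂ : 0 ≤ c₂)
    (hy : 0 ≤ y) (hβ : 0 < β) (hτ : 0 < τ) (j : ℕ) :
    (c₁ * b ^ j * y) ^ β * (c₂ * b ^ j * y) ^ τ =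
      c₁ ^ β * c₂ ^ τ * (b ^ (β + τ)) ^ j * y ^ (β + τ) := by
  have hbj : 0 ≤ b ^ j := by positivity
  rw [Real.mul_rpow (by positivity) hy, Real.mul_rpow hc₁ hbj, Real.mul_rpow (by positivity) hy,
    Real.mul_rpow hc₂ hbj, Real.rpow_add_of_nonneg hy hβ.le hτ.le]
  have : (b ^ (β + τ)) ^ j = (b ^ j) ^ β * (b ^ j) ^ τ := by
    rw [← Real.rpow_add_of_nonneg hbj hβ.le hτ.le, ← Real.rpow_natCast, ← Real.rpow_natCast,
      ← Real.rpow_mul hb.le, ← Real.rpow_mul hb.le, mul_comm]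
  rw [this]
  ring

/-- The smallness condition starting the iteration holds for large levels. -/
lemma initial_smallness (hn : 0 < n) {p : Fin n → ℝ} (hP : 0 < pbar p)
    (hPq : bigP p < parExp p) {C₁ σ ρ y₀ k : ℝ} (hC₁ : 0 < C₁) (hσ : σ < 1) (hρ : 0 < ρ)
    (hy₀ : 0 ≤ y₀) (hk : 0 < k)
    (h : (C₁ * (2 ^ n) ^ (bigP p / ((n : ℝ) + 2))) ^ (1 / (bigP p * (1 - bigP p / parExp p))) *
      ((1 - σ) ^ (-(pmax p * ((n : ℝ) + pbar p) / pbar p)) *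
        (y₀ / (2 ^ n * ρ ^ ((n + pbar p) / pbar p)))) ^
        (pbar p / (pbar p * ((n : ℝ) + 2) - n * bigP p)) ≤ k) :
    C₁ * ((1 - σ) ^ (-pmax p) / ρ) ^ ((1 + pbar p / n) * (bigP p / parExp p)) *
      y₀ ^ (bigP p / ((n : ℝ) + 2)) * (k ^ (-bigP p)) ^ (1 - bigP p / parExp p) ≤ 1 := by
  have hP2 : 0 < bigP p := by linarith [two_le_bigP p]
  have hq : 0 < parExp p := hP2.trans hPq
  have hτ : 0 < 1 - bigP p / parExp p := by
    rw [sub_pos, div_lt_one hq]; exact hPq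
  have hPτ : 0 < bigP p * (1 - bigP p / parExp p) := mul_pos hP2 hτ
  have h1σ : 0 < 1 - σ := by linarith
  set α := bigP p / ((n : ℝ) + 2) with hα
  set μ := (n + pbar p) / pbar p with hμ
  set A := (1 - σ) ^ (-(pmax p * ((n : ℝ) + pbar p) / pbar p)) with hA
  have hA0 : 0 < A := Real.rpow_pos_of_pos h1σ _
  have hρμ : 0 < ρ ^ μ := Real.rpow_pos_of_pos hρ _
  have hDμ : ((1 - σ) ^ (-pmax p) / ρ) ^ μ = A / ρ ^ μ := by
    rw [Real.div_rpow (Real.rpow_nonneg h1σ.le _) hρ.le, ← Real.rpow_mul h1σ.le, hA]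
    congr 2
    rw [hμ]; ring
  have hD0 : 0 ≤ (1 - σ) ^ (-pmax p) / ρ := div_nonneg (Real.rpow_nonneg h1σ.le _) hρ.le
  rw [step_exponent_eq hn hP, Real.rpow_mul hD0, hDμ]
  have h2n : (0 : ℝ) < 2 ^ n := by positivity
  set X := A * (y₀ / (2 ^ n * ρ ^ μ)) with hX
  have hX0 : 0 ≤ X := by positivity
  -- Raising to the power P(1 - P/q) undoes the root of the constant and turns the exponent of the
  -- mean value into α.
  have hraise := Real.rpow_le_rpow (by positivity) h hPτ.le
  rw [Real.mul_rpow (by positivity) (by positivity), ← Real.rpow_mul (by positivity),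
    ← Real.rpow_mul hX0, level_exponent_eq hn hP hPq, one_div_mul_cancel hPτ.ne', Real.rpow_one]
    at hraise
  have e : C₁ * (A / ρ ^ μ) ^ α * y₀ ^ α = C₁ * (2 ^ n) ^ α * X ^ α := by
    rw [mul_assoc, mul_assoc, ← Real.mul_rpow (by positivity) hy₀,
      ← Real.mul_rpow h2n.le hX0]
    congr 2
    rw [hX]; field_simp
  rw [e, ← Real.rpow_mul hk.le, neg_mul, Real.rpow_neg hk.le, ← div_eq_mul_inv,
    div_le_one (Real.rpow_pos_of_pos hk _)]
  exact hraise

/-- The radii of the iteration. -/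
noncomputable def iterRadius (ρ σ : ℝ) (j : ℕ) : ℝ := ρ * (σ + (1 - σ) / 2 ^ j)

/-- The levels of the iteration. -/
noncomputable def iterLevel (k : ℝ) (j : ℕ) : ℝ := k * (1 - 1 / 2 ^ j)

/-- The geometric growth factor of the iteration. -/
noncomputable def iterBase (p : Fin n → ℝ) : ℝ := 2 ^ (bigP p + pmax p + 1)

lemma iterRadius_pos {ρ σ : ℝ} (hρ : 0 < ρ) (hσ : σ ∈ Ioo (0 : ℝ) 1) (j : ℕ) :
    0 < iterRadius ρ σ j := by
  have : 0 ≤ (1 - σ) / 2 ^ j := div_nonneg (by linarith [hσ.2]) (by positivity)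
  exact mul_pos hρ (by linarith [hσ.1])

lemma iterRadius_sub (ρ σ : ℝ) (j : ℕ) :
    iterRadius ρ σ j - iterRadius ρ σ (j + 1) = ρ * ((1 - σ) / 2 ^ (j + 1)) := by
  unfold iterRadius
  rw [pow_succ]
  field_simp
  ring

lemma iterRadius_succ_lt {ρ σ : ℝ} (hρ : 0 < ρ) (hσ : σ ∈ Ioo (0 : ℝ) 1) (j : ℕ) :
    iterRadius ρ σ (j + 1) < iterRadius ρ σ j := by
  rw [← sub_pos, iterRadius_sub]
  have : 0 < 1 - σ := by linarith [hσ.2]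
  positivity

lemma iterRadius_le {ρ σ : ℝ} (hρ : 0 < ρ) (hσ : σ ∈ Ioo (0 : ℝ) 1) (j : ℕ) :
    iterRadius ρ σ j ≤ ρ := by
  have : (1 - σ) / 2 ^ j ≤ 1 - σ :=
    div_le_self (by linarith [hσ.2]) (one_le_pow₀ (by norm_num))
  calc _ ≤ ρ * 1 := by unfold iterRadius; gcongr; linarith
    _ = ρ := mul_one ρ

lemma le_iterRadius {ρ σ : ℝ} (hρ : 0 < ρ) (hσ : σ ∈ Ioo (0 : ℝ) 1) (j : ℕ) :
    σ * ρ ≤ iterRadius ρ σ j := by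
  have : 0 ≤ (1 - σ) / 2 ^ j := div_nonneg (by linarith [hσ.2]) (by positivity)
  unfold iterRadius
  nlinarith

/-- A lower bound for the radii that does not involve σ, so that dividing by the radius puts no
negative power of σ into the estimate. -/
lemma div_pow_le_iterRadius {ρ σ : ℝ} (hρ : 0 < ρ) (hσ : σ ∈ Ioo (0 : ℝ) 1) (j : ℕ) :
    ρ / 2 ^ j ≤ iterRadius ρ σ j := by
  have h1 : (1 : ℝ) / 2 ^ j ≤ 1 := by
    rw [div_le_one (by positivity)]; exact one_le_pow₀ (by norm_num)
  have h2 : 0 ≤ σ * (1 - 1 / 2 ^ j) := mul_nonneg hσ.1.le (by linarith)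
  calc ρ / 2 ^ j = ρ * (1 / 2 ^ j) := by ring
    _ ≤ ρ * (σ + (1 - σ) / 2 ^ j) := by
      gcongr
      have : σ + (1 - σ) / 2 ^ j = 1 / 2 ^ j + σ * (1 - 1 / 2 ^ j) := by ring
      linarith

lemma iterLevel_sub (k : ℝ) (j : ℕ) :
    iterLevel k (j + 1) - iterLevel k j = k / 2 ^ (j + 1) := by
  unfold iterLevel
  rw [pow_succ]
  field_simp
  ring

lemma iterBase_pow (p : Fin n → ℝ) (j : ℕ) :
    iterBase p ^ j = ((2 : ℝ) ^ j) ^ (bigP p + pmax p + 1) := by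
  unfold iterBase
  rw [← Real.rpow_natCast, ← Real.rpow_natCast, ← Real.rpow_mul (by norm_num),
    ← Real.rpow_mul (by norm_num), mul_comm]

/-- The gradient factor in the energy inequality between two consecutive cylinders. -/
lemma iter_factor_le {p : Fin n → ℝ} (hpm : 0 ≤ pmax p) {ρ σ : ℝ} (hρ : 0 < ρ)
    (hσ : σ ∈ Ioo (0 : ℝ) 1) (j : ℕ) :
    ((iterRadius ρ σ j - iterRadius ρ σ (j + 1)) / iterRadius ρ σ j) ^ (-pmax p) /
      iterRadius ρ σ j ≤ ((2 : ℝ) ^ (j + 1)) ^ (pmax p + 1) * ((1 - σ) ^ (-pmax p) / ρ) := by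
  have h1σ : 0 < 1 - σ := by linarith [hσ.2]
  have hR := iterRadius_pos hρ hσ j
  set Δ : ℝ := 2 ^ (j + 1) with hΔ
  have hΔ0 : 0 < Δ := by positivity
  have h1 : (1 - σ) / Δ ≤ (iterRadius ρ σ j - iterRadius ρ σ (j + 1)) / iterRadius ρ σ j := by
    rw [iterRadius_sub, le_div_iff₀ hR, mul_comm]
    gcongr
    exact iterRadius_le hρ hσ j
  have h2 : ((iterRadius ρ σ j - iterRadius ρ σ (j + 1)) / iterRadius ρ σ j) ^ (-pmax p) ≤
      (1 - σ) ^ (-pmax p) * Δ ^ pmax p := by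
    refine (Real.rpow_le_rpow_of_nonpos (by positivity) h1 (by linarith)).trans_eq ?_
    rw [Real.div_rpow h1σ.le hΔ0.le, Real.rpow_neg hΔ0.le, div_inv_eq_mul]
  have h3 : (iterRadius ρ σ j)⁻¹ ≤ Δ / ρ := by
    rw [inv_le_comm₀ hR (by positivity), inv_div]
    refine le_trans ?_ (div_pow_le_iterRadius hρ hσ j)
    rw [hΔ]
    gcongr
    · norm_num
    · omega
  rw [div_eq_mul_inv]
  calc _ ≤ (1 - σ) ^ (-pmax p) * Δ ^ pmax p * (Δ / ρ) := by gcongr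
    _ = _ := by rw [Real.rpow_add hΔ0, Real.rpow_one]; ring

/-- Chebyshev's bound is used twice. Inside the higher integrability estimate its factor k^(-P) is
absorbed into (1 - σ)^(-𝒫)/ρ; in the Hölder factor it is kept, and there it makes the recursion
improve as k grows. -/
lemma levelEnergy_step (hn : 0 < n) {p : Fin n → ℝ} (hp : ∀ i, 1 < p i)
    (hPq : bigP p < parExp p) {x₀ : Fin n → ℝ} {t₀ ρ σ k C : ℝ} (hρ : 0 < ρ)
    (hσ : σ ∈ Ioo (0 : ℝ) 1) (hk1 : 1 ≤ k) (hkρ : ρ ^ (1 / bigP p) ≤ k) (hC : 0 < C)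
    {u : SpaceTime n → ℝ} {j : ℕ}
    (hu : AEMeasurable u (volume.restrict (cyl p x₀ t₀ (iterRadius ρ σ j))))
    (hint : ∫⁻ z in cyl p x₀ t₀ (iterRadius ρ σ (j + 1)),
        ENNReal.ofReal (max (u z - iterLevel k (j + 1)) 0 ^ parExp p) ≤
      (ENNReal.ofReal C * (ENNReal.ofReal (((iterRadius ρ σ j - iterRadius ρ σ (j + 1)) /
        iterRadius ρ σ j) ^ (-pmax p) / iterRadius ρ σ j) *
          lowerOrder p x₀ t₀ (iterRadius ρ σ j) (fun z => max (u z - iterLevel k (j + 1)) 0) +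
        volume.restrict (cyl p x₀ t₀ (iterRadius ρ σ j)) {z | iterLevel k (j + 1) < u z})) ^
          (1 + pbar p / n)) :
    levelEnergy p x₀ t₀ u (iterRadius ρ σ (j + 1)) (iterLevel k (j + 1)) ≤
      ((ENNReal.ofReal (C * (n + 2) * ((1 - σ) ^ (-pmax p) / ρ) * iterBase p * iterBase p ^ j) *
        levelEnergy p x₀ t₀ u (iterRadius ρ σ j) (iterLevel k j)) ^ (1 + pbar p / n)) ^
          (bigP p / parExp p) *
      (ENNReal.ofReal (k ^ (-bigP p) * iterBase p * iterBase p ^ j) *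
        levelEnergy p x₀ t₀ u (iterRadius ρ σ j) (iterLevel k j)) ^
          (1 - bigP p / parExp p) := by
  have hpm1 : 1 ≤ pmax p := (hp ⟨0, hn⟩).le.trans (le_pmax p _)
  have hP2 := two_le_bigP p
  have hP : 0 < pbar p := pbar_pos hp hn
  have hn0 : (0 : ℝ) < n := by exact_mod_cast hn
  have h1σ : 0 < 1 - σ := by linarith [hσ.2]
  have hq : 0 < parExp p := by linarith
  set R := iterRadius ρ σ j with hR
  set r := iterRadius ρ σ (j + 1) with hr
  set Δ : ℝ := 2 ^ (j + 1) with hΔdef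
  have hΔ1 : 1 ≤ Δ := one_le_pow₀ (by norm_num)
  have hΔ0 : 0 < Δ := by linarith
  have hk0 : 0 < k := by linarith
  set k₁ := iterLevel k j with hk₁
  set k₂ := iterLevel k (j + 1) with hk₂
  have hd : k₂ - k₁ = k / Δ := iterLevel_sub k j
  have hk12 : k₁ < k₂ := by rw [← sub_pos, hd]; positivity
  -- Here k ≥ 1 is used: consecutive levels differ by k/Δ.
  have hdinv : (k₂ - k₁)⁻¹ ≤ Δ := by
    rw [hd, inv_div]; exact div_le_self hΔ0.le hk1
  set Y := levelEnergy p x₀ t₀ u R k₁ with hY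
  set D := (1 - σ) ^ (-pmax p) / ρ with hD
  have hD0 : 0 < D := div_pos (Real.rpow_pos_of_pos h1σ _) hρ
  have hb : iterBase p * iterBase p ^ j = Δ ^ (bigP p + pmax p + 1) := by
    rw [← pow_succ', iterBase_pow]
  have hV : volume.restrict (cyl p x₀ t₀ R) {z | k₂ < u z} ≤
      ENNReal.ofReal (k ^ (-bigP p) * Δ ^ bigP p) * Y := by
    refine (measure_superlevel_le hu hk12).trans_eq ?_
    congr 2
    rw [hd, Real.div_rpow hk0.le hΔ0.le, Real.rpow_neg hΔ0.le, div_inv_eq_mul]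
  -- Here k ≥ ρ^(1/P) is used: k^(-P) ≤ 1/ρ ≤ D.
  have hkD : k ^ (-bigP p) ≤ D := by
    have h1 : ρ ≤ k ^ bigP p := by
      have := Real.rpow_le_rpow (by positivity) hkρ (by linarith : 0 ≤ bigP p)
      rwa [← Real.rpow_mul hρ.le, one_div_mul_cancel (by linarith), Real.rpow_one] at this
    have h2 : 1 ≤ (1 - σ) ^ (-pmax p) :=
      Real.one_le_rpow_of_pos_of_le_one_of_nonpos h1σ (by linarith [hσ.1]) (by linarith)
    rw [Real.rpow_neg hk0.le, hD, inv_eq_one_div]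
    gcongr
  have hΔP : Δ ^ bigP p ≤ Δ ^ (bigP p + pmax p + 1) :=
    Real.rpow_le_rpow_of_exponent_le hΔ1 (by linarith)
  have hsum : ENNReal.ofReal (((R - r) / R) ^ (-pmax p) / R) *
      lowerOrder p x₀ t₀ R (fun z => max (u z - k₂) 0) +
        volume.restrict (cyl p x₀ t₀ R) {z | k₂ < u z} ≤
      ENNReal.ofReal ((n + 2) * D * Δ ^ (bigP p + pmax p + 1)) * Y := by
    have hf := ENNReal.ofReal_le_ofReal (iter_factor_le (p := p) (by linarith) hρ hσ j)
    calc _ ≤ ENNReal.ofReal (Δ ^ (pmax p + 1) * D) *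
          (ENNReal.ofReal ((n + 1) * Δ ^ bigP p) * Y) +
            ENNReal.ofReal (k ^ (-bigP p) * Δ ^ bigP p) * Y :=
          add_le_add (mul_le_mul' hf (lowerOrder_le_levelEnergy hp hk12 hΔ1 hdinv)) hV
      _ = ENNReal.ofReal ((n + 1) * D * Δ ^ (bigP p + pmax p + 1) +
            k ^ (-bigP p) * Δ ^ bigP p) * Y := by
          rw [← mul_assoc, ← ENNReal.ofReal_mul (by positivity), ← add_mul,
            ← ENNReal.ofReal_add (by positivity) (by positivity)]
          congr 3
          rw [add_assoc (bigP p), Real.rpow_add hΔ0 (bigP p)]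
          ring
      _ ≤ _ := by
          refine mul_le_mul_left (ENNReal.ofReal_le_ofReal ?_) _
          have : k ^ (-bigP p) * Δ ^ bigP p ≤ D * Δ ^ (bigP p + pmax p + 1) := by gcongr
          linarith
  have hrR : r ≤ R := (iterRadius_succ_lt hρ hσ j).le
  have hr0 : 0 < r := iterRadius_pos hρ hσ (j + 1)
  have hsub := cyl_mono p (fun i => by linarith [hp i]) x₀ t₀ hr0.le hrR
  have hτ : 0 ≤ 1 - bigP p / parExp p := by
    rw [sub_nonneg, div_le_one hq]; exact hPq.le
  refine (levelEnergy_le_holder (hu.mono_set hsub) hPq k₂).trans ?_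
  refine mul_le_mul' (ENNReal.rpow_le_rpow (hint.trans (ENNReal.rpow_le_rpow ?_ (by positivity)))
    (by positivity)) (ENNReal.rpow_le_rpow ?_ hτ)
  · calc _ ≤ ENNReal.ofReal C * (ENNReal.ofReal ((n + 2) * D * Δ ^ (bigP p + pmax p + 1)) * Y) :=
          mul_le_mul_right hsum _
      _ = _ := by
          rw [← mul_assoc, ← ENNReal.ofReal_mul hC.le, mul_assoc _ (iterBase p), hb]
          congr 2
          ring
  · refine (Measure.restrict_mono hsub le_rfl _).trans (hV.trans ?_)
    rw [mul_assoc (k ^ (-bigP p)), hb]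
    refine mul_le_mul_left (ENNReal.ofReal_le_ofReal ?_) _
    gcongr

lemma levelEnergy_zero_ne_top {p : Fin n → ℝ} {x₀ : Fin n → ℝ} {t₀ ρ : ℝ} {u : SpaceTime n → ℝ}
    {S : Set (SpaceTime n)} (hu : MemLpLoc (bigP p) u S) (hS : closure (cyl p x₀ t₀ ρ) ⊆ S) :
    levelEnergy p x₀ t₀ u ρ 0 ≠ ⊤ := by
  have hP2 := two_le_bigP p
  have hm : MemLp u (ENNReal.ofReal (bigP p)) (volume.restrict (cyl p x₀ t₀ ρ)) :=
    (hu _ hS (isCompact_closure_cyl p x₀ t₀ ρ)).mono_measure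
      (Measure.restrict_mono subset_closure le_rfl)
  have h := lintegral_rpow_enorm_lt_top_of_eLpNorm_lt_top (by simp; linarith)
    ENNReal.ofReal_ne_top hm.2
  rw [ENNReal.toReal_ofReal (by linarith)] at h
  refine (lt_of_le_of_lt (lintegral_mono fun z => ?_) h).ne
  rw [Real.enorm_eq_ofReal_abs, ENNReal.ofReal_rpow_of_nonneg (abs_nonneg _) (by linarith),
    sub_zero]
  exact ENNReal.ofReal_le_ofReal (Real.rpow_le_rpow (le_max_right _ _)
    (max_le (le_abs_self _) (abs_nonneg _)) (by linarith))

lemma levelEnergy_mono {p : Fin n → ℝ} (hp : ∀ i, 0 < p i) {x₀ : Fin n → ℝ} {t₀ r R k₁ k₂ : ℝ}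
    {u : SpaceTime n → ℝ} (hr : 0 ≤ r) (hrR : r ≤ R) (hk : k₁ ≤ k₂) :
    levelEnergy p x₀ t₀ u r k₂ ≤ levelEnergy p x₀ t₀ u R k₁ := by
  have hP2 := two_le_bigP p
  refine lintegral_mono' (Measure.restrict_mono (cyl_mono p hp x₀ t₀ hr hrR) le_rfl) fun z => ?_
  refine ENNReal.ofReal_le_ofReal (Real.rpow_le_rpow (le_max_right _ _) ?_ (by linarith))
  exact max_le_max (by linarith) le_rfl

lemma ae_le_of_levelEnergy_eq_zero {p x₀ : Fin n → ℝ} {t₀ R k : ℝ} {u : SpaceTime n → ℝ}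
    (hu : AEMeasurable u (volume.restrict (cyl p x₀ t₀ R)))
    (h : levelEnergy p x₀ t₀ u R k = 0) : ∀ᵐ z ∂volume.restrict (cyl p x₀ t₀ R), u z ≤ k := by
  have hP2 := two_le_bigP p
  rw [levelEnergy, lintegral_eq_zero_iff'
    (((hu.sub_const k).max aemeasurable_const).pow_const _).ennreal_ofReal] at h
  filter_upwards [h] with z hz
  by_contra! hlt
  have h1 : 0 < max (u z - k) 0 := lt_max_of_lt_left (by linarith)
  have h2 := Real.rpow_pos_of_pos h1 (bigP p)
  simp only [Pi.zero_apply, ENNReal.ofReal_eq_zero] at hz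
  linarith

lemma setAverage_posPart_eq (hn : 0 < n) {p : Fin n → ℝ} (hp : ∀ i, 1 < p i) {x₀ : Fin n → ℝ}
    {t₀ ρ : ℝ} (hρ : 0 < ρ) {u : SpaceTime n → ℝ}
    (hu : AEMeasurable u (volume.restrict (cyl p x₀ t₀ ρ))) :
    ⨍ z in cyl p x₀ t₀ ρ, max (u z) 0 ^ bigP p =
      (levelEnergy p x₀ t₀ u ρ 0).toReal / (2 ^ n * ρ ^ ((n + pbar p) / pbar p)) := by
  rw [setAverage_eq, measureReal_cyl hn hp x₀ t₀ hρ, smul_eq_mul, inv_mul_eq_div,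
    integral_eq_lintegral_of_nonneg_ae
      (ae_of_all _ fun z => Real.rpow_nonneg (le_max_right _ _) _)
      ((hu.max aemeasurable_const).pow_const _).aestronglyMeasurable]
  simp only [levelEnergy, sub_zero]

/-- The De Giorgi iteration on a fixed cylinder. -/
lemma ae_le_of_level_ge (hn : 0 < n) {p : Fin n → ℝ} (hp : ∀ i, 1 < p i)
    (hPq : bigP p < parExp p) {C x₀ t₀ ρ σ k : _} (hC : 0 < C) (hρ : 0 < ρ)
    (hσ : σ ∈ Ioo (0 : ℝ) 1) (hk1 : 1 ≤ k) (hkρ : ρ ^ (1 / bigP p) ≤ k)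
    {u : SpaceTime n → ℝ} (hu : AEMeasurable u (volume.restrict (cyl p x₀ t₀ ρ)))
    (hfin : levelEnergy p x₀ t₀ u ρ 0 ≠ ⊤)
    (hint : ∀ r R l : ℝ, 0 < r → r < R → R ≤ ρ →
      ∫⁻ z in cyl p x₀ t₀ r, ENNReal.ofReal (max (u z - l) 0 ^ parExp p) ≤
        (ENNReal.ofReal C * (ENNReal.ofReal (((R - r) / R) ^ (-pmax p) / R) *
          lowerOrder p x₀ t₀ R (fun z => max (u z - l) 0) +
            volume.restrict (cyl p x₀ t₀ R) {z | l < u z})) ^ (1 + pbar p / n))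
    (hinit : (C * (n + 2) * iterBase p) ^ ((1 + pbar p / n) * (bigP p / parExp p)) *
        iterBase p ^ (1 - bigP p / parExp p) *
        (iterBase p ^ (1 + bigP p / ((n : ℝ) + 2))) ^ (1 / (bigP p / ((n : ℝ) + 2))) *
      ((1 - σ) ^ (-pmax p) / ρ) ^ ((1 + pbar p / n) * (bigP p / parExp p)) *
      (levelEnergy p x₀ t₀ u ρ 0).toReal ^ (bigP p / ((n : ℝ) + 2)) *
      (k ^ (-bigP p)) ^ (1 - bigP p / parExp p) ≤ 1) :
    ∀ᵐ z ∂volume.restrict (cyl p x₀ t₀ (σ * ρ)), u z ≤ k := by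
  have hp0 : ∀ i, 0 < p i := fun i => by linarith [hp i]
  have hpm1 : 1 ≤ pmax p := (hp ⟨0, hn⟩).le.trans (le_pmax p _)
  have hP2 := two_le_bigP p
  have hP : 0 < pbar p := pbar_pos hp hn
  have hn0 : (0 : ℝ) < n := by exact_mod_cast hn
  have hq : 0 < parExp p := by linarith
  have h1σ : 0 < 1 - σ := by linarith [hσ.2]
  have hk0 : 0 < k := by linarith
  have hb1 : 1 < iterBase p := Real.one_lt_rpow (by norm_num) (by linarith)
  have hb0 : 0 < iterBase p := by linarith
  set b := iterBase p
  set α := bigP p / ((n : ℝ) + 2)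
  have hα : 0 < α := by positivity
  have hτ : 0 < 1 - bigP p / parExp p := by
    rw [sub_pos, div_lt_one hq]; exact hPq
  have hβτ : (1 + pbar p / n) * (bigP p / parExp p) + (1 - bigP p / parExp p) = 1 + α :=
    step_exponent_sum hn hP
  have hβ : 0 < (1 + pbar p / n) * (bigP p / parExp p) := by positivity
  set τ := 1 - bigP p / parExp p
  set D := (1 - σ) ^ (-pmax p) / ρ
  have hD : 0 < D := div_pos (Real.rpow_pos_of_pos h1σ _) hρ
  set Y : ℕ → ℝ≥0∞ := fun j => levelEnergy p x₀ t₀ u (iterRadius ρ σ j) (iterLevel k j) with hY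
  have hY0 : Y 0 = levelEnergy p x₀ t₀ u ρ 0 := by simp [hY, iterRadius, iterLevel]
  have hlev : ∀ j, 0 ≤ iterLevel k j ∧ iterLevel k j ≤ k := fun j => by
    have h1 : (1 : ℝ) / 2 ^ j ≤ 1 := by
      rw [div_le_one (by positivity)]; exact one_le_pow₀ (by norm_num)
    have h2 : (0 : ℝ) < 1 / 2 ^ j := by positivity
    exact ⟨mul_nonneg hk0.le (by linarith), by unfold iterLevel; nlinarith⟩
  have hYtop : ∀ j, Y j ≠ ⊤ := fun j => ne_top_of_le_ne_top hfin
    (levelEnergy_mono hp0 (iterRadius_pos hρ hσ j).le (iterRadius_le hρ hσ j) (hlev j).1)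
  have hrec : ∀ j, (Y (j + 1)).toReal ≤
      (C * (n + 2) * D * b) ^ ((1 + pbar p / n) * (bigP p / parExp p)) *
        (k ^ (-bigP p) * b) ^ τ * (b ^ (1 + α)) ^ j * (Y j).toReal ^ (1 + α) := fun j => by
    have h := levelEnergy_step hn hp hPq hρ hσ hk1 hkρ hC (j := j)
      (hu.mono_set (cyl_mono p hp0 x₀ t₀ (iterRadius_pos hρ hσ j).le (iterRadius_le hρ hσ j)))
      (hint _ _ _ (iterRadius_pos hρ hσ _) (iterRadius_succ_lt hρ hσ j) (iterRadius_le hρ hσ j))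
    rw [← ENNReal.rpow_mul] at h
    have hm := ENNReal.toReal_mono (ENNReal.mul_ne_top
      (ENNReal.rpow_ne_top_of_nonneg hβ.le (ENNReal.mul_ne_top ENNReal.ofReal_ne_top (hYtop j)))
      (ENNReal.rpow_ne_top_of_nonneg hτ.le
        (ENNReal.mul_ne_top ENNReal.ofReal_ne_top (hYtop j)))) h
    rw [ENNReal.toReal_mul, ← ENNReal.toReal_rpow, ← ENNReal.toReal_rpow, ENNReal.toReal_mul,
      ENNReal.toReal_mul, ENNReal.toReal_ofReal (by positivity),
      ENNReal.toReal_ofReal (by positivity),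
      step_product hb0 (by positivity) (by positivity) ENNReal.toReal_nonneg hβ hτ, hβτ] at hm
    exact hm
  have hlim := fast_geometric_convergence (fun j => ENNReal.toReal_nonneg) (by positivity)
    (Real.one_lt_rpow hb1 (by linarith)) hα hrec (by
      refine le_trans (le_of_eq ?_) hinit
      rw [hY0, Real.mul_rpow (by positivity) hb0.le, Real.mul_rpow (by positivity) hD.le,
        Real.mul_rpow (by positivity) hb0.le, Real.mul_rpow (by positivity) hb0.le]
      ring)
  have hσρ : 0 < σ * ρ := mul_pos hσ.1 hρ
  -- The limiting cylinder lies in all the others and the limiting level is above all the others, so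
  -- its energy is bounded by every Y_j and hence vanishes.
  have hZ : ∀ j, levelEnergy p x₀ t₀ u (σ * ρ) k ≤ Y j := fun j =>
    levelEnergy_mono hp0 hσρ.le (le_iterRadius hρ hσ j) (hlev j).2
  have hle : (levelEnergy p x₀ t₀ u (σ * ρ) k).toReal ≤ 0 :=
    ge_of_tendsto' hlim fun j => ENNReal.toReal_mono (hYtop j) (hZ j)
  have hzero : levelEnergy p x₀ t₀ u (σ * ρ) k = 0 :=
    ((ENNReal.toReal_eq_zero_iff _).1 (le_antisymm hle ENNReal.toReal_nonneg)).resolve_right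
      (ne_top_of_le_ne_top (hYtop 0) (hZ 0))
  exact ae_le_of_levelEnergy_eq_zero (hu.mono_set (cyl_mono p hp0 x₀ t₀ hσρ.le
    (by nlinarith [hσ.2]))) hzero

lemma exists_ae_le_supBound (hn : 2 ≤ n) {p : Fin n → ℝ} (hp : ∀ i, 1 < p i)
    (hpn : pbar p < n) (hPq : bigP p < parExp p) {c : ℝ} (hc : 0 < c) (δmax : ℝ) :
    ∃ C : ℝ, 0 < C ∧ ∀ δ : Fin n → ℝ, (∀ i, 0 ≤ δ i) → (∀ i, δ i ≤ δmax) →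
      ∀ Ω : Set (Fin n → ℝ), IsOpen Ω → ∀ (T : ℝ) (u : SpaceTime n → ℝ), MemDGPlus p δ Ω T c u →
        ∀ (x₀ : Fin n → ℝ) (t₀ ρ σ : ℝ), 0 < ρ → closure (cyl p x₀ t₀ ρ) ⊆ parDomain Ω T →
          σ ∈ Ioo (0 : ℝ) 1 → ∀ᵐ z ∂volume.restrict (cyl p x₀ t₀ (σ * ρ)),
            u z ≤ supBound p C x₀ t₀ ρ σ (fun z => max (u z) 0) := by
  have hn1 : 0 < n := by omega
  have hp0 : ∀ i, 0 < p i := fun i => by linarith [hp i]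
  obtain ⟨C, hC, H⟩ := exists_higher_integrability hn hp hpn hc δmax
  have hb0 : 0 < iterBase p := Real.rpow_pos_of_pos (by norm_num) _
  have hn0 : (0 : ℝ) < n := by exact_mod_cast hn1
  set C₁ := (C * (n + 2) * iterBase p) ^ ((1 + pbar p / n) * (bigP p / parExp p)) *
        iterBase p ^ (1 - bigP p / parExp p) *
        (iterBase p ^ (1 + bigP p / ((n : ℝ) + 2))) ^ (1 / (bigP p / ((n : ℝ) + 2))) with hC₁def
  have hC₁ : 0 < C₁ := by positivity
  -- The factor 2^n is the constant in the volume of the cylinder; the root matches the power of k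
  -- in the smallness condition.
  refine ⟨(C₁ * (2 ^ n) ^ (bigP p / ((n : ℝ) + 2))) ^
    (1 / (bigP p * (1 - bigP p / parExp p))), by positivity, ?_⟩
  intro δ hδ hδm Ω hΩ T u hu x₀ t₀ ρ σ hρ hcyl hσ
  obtain ⟨hum, huP, g, hug, hen⟩ := hu
  have humρ : AEMeasurable u (volume.restrict (cyl p x₀ t₀ ρ)) := aemeasurable_of_memLpLoc huP hcyl
  -- The level is the asserted bound itself: the three entries of the maximum are the three
  -- requirements of the iteration.
  set k := supBound p _ x₀ t₀ ρ σ (fun z => max (u z) 0) with hk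
  have hk1 : 1 ≤ k := le_max_left _ _
  have hkρ : ρ ^ (1 / bigP p) ≤ k := (le_max_left _ _).trans (le_max_right _ _)
  refine ae_le_of_level_ge hn1 hp hPq hC hρ hσ hk1 hkρ humρ (levelEnergy_zero_ne_top huP hcyl) ?_ ?_
  · intro r R l hr hrR hRρ
    have hcR : closure (cyl p x₀ t₀ R) ⊆ parDomain Ω T :=
      (closure_mono (cyl_mono p hp0 x₀ t₀ (hr.trans hrR).le hRρ)).trans hcyl
    exact H δ hδ hδm Ω hΩ T u g hum hug x₀ t₀ r R hr hrR hcR l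
      fun ζ hζ => hen x₀ t₀ R (hr.trans hrR) hcR ζ hζ l
  · refine initial_smallness hn1 (pbar_pos hp hn1) hPq hC₁ hσ.2 hρ ENNReal.toReal_nonneg
      (by linarith) ?_
    rw [← setAverage_posPart_eq hn1 hp hρ humρ]
    exact (le_max_right _ _).trans (le_max_right _ _)

/-! ### From cylinders to compact sets -/

/-- A backward cylinder does not contain its vertex. Moving the vertex forward in time by ρ/4 makes
the concentric cylinder of radius ρ/2 an open neighbourhood of the point. -/
lemma exists_closure_cyl_subset {p : Fin n → ℝ} (hp : ∀ i, 0 < p i) {S : Set (SpaceTime n)}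
    (hS : IsOpen S) {z : SpaceTime n} (hz : z ∈ S) :
    ∃ ρ : ℝ, 0 < ρ ∧ closure (cyl p z.1 (z.2 + ρ / 4) ρ) ⊆ S := by
  obtain ⟨ε, hε, hεS⟩ := Metric.nhds_basis_closedBall.mem_iff.1 (hS.mem_nhds hz)
  have h1 : ∀ i, ∀ᶠ ρ : ℝ in 𝓝[>] 0, ρ ^ (1 / p i) < ε := fun i => by
    have hc : ContinuousAt (fun ρ : ℝ => ρ ^ (1 / p i)) 0 :=
      Real.continuousAt_rpow_const _ _ (Or.inr (by have := hp i; positivity))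
    have : (0 : ℝ) ^ (1 / p i) < ε := by
      rwa [Real.zero_rpow (by have := hp i; positivity)]
    exact (hc.eventually_lt_const this).filter_mono nhdsWithin_le_nhds
  have h2 : ∀ᶠ ρ : ℝ in 𝓝[>] 0, ρ < ε :=
    (eventually_lt_nhds hε).filter_mono nhdsWithin_le_nhds
  obtain ⟨ρ, hρi, hρε, hρ⟩ := ((eventually_all.2 h1).and (h2.and self_mem_nhdsWithin)).exists
  have hρ0 : 0 < ρ := hρ
  refine ⟨ρ, hρ0, (closure_minimal ?_ Metric.isClosed_closedBall).trans hεS⟩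
  rintro ⟨x, t⟩ ⟨hx, ht⟩
  rw [Metric.mem_closedBall, Prod.dist_eq]
  refine max_le ((dist_pi_le_iff hε.le).2 fun i => ?_) ?_
  · have := hx i (mem_univ i)
    have := hρi i
    simp only [mem_Ioo] at *
    rw [Real.dist_eq, abs_le]
    constructor <;> linarith
  · simp only [mem_Ioo] at ht
    rw [Real.dist_eq, abs_le]
    constructor <;> linarith

lemma locBddAbove_of_cyl {p : Fin n → ℝ} (hp : ∀ i, 0 < p i) {S : Set (SpaceTime n)}
    (hS : IsOpen S) {u : SpaceTime n → ℝ}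
    (h : ∀ x₀ t₀ ρ, 0 < ρ → closure (cyl p x₀ t₀ ρ) ⊆ S →
      ∃ M : ℝ, ∀ᵐ z ∂volume.restrict (cyl p x₀ t₀ (1 / 2 * ρ)), u z ≤ M) : LocBddAbove u S := by
  intro K hKS hK
  refine hK.induction_on (p := fun K => ∃ M : ℝ, ∀ᵐ z ∂volume.restrict K, u z ≤ M)
    ⟨0, by simp⟩ ?_ ?_ ?_
  · rintro A B hAB ⟨M, hM⟩
    exact ⟨M, ae_restrict_of_ae_restrict_of_subset hAB hM⟩
  · rintro A B ⟨M, hM⟩ ⟨N, hN⟩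
    refine ⟨max M N, (ae_restrict_union_iff _ _ _).2 ⟨?_, ?_⟩⟩
    · filter_upwards [hM] with z hz using hz.trans (le_max_left _ _)
    · filter_upwards [hN] with z hz using hz.trans (le_max_right _ _)
  · intro z hz
    obtain ⟨ρ, hρ, hcyl⟩ := exists_closure_cyl_subset hp hS (hKS hz)
    refine ⟨_, mem_nhdsWithin_of_mem_nhds ((isOpen_cyl p z.1 _ _).mem_nhds
      ⟨mem_box_self p z.1 (by linarith), ?_⟩), h _ _ ρ hρ hcyl⟩
    constructor <;> linarith

/-! ### Reflection u ↦ -u -/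

lemma MemLpLoc.neg {X : Type*} [TopologicalSpace X] [MeasureSpace X] {q : ℝ} {f : X → ℝ}
    {S : Set X} (hf : MemLpLoc q f S) : MemLpLoc q (fun x => -f x) S :=
  fun K hKS hK => (hf K hKS hK).neg

lemma HasWeakPartial.neg {Ω : Set (Fin n → ℝ)} {i : Fin n} {v w : (Fin n → ℝ) → ℝ}
    (h : HasWeakPartial Ω i v w) : HasWeakPartial Ω i (fun x => -v x) (fun x => -w x) := by
  refine ⟨h.1.neg, h.2.1.neg, fun φ hφ hc hs => ?_⟩
  simp only [neg_mul, integral_neg]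
  rw [h.2.2 φ hφ hc hs]

lemma MemParabolicSobolev.neg {p : Fin n → ℝ} {Ω : Set (Fin n → ℝ)} {T : ℝ}
    {u : SpaceTime n → ℝ} {g : Fin n → SpaceTime n → ℝ} (h : MemParabolicSobolev p Ω T u g) :
    MemParabolicSobolev p Ω T (fun z => -u z) (fun i z => -g i z) where
  locInt := h.locInt.neg
  grad_locInt i := (h.grad_locInt i).neg
  weakGrad := by
    filter_upwards [h.weakGrad] with t ht i using (ht i).neg
  grad_memLp i := (h.grad_memLp i).neg

/-- The truncation of u from below at level -k is the truncation of -u from above at level k, and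
the energy sees the gradient only through its absolute value. -/
lemma MemDGMinus.neg {p δ : Fin n → ℝ} {Ω : Set (Fin n → ℝ)} {T c : ℝ} {u : SpaceTime n → ℝ}
    (h : MemDGMinus p δ Ω T c u) : MemDGPlus p δ Ω T c (fun z => -u z) := by
  obtain ⟨hum, huP, g, hug, hen⟩ := h
  refine ⟨hum.neg, huP.neg, fun i z => -g i z, hug.neg, ?_⟩
  intro x₀ t₀ ρ hρ hcyl ζ hζ k
  have h := hen x₀ t₀ ρ hρ hcyl ζ hζ (-k)
  have e1 : ∀ z, -(u z - -k) = -u z - k := fun z => by ring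
  have e2 : {z | u z < -k} = {z | k < -u z} := by ext z; simp [lt_neg]
  simp only [e1, e2] at h
  simpa only [EnergyIneq, abs_neg] using h

end AnisoDG

theorem theorem1 (n : ℕ) (hn : 2 ≤ n) (p : Fin n → ℝ)
    (hp : ∀ i, 1 < p i ∧ p i < AnisoDG.pbar p * (1 + 2 / (n : ℝ)))
    (hpn : AnisoDG.pbar p < (n : ℝ))
    (hsuper : 2 * (n : ℝ) / ((n : ℝ) + 2) < AnisoDG.pbar p)
    (c : ℝ) (hc : 0 < c) (δmax : ℝ) :
    ∃ C : ℝ, 0 < C ∧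
      ∀ (δ : Fin n → ℝ), (∀ i, 0 ≤ δ i) → (⨆ i, δ i) = δmax →
      ∀ (Ω : Set (Fin n → ℝ)), IsOpen Ω → IsConnected Ω → Bornology.IsBounded Ω →
      ∀ (T : ℝ), 0 < T → ∀ (u : AnisoDG.SpaceTime n → ℝ),
        (AnisoDG.MemDGPlus p δ Ω T c u →
          AnisoDG.LocBddAbove u (AnisoDG.parDomain Ω T) ∧
          ∀ (x₀ : Fin n → ℝ) (t₀ ρ σ : ℝ), 0 < ρ →
            closure (AnisoDG.cyl p x₀ t₀ ρ) ⊆ AnisoDG.parDomain Ω T → σ ∈ Ioo (0 : ℝ) 1 →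
            essSup (fun z => (u z : EReal))
                (volume.restrict (AnisoDG.cyl p x₀ t₀ (σ * ρ)))
              ≤ ((AnisoDG.supBound p C x₀ t₀ ρ σ (fun z => max (u z) 0) : ℝ) : EReal)) ∧
        (AnisoDG.MemDGMinus p δ Ω T c u →
          AnisoDG.LocBddBelow u (AnisoDG.parDomain Ω T) ∧
          ∀ (x₀ : Fin n → ℝ) (t₀ ρ σ : ℝ), 0 < ρ →
            closure (AnisoDG.cyl p x₀ t₀ ρ) ⊆ AnisoDG.parDomain Ω T → σ ∈ Ioo (0 : ℝ) 1 →
            ((-AnisoDG.supBound p C x₀ t₀ ρ σ (fun z => max (-u z) 0) : ℝ) : EReal)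
              ≤ essInf (fun z => (u z : EReal))
                (volume.restrict (AnisoDG.cyl p x₀ t₀ (σ * ρ)))) := by
  have hp1 : ∀ i, 1 < p i := fun i => (hp i).1
  have hp0 : ∀ i, 0 < p i := fun i => by linarith [hp1 i]
  obtain ⟨C, hC, H⟩ := AnisoDG.exists_ae_le_supBound hn hp1 hpn
    (AnisoDG.bigP_lt_parExp (by omega) (fun i => (hp i).2) hsuper) hc δmax
  have half : (1 / 2 : ℝ) ∈ Ioo (0 : ℝ) 1 := by constructor <;> norm_num
  refine ⟨C, hC, fun δ hδ hδmax Ω hΩ _ _ T _ u => ?_⟩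
  -- Only this common upper bound for the δᵢ enters the constant.
  have hδm : ∀ i, δ i ≤ δmax := fun i => hδmax ▸ le_ciSup (finite_range δ).bddAbove i
  have hopen : IsOpen (AnisoDG.parDomain Ω T) := hΩ.prod isOpen_Ioo
  refine ⟨fun hu => ⟨AnisoDG.locBddAbove_of_cyl hp0 hopen fun x₀ t₀ ρ hρ hcyl =>
    ⟨_, H δ hδ hδm Ω hΩ T u hu x₀ t₀ ρ _ hρ hcyl half⟩, fun x₀ t₀ ρ σ hρ hcyl hσ => ?_⟩,
    fun hu => ⟨?_, fun x₀ t₀ ρ σ hρ hcyl hσ => ?_⟩⟩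
  · refine essSup_le_of_ae_le _ ?_
    filter_upwards [H δ hδ hδm Ω hΩ T u hu x₀ t₀ ρ σ hρ hcyl hσ] with z hz
    exact EReal.coe_le_coe_iff.2 hz
  · intro K hKS hK
    obtain ⟨M, hM⟩ := AnisoDG.locBddAbove_of_cyl hp0 hopen (fun x₀ t₀ ρ hρ hcyl =>
      ⟨_, H δ hδ hδm Ω hΩ T _ hu.neg x₀ t₀ ρ _ hρ hcyl half⟩) K hKS hK
    refine ⟨-M, ?_⟩
    filter_upwards [hM] with z hz
    linarith
  · refine le_essInf_of_ae_le _ ?_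
    filter_upwards [H δ hδ hδm Ω hΩ T _ hu.neg x₀ t₀ ρ σ hρ hcyl hσ] with z hz
    exact EReal.coe_le_coe_iff.2 (by linarith)
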